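/- An edge weighted graph is a finite simple graph $G=(V,E)$ in which every edge $e\in E$ has a weight $w_G(e)\in[0,1]$; non-edges have weight $0$. A drawing of $G$ maps the vertices to distinct points of the plane and represents every edge by a simple continuous curve that connects its endpoints, such that no edge passes through a vertex other than its endpoints, no two edges are tangent (at every common interior point two edges cross properly), no three edges have an interior point in common, and there are finitely many crossings, where a crossing of two distinct edges is a common interior point of them. For a drawing $\mathcal D$ let $\mathrm{cr}(G,\mathcal D)=\sum_{\{e,f\}}w_G(e)\,w_G(f)\,k_{\mathcal D}(e,f)$, where the sum is over all unordered pairs of distinct edges and $k_{\mathcal D}(e,f)$ is the number of crossings of $e$ and $f$ in $\mathcal D$. The crossing number $\mathrm{cr}(G)$ is the least value of $\mathrm{cr}(G,\mathcal D)$ over all drawings $\mathcal D$ of $G$. For an integer $m\ge 1$, the $m$ blow-up $G[m]$ is the edge weighted graph obtained by replacing each vertex $v$ of $G$ by an independent set $U_v$ with $m$ elements and joining every element of $U_u$ to every element of $U_v$ by an edge of weight $w_G(uv)$ whenever $uv\in E$. Theorem. For every edge weighted graph $G$ on $n$ vertices and every integer $m\ge 1$, $$0\le \mathrm{cr}(G[m])-m^4\,\mathrm{cr}(G)\le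 n^3m^4 .$$ -/

import Mathlib

/-- The Euclidean plane. -/
abbrev Plane : Type := EuclideanSpace ℝ (Fin 2)

/-- An edge weighted graph on the vertex set `V`: a simple graph, each of whose edges carries a
weight in `[0, 1]`; pairs that are not edges have weight `0`. -/
structure EdgeWeightedGraph (V : Type*) where
  graph : SimpleGraph V
  weight : Sym2 V → ℝ
  weight_nonneg : ∀ e, 0 ≤ weight e
  weight_le_one : ∀ e, weight e ≤ 1
  weight_eq_zero : ∀ e, e ∉ graph.edgeSet → weight e = 0

/-- Two plane curves `A` and `B` properly cross (they meet and are not tangent) at `p`: in suitable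
local coordinates around `p`, the two curves are the two coordinate axes. -/
def CrossProperlyAt (A B : Set Plane) (p : Plane) : Prop :=
  ∃ h : OpenPartialHomeomorph Plane Plane, p ∈ h.source ∧ h p = 0 ∧
    ∀ q ∈ h.source, (q ∈ A ↔ h q 0 = 0) ∧ (q ∈ B ↔ h q 1 = 0)

/-- The relative interior of the curve `A` that represents the edge `e`, when the vertices are
placed by `pos`: the curve without its endpoints. -/
def curveInterior {V : Type*} (pos : V → Plane) (A : Set Plane) (e : Sym2 V) : Set Plane :=
  A \ pos '' {v | v ∈ e}

/-- A drawing of a graph in the plane. A curve is identified with its set of points. Only the values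
of `curve` at the edges of the graph matter. -/
structure Drawing {V : Type*} (G : SimpleGraph V) where
  /-- The points that represent the vertices. -/
  pos : V → Plane
  /-- The curves that represent the edges. -/
  curve : Sym2 V → Set Plane
  /-- Distinct vertices are represented by distinct points. -/
  pos_injective : Function.Injective pos
  /-- Every edge is a simple continuous curve that connects its endpoints. -/
  isSimpleCurve : ∀ u v, G.Adj u v →
    ∃ γ : Path (pos u) (pos v), Function.Injective γ ∧ Set.range γ = curve s(u, v)
  /-- No edge goes through a vertex other than its endpoints. -/
  pos_notMem : ∀ e ∈ G.edgeSet, ∀ v, v ∉ e → pos v ∉ curve e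
  /-- No two edges are tangent: common interior points are proper crossings. -/
  not_tangent : ∀ e ∈ G.edgeSet, ∀ f ∈ G.edgeSet, e ≠ f →
    ∀ p ∈ curveInterior pos (curve e) e ∩ curveInterior pos (curve f) f,
      CrossProperlyAt (curve e) (curve f) p
  /-- No three edges have an interior point in common. -/
  no_triple : ∀ e ∈ G.edgeSet, ∀ f ∈ G.edgeSet, ∀ g ∈ G.edgeSet, e ≠ f → e ≠ g → f ≠ g →
    curveInterior pos (curve e) e ∩ curveInterior pos (curve f) f ∩
      curveInterior pos (curve g) g = ∅
  /-- There are finitely many crossings. -/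
  finite_crossings : ∀ e ∈ G.edgeSet, ∀ f ∈ G.edgeSet, e ≠ f →
    (curveInterior pos (curve e) e ∩ curveInterior pos (curve f) f).Finite

/-- The crossings of `e` and `f` in a drawing: their common interior points. -/
def Drawing.crossings {V : Type*} {G : SimpleGraph V} (D : Drawing G) (e f : Sym2 V) : Set Plane :=
  curveInterior D.pos (D.curve e) e ∩ curveInterior D.pos (D.curve f) f

namespace EdgeWeightedGraph

open Classical in
/-- The weighted number of crossings `cr(G, D)` of a drawing `D`: the sum of `w(e) w(f)` over all
unordered pairs of distinct edges `e`, `f`, counted with the number of points where they cross. The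
double sum runs over ordered pairs, hence the division by `2`. -/
noncomputable def drawingCr {V : Type*} [Fintype V] (G : EdgeWeightedGraph V)
    (D : Drawing G.graph) : ℝ :=
  (∑ e ∈ G.graph.edgeFinset, ∑ f ∈ G.graph.edgeFinset.erase e,
    G.weight e * G.weight f * ((D.crossings e f).ncard : ℝ)) / 2

/-- The crossing number `cr(G)`: the least value of `cr(G, D)` over all drawings `D`. -/
noncomputable def cr {V : Type*} [Fintype V] (G : EdgeWeightedGraph V) : ℝ :=
  sInf (Set.range fun D : Drawing G.graph => G.drawingCr D)

/-- The `m` blow-up `G[m]`: every vertex `v` is replaced by the independent set `{v} × Fin m`, and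
the edges between two such sets inherit the weight of the original edge. -/
def blowup {V : Type*} (G : EdgeWeightedGraph V) (m : ℕ) : EdgeWeightedGraph (V × Fin m) where
  graph := G.graph.comap Prod.fst
  weight e := G.weight (e.map Prod.fst)
  weight_nonneg _ := G.weight_nonneg _
  weight_le_one _ := G.weight_le_one _
  weight_eq_zero e he := by
    apply G.weight_eq_zero
    intro h
    apply he
    induction e using Sym2.ind with
    | _ x y => simpa using h

end EdgeWeightedGraph

/-! Crossing numbers are first made combinatorial. A drawing is described by segments between
finitely many nodes, and its crossings are replaced by the pairs of intersecting segments, from two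
edges, without a common node (`PreDrawing.pairs`). Disjointness of two segments survives small
motions and general position is dense, so such a description, however degenerate, perturbs to a
genuine drawing with at most that many crossings (`PreDrawing.exists_poly`,
`PolyDrawing.toDrawing`). Conversely, every topological drawing becomes polygonal without gaining
crossings: outside small discs around the vertices and crossings the curves are disjoint compact
arcs, which thin polygonal chains can replace, and inside a disc each edge is continued by a single
segment (`exists_polyDrawing`).

Upper bound: in a nearly optimal polygonal drawing of `G`, all copies of a vertex are put at that
vertex, and the copies of an edge run in parallel lanes. A crossing of two edges yields at most one
intersecting pair for every choice of copies, and every common vertex of the underlying edges at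
most one more. The number of common vertices, summed over ordered pairs of edges, is the sum of the
squared degrees, hence at most n³; since weights are at most 1, the excess is at most n³m⁴
(`cr_blowup_le_cost`).

Lower bound: choosing one copy of each vertex at random in a nearly optimal drawing of `G[m]` gives
a drawing of `G`. A pair of copies of two disjoint edges survives with probability m⁻⁴, so averaging
gives the bound (`le_cr_blowup`), provided that crossings of copies of adjacent edges play no role;
their survival probability can be as large as m⁻³. If two edges `va` and `vb` cross, the one with
the more expensive initial part can be rerouted along the other, which saves at least the product of
their weights (`PolyDrawing.exists_cost_le`). A drawing whose cost exceeds the infimum by less than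
every positive product of two weights therefore has no such crossing of positive weight
(`exists_cost_lt_of_adjacent`). -/

namespace CrossingNumber
open Set Filter Topology

/-! ### Plane geometry -/

/-- The determinant of two plane vectors. -/
def det2 (a b : Plane) : ℝ := a 0 * b 1 - a 1 * b 0

theorem plane_ext {p q : Plane} (h0 : p 0 = q 0) (h1 : p 1 = q 1) : p = q := by
  ext i
  fin_cases i
  · exact h0
  · exact h1

theorem mem_segment_iff {a b q : Plane} : q ∈ segment ℝ a b ↔
    ∃ t : ℝ, 0 ≤ t ∧ t ≤ 1 ∧ q 0 = a 0 + t * (b 0 - a 0) ∧ q 1 = a 1 + t * (b 1 - a 1) := by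
  rw [segment_eq_image]
  constructor
  · rintro ⟨t, ht, rfl⟩
    refine ⟨t, ht.1, ht.2, ?_, ?_⟩ <;> simp <;> ring
  · rintro ⟨t, h0, h1, hx, hy⟩
    refine ⟨t, ⟨h0, h1⟩, plane_ext ?_ ?_⟩
    · simp [hx]; ring
    · simp [hy]; ring

theorem isClosed_segment (a b : Plane) : IsClosed (segment ℝ a b) := by
  rw [segment_eq_image]
  exact (isCompact_Icc.image (by fun_prop)).isClosed

/-- Disjointness of two segments persists under small motions of their endpoints. -/
theorem eventually_disjoint_segment {α : Type*} {l : Filter α} {a b c d : α → Plane}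
    {a₀ b₀ c₀ d₀ : Plane} (ha : Tendsto a l (𝓝 a₀)) (hb : Tendsto b l (𝓝 b₀))
    (hc : Tendsto c l (𝓝 c₀)) (hd : Tendsto d l (𝓝 d₀))
    (h : Disjoint (segment ℝ a₀ b₀) (segment ℝ c₀ d₀)) :
    ∀ᶠ x in l, Disjoint (segment ℝ (a x) (b x)) (segment ℝ (c x) (d x)) := by
  let I := Icc (0 : ℝ) 1
  -- The quadruples of endpoints whose segments meet form the projection of this closed set along a
  -- compact square of parameters, hence a closed set.
  let C : Set ((Plane × Plane × Plane × Plane) × (I × I)) :=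
    {z | (1 - z.2.1.1) • z.1.1 + z.2.1.1 • z.1.2.1 =
      (1 - z.2.2.1) • z.1.2.2.1 + z.2.2.1 • z.1.2.2.2}
  have hC : IsClosed C := isClosed_eq (by fun_prop) (by fun_prop)
  have hC' := isClosedMap_fst_of_compactSpace C hC
  have key : ∀ q : Plane × Plane × Plane × Plane, q ∈ Prod.fst '' C ↔
      ¬ Disjoint (segment ℝ q.1 q.2.1) (segment ℝ q.2.2.1 q.2.2.2) := by
    intro q
    rw [Set.not_disjoint_iff, segment_eq_image, segment_eq_image]
    constructor
    · rintro ⟨⟨q, s, t⟩, hz, rfl⟩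
      exact ⟨_, ⟨s.1, s.2, rfl⟩, ⟨t.1, t.2, hz.symm⟩⟩
    · rintro ⟨x, ⟨s, hs, rfl⟩, ⟨t, ht, h⟩⟩
      exact ⟨⟨q, ⟨s, hs⟩, ⟨t, ht⟩⟩, h.symm, rfl⟩
  have hlim : Tendsto (fun x => (a x, b x, c x, d x)) l (𝓝 (a₀, b₀, c₀, d₀)) :=
    ha.prodMk_nhds (hb.prodMk_nhds (hc.prodMk_nhds hd))
  have hmem : (Prod.fst '' C)ᶜ ∈ 𝓝 (a₀, b₀, c₀, d₀) := by
    apply hC'.isOpen_compl.mem_nhds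
    rw [mem_compl_iff, key, not_not]
    exact h
  filter_upwards [hlim hmem] with x hx
  rw [mem_preimage, mem_compl_iff, key, not_not] at hx
  exact hx

/-- Two segments sharing the endpoint `b` meet only there if they are not collinear. -/
theorem segment_inter_of_det_ne {a b c q : Plane} (h : det2 (b - a) (c - a) ≠ 0)
    (h1 : q ∈ segment ℝ a b) (h2 : q ∈ segment ℝ a c) : q = a := by
  obtain ⟨t, -, -, hx, hy⟩ := mem_segment_iff.1 h1
  obtain ⟨s, -, -, hx', hy'⟩ := mem_segment_iff.1 h2
  simp only [det2, PiLp.sub_apply] at h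
  have : t = 0 := by
    have : t * ((b 0 - a 0) * (c 1 - a 1) - (b 1 - a 1) * (c 0 - a 0)) = 0 := by
      linear_combination (c 1 - a 1) * (hx' - hx) - (c 0 - a 0) * (hy' - hy)
    exact (mul_eq_zero.1 this).resolve_right h
  subst this
  apply plane_ext <;> linarith

theorem det2_eq_zero_of_mem_segment {a b q : Plane} (h : q ∈ segment ℝ a b) :
    det2 (b - a) (q - a) = 0 := by
  obtain ⟨t, -, -, hx, hy⟩ := mem_segment_iff.1 h
  simp only [det2, PiLp.sub_apply, hx, hy]
  ring

/-! ### Points in general position -/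

/-- The segment between the positions of the two nodes of `s`. -/
def sseg {N : Type*} (P : N → Plane) : Sym2 N → Set Plane :=
  Sym2.lift ⟨fun a b => segment ℝ (P a) (P b), fun _ _ => segment_symm ℝ _ _⟩

@[simp] theorem sseg_mk {N : Type*} (P : N → Plane) (a b : N) :
    sseg P s(a, b) = segment ℝ (P a) (P b) := rfl

theorem isClosed_sseg {N : Type*} (P : N → Plane) (s : Sym2 N) : IsClosed (sseg P s) := by
  induction s using Sym2.ind with
  | _ a b => exact isClosed_segment _ _

/-- Two pairs of nodes without a common node. -/
def Apart {N : Type*} (s t : Sym2 N) : Prop := ∀ n, n ∈ s → n ∉ t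

theorem Apart.symm {N : Type*} {s t : Sym2 N} (h : Apart s t) : Apart t s :=
  fun n ht hs => h n hs ht

theorem eventually_disjoint_sseg {N α : Type*} {l : Filter α} {Q : α → N → Plane}
    {P : N → Plane} (hQ : ∀ n, Tendsto (fun x => Q x n) l (𝓝 (P n))) {s t : Sym2 N}
    (h : Disjoint (sseg P s) (sseg P t)) :
    ∀ᶠ x in l, Disjoint (sseg (Q x) s) (sseg (Q x) t) := by
  induction s using Sym2.ind with
  | _ a b =>
    induction t using Sym2.ind with
    | _ c d => exact eventually_disjoint_segment (hQ a) (hQ b) (hQ c) (hQ d) h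

/-- Positions in general position: distinct, no three collinear, and no three segments without
common nodes concurrent. -/
structure GenPos {N : Type*} (P : N → Plane) : Prop where
  inj : Function.Injective P
  noncol : ∀ a b c, a ≠ b → a ≠ c → b ≠ c → det2 (P b - P a) (P c - P a) ≠ 0
  nonconc : ∀ s t u : Sym2 N, ¬ s.IsDiag → ¬ t.IsDiag → ¬ u.IsDiag → Apart s t → Apart s u →
    Apart t u → ∀ q, q ∈ sseg P s → q ∈ sseg P t → q ∉ sseg P u

section
variable {N : Type*} [Fintype N]

theorem analytic_coord (n : N) (i : Fin 2) :
    AnalyticOnNhd ℝ (fun Q : N → Plane => Q n i) univ :=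
  ((EuclideanSpace.proj i : Plane →L[ℝ] ℝ).comp
    (ContinuousLinearMap.proj n : (N → Plane) →L[ℝ] Plane)).analyticOnNhd univ

/-- By the identity theorem, an analytic function that vanishes near one point vanishes everywhere,
in particular at the witness `W`. -/
theorem isOpen_dense_ne_zero {f : (N → Plane) → ℝ} (hf : AnalyticOnNhd ℝ f univ)
    (W : N → Plane) (hW : f W ≠ 0) : IsOpen {Q | f Q ≠ 0} ∧ Dense {Q | f Q ≠ 0} := by
  have hc : Continuous f := continuousOn_univ.1 hf.continuousOn
  refine ⟨isOpen_ne_fun hc continuous_const, ?_⟩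
  rw [dense_iff_closure_eq, eq_univ_iff_forall]
  intro Q
  rw [mem_closure_iff_frequently]
  intro h
  apply hW
  refine hf.eqOn_zero_of_preconnected_of_eventuallyEq_zero isPreconnected_univ
    (mem_univ Q) ?_ (mem_univ W)
  filter_upwards [h] with x hx
  simpa using hx

/-- The determinant that vanishes if the lines `p₀p₁`, `p₂p₃`, `p₄p₅` are concurrent. -/
def concDet (p : Fin 6 → Plane) : ℝ :=
  (p 1 1 - p 0 1) * ((p 3 0 - p 2 0) * ((p 5 0 - p 4 0) * p 4 1 - (p 5 1 - p 4 1) * p 4 0)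
      - (p 5 0 - p 4 0) * ((p 3 0 - p 2 0) * p 2 1 - (p 3 1 - p 2 1) * p 2 0))
  - (p 1 0 - p 0 0) * ((p 3 1 - p 2 1) * ((p 5 0 - p 4 0) * p 4 1 - (p 5 1 - p 4 1) * p 4 0)
      - (p 5 1 - p 4 1) * ((p 3 0 - p 2 0) * p 2 1 - (p 3 1 - p 2 1) * p 2 0))
  + ((p 1 0 - p 0 0) * p 0 1 - (p 1 1 - p 0 1) * p 0 0) *
      ((p 3 1 - p 2 1) * (p 5 0 - p 4 0) - (p 5 1 - p 4 1) * (p 3 0 - p 2 0))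

theorem concDet_eq_zero {p : Fin 6 → Plane} {q : Plane} (h1 : q ∈ segment ℝ (p 0) (p 1))
    (h2 : q ∈ segment ℝ (p 2) (p 3)) (h3 : q ∈ segment ℝ (p 4) (p 5)) : concDet p = 0 := by
  have e1 := det2_eq_zero_of_mem_segment h1
  have e2 := det2_eq_zero_of_mem_segment h2
  have e3 := det2_eq_zero_of_mem_segment h3
  simp only [det2, PiLp.sub_apply] at e1 e2 e3
  unfold concDet
  linear_combination
    ((p 3 1 - p 2 1) * (p 5 0 - p 4 0) - (p 5 1 - p 4 1) * (p 3 0 - p 2 0)) * (-e1)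
    - ((p 1 1 - p 0 1) * (p 5 0 - p 4 0) - (p 5 1 - p 4 1) * (p 1 0 - p 0 0)) * (-e2)
    + ((p 1 1 - p 0 1) * (p 3 0 - p 2 0) - (p 3 1 - p 2 1) * (p 1 0 - p 0 0)) * (-e3)

/-- Positions in general position are dense. -/
theorem dense_genPos : Dense {P : N → Plane | GenPos P} := by
  classical
  -- General position follows from finitely many polynomial inequations, one for each tuple of
  -- distinct nodes and each kind of degeneracy. Distinct first coordinates already separate two
  -- points.
  let f2 : {x : Fin 2 → N // Function.Injective x} → (N → Plane) → ℝ := fun x Q =>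
    Q (x.1 0) 0 - Q (x.1 1) 0
  let f3 : {x : Fin 3 → N // Function.Injective x} → (N → Plane) → ℝ := fun x Q =>
    det2 (Q (x.1 1) - Q (x.1 0)) (Q (x.1 2) - Q (x.1 0))
  let f6 : {x : Fin 6 → N // Function.Injective x} → (N → Plane) → ℝ := fun x Q =>
    concDet (fun i => Q (x.1 i))
  have ext : ∀ {k : ℕ} (x : Fin k → N), Function.Injective x → ∀ p : Fin k → Plane,
      ∃ W : N → Plane, ∀ i, W (x i) = p i := fun x hx p =>
    ⟨Function.extend x p 0, fun i => hx.extend_apply p 0 i⟩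
  have h2 : ∀ x, IsOpen {Q | f2 x Q ≠ 0} ∧ Dense {Q | f2 x Q ≠ 0} := by
    intro x
    obtain ⟨W, hW⟩ := ext x.1 x.2 ![!₂[1, 0], !₂[0, 0]]
    refine isOpen_dense_ne_zero ((analytic_coord _ _).sub (analytic_coord _ _)) W ?_
    simp [f2, hW]
  have h3 : ∀ x, IsOpen {Q | f3 x Q ≠ 0} ∧ Dense {Q | f3 x Q ≠ 0} := by
    intro x
    obtain ⟨W, hW⟩ := ext x.1 x.2 ![!₂[0, 0], !₂[1, 0], !₂[0, 1]]
    refine isOpen_dense_ne_zero (f := f3 x) ?_ W ?_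
    · simp only [f3, det2, PiLp.sub_apply]
      have c := fun n i => analytic_coord (N := N) n i
      exact (((c _ _).sub (c _ _)).mul ((c _ _).sub (c _ _))).sub
        (((c _ _).sub (c _ _)).mul ((c _ _).sub (c _ _)))
    · simp [f3, hW, det2]
  have h6 : ∀ x, IsOpen {Q | f6 x Q ≠ 0} ∧ Dense {Q | f6 x Q ≠ 0} := by
    intro x
    -- The sides of the triangle (0,0), (1,0), (0,1). Coincidences among the six points are
    -- harmless, since only a nonzero value of the polynomial is needed.
    obtain ⟨W, hW⟩ := ext x.1 x.2
      ![!₂[0, 0], !₂[0, 1], !₂[0, 0], !₂[1, 0], !₂[1, 0], !₂[0, 1]]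
    refine isOpen_dense_ne_zero (f := f6 x) ?_ W ?_
    · simp only [f6, concDet]
      have c := fun n i => analytic_coord (N := N) n i
      have d := fun n m i => (c n i).sub (c m i)
      have g := fun n m => ((d n m 0).mul (c m 1)).sub ((d n m 1).mul (c m 0))
      exact (((d _ _ _).mul (((d _ _ _).mul (g _ _)).sub ((d _ _ _).mul (g _ _)))).sub
        ((d _ _ _).mul (((d _ _ _).mul (g _ _)).sub ((d _ _ _).mul (g _ _))))).add
        ((g _ _).mul (((d _ _ _).mul (d _ _ _)).sub ((d _ _ _).mul (d _ _ _))))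
    · simp [f6, hW, concDet]
  have D := (dense_iInter_of_isOpen (fun x => (h2 x).1) (fun x => (h2 x).2)).inter_of_isOpen_left
    ((dense_iInter_of_isOpen (fun x => (h3 x).1) (fun x => (h3 x).2)).inter_of_isOpen_left
      (dense_iInter_of_isOpen (fun x => (h6 x).1) (fun x => (h6 x).2))
      (isOpen_iInter_of_finite fun x => (h3 x).1)) (isOpen_iInter_of_finite fun x => (h2 x).1)
  refine D.mono ?_
  rintro P ⟨k2, k3, k6⟩
  simp only [mem_iInter, mem_ofPred_eq] at k2 k3 k6
  refine ⟨fun a b hab => ?_, fun a b c hab hac hbc => ?_, fun s t u hs ht hu hst hsu htu q => ?_⟩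
  · by_contra hne
    refine k2 ⟨![a, b], ?_⟩ (by simp [f2, hab])
    intro i j hij
    fin_cases i <;> fin_cases j <;> simp_all
  · refine k3 ⟨![a, b, c], ?_⟩
    intro i j hij
    fin_cases i <;> fin_cases j <;> simp_all
  · induction s using Sym2.ind with
    | _ a b =>
    induction t using Sym2.ind with
    | _ c d =>
    induction u using Sym2.ind with
    | _ e f =>
    intro q1 q2 q3
    refine k6 ⟨![a, b, c, d, e, f], ?_⟩ (concDet_eq_zero (q := q) q1 q2 q3)
    simp only [Sym2.mk_isDiag_iff] at hs ht hu
    simp only [Apart, Sym2.mem_iff] at hst hsu htu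
    intro i j hij
    fin_cases i <;> fin_cases j <;> simp at hij ⊢ <;> grind
end

theorem exists_genPos {N : Type*} [Finite N] {P : N → Plane} {p : (N → Plane) → Prop}
    (h : ∀ᶠ Q in 𝓝 P, p Q) : ∃ Q, GenPos Q ∧ p Q := by
  have := Fintype.ofFinite N
  obtain ⟨Q, h1, h2⟩ := dense_genPos.inter_nhds_nonempty h
  exact ⟨Q, h1, h2⟩

end CrossingNumber

namespace CrossingNumber
open Set Filter Topology

/-! ### Arcs -/

/-- `A` is the range of a simple continuous curve from `a` to `b`. -/
def IsArc (a b : Plane) (A : Set Plane) : Prop :=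
  ∃ γ : Path a b, Function.Injective γ ∧ range γ = A

theorem IsArc.append {a b c : Plane} {A B : Set Plane} (hA : IsArc a b A) (hB : IsArc b c B)
    (h : ∀ q ∈ A, q ∈ B → q = b) : IsArc a c (A ∪ B) := by
  obtain ⟨γ, hγ, rfl⟩ := hA
  obtain ⟨δ, hδ, rfl⟩ := hB
  refine ⟨γ.trans δ, ?_, Path.trans_range _ _⟩
  have cross : ∀ (s t : unitInterval), (s : ℝ) ≤ 1 / 2 → ¬ (t : ℝ) ≤ 1 / 2 →
      γ.trans δ s ≠ γ.trans δ t := by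
    intro s t hs ht hst
    rw [Path.trans_apply, Path.trans_apply, dif_pos hs, dif_neg ht] at hst
    have hb := h _ (mem_range_self _) ⟨_, hst.symm⟩
    have := congrArg Subtype.val (hδ ((hst.symm.trans hb).trans δ.source.symm))
    simp at this
    linarith
  intro s t hst
  by_cases hs : (s : ℝ) ≤ 1 / 2 <;> by_cases ht : (t : ℝ) ≤ 1 / 2
  · rw [Path.trans_apply, Path.trans_apply, dif_pos hs, dif_pos ht] at hst
    have := congrArg Subtype.val (hγ hst)
    ext
    simpa using this
  · exact (cross s t hs ht hst).elim
  · exact (cross t s ht hs hst.symm).elim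
  · rw [Path.trans_apply, Path.trans_apply, dif_neg hs, dif_neg ht] at hst
    have := congrArg Subtype.val (hδ hst)
    ext
    simpa using this

theorem isArc_segment {a b : Plane} (h : a ≠ b) : IsArc a b (segment ℝ a b) := by
  refine ⟨⟨⟨fun t => AffineMap.lineMap a b (t : ℝ), by fun_prop⟩, by simp, by simp⟩, ?_, ?_⟩
  · intro s t hst
    exact Subtype.ext ((AffineMap.lineMap_injective ℝ h) hst)
  · rw [segment_eq_image_lineMap]
    ext q
    constructor
    · rintro ⟨t, rfl⟩
      exact ⟨t, t.2, rfl⟩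
    · rintro ⟨t, ht, rfl⟩
      exact ⟨⟨t, ht⟩, rfl⟩

/-! ### Proper crossings of segments -/

/-- Determinants with two independent vectors are coordinates of the plane. -/
noncomputable def detHomeomorph (u w q : Plane) (h : det2 u w ≠ 0) : Plane ≃ₜ Plane where
  toFun z := !₂[det2 u (z - q), det2 w (z - q)]
  invFun z := q + !₂[(w 0 * z 0 - u 0 * z 1) / det2 u w, (w 1 * z 0 - u 1 * z 1) / det2 u w]
  left_inv z := by
    have h' : u 0 * w 1 - u 1 * w 0 ≠ 0 := h
    apply plane_ext
    · simp only [det2, PiLp.add_apply, PiLp.sub_apply, Matrix.cons_val_zero,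
        Matrix.cons_val_one]
      rw [← eq_sub_iff_add_eq', div_eq_iff h']
      ring
    · simp only [det2, PiLp.add_apply, PiLp.sub_apply, Matrix.cons_val_zero,
        Matrix.cons_val_one]
      rw [← eq_sub_iff_add_eq', div_eq_iff h']
      ring
  right_inv z := by
    have h' : u 0 * w 1 - u 1 * w 0 ≠ 0 := h
    apply plane_ext
    · simp only [det2, PiLp.toLp_apply, Matrix.cons_val_zero,
        Matrix.cons_val_one, add_sub_cancel_left]
      rw [mul_div_assoc', mul_div_assoc', ← sub_div, div_eq_iff h']
      ring
    · simp only [det2, PiLp.toLp_apply, Matrix.cons_val_zero,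
        Matrix.cons_val_one, add_sub_cancel_left]
      rw [mul_div_assoc', mul_div_assoc', ← sub_div, div_eq_iff h']
      ring
  continuous_toFun := by unfold det2; fun_prop
  continuous_invFun := by unfold det2; fun_prop

/-- The two determinants serve as local coordinates: they vanish exactly on the lines through `q`
with directions `u` and `w`. -/
theorem crossProperlyAt_of_local {A B : Set Plane} {u w q : Plane} (h : det2 u w ≠ 0)
    (hA : ∀ᶠ z in 𝓝 q, z ∈ A ↔ det2 u (z - q) = 0)
    (hB : ∀ᶠ z in 𝓝 q, z ∈ B ↔ det2 w (z - q) = 0) : CrossProperlyAt A B q := by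
  obtain ⟨U, hU, hUo, hq⟩ := eventually_nhds_iff.1 (hA.and hB)
  refine ⟨(detHomeomorph u w q h).toOpenPartialHomeomorph.restrOpen U hUo, ?_, ?_, ?_⟩
  · simpa using hq
  · apply plane_ext <;> simp [detHomeomorph, det2]
  · intro z hz
    have hz' : z ∈ U := by simpa using hz
    simpa [detHomeomorph] using hU z hz'

theorem eventually_mem_segment_iff {a b q : Plane} (hq : q ∈ segment ℝ a b) (ha : q ≠ a)
    (hb : q ≠ b) : ∀ᶠ z in 𝓝 q, z ∈ segment ℝ a b ↔ det2 (b - a) (z - q) = 0 := by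
  obtain ⟨t, h0, h1, hx, hy⟩ := mem_segment_iff.1 hq
  have h0 : 0 < t := by
    refine h0.lt_of_ne ?_
    rintro rfl
    exact ha (plane_ext (by linarith) (by linarith))
  have h1 : t < 1 := by
    refine h1.lt_of_ne ?_
    rintro rfl
    exact hb (plane_ext (by linarith) (by linarith))
  -- `φ` is the unnormalised projection to the direction `b - a`, and `L` the squared length. In the
  -- strip `0 < φ < L`, a neighbourhood of `q`, the segment coincides with its line.
  let L : ℝ := (b 0 - a 0) ^ 2 + (b 1 - a 1) ^ 2
  let φ : Plane → ℝ := fun z => (z 0 - a 0) * (b 0 - a 0) + (z 1 - a 1) * (b 1 - a 1)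
  have hφ : Continuous φ := by fun_prop
  have hφq : φ q = t * L := by simp only [φ, L, hx, hy]; ring
  have hL : 0 < L := by
    by_contra hL
    have h2 : (b 0 - a 0) ^ 2 = 0 := by simp only [L] at hL; nlinarith [sq_nonneg (b 0 - a 0), sq_nonneg (b 1 - a 1)]
    have h3 : (b 1 - a 1) ^ 2 = 0 := by simp only [L] at hL; nlinarith [sq_nonneg (b 0 - a 0), sq_nonneg (b 1 - a 1)]
    have h2 := pow_eq_zero_iff two_ne_zero |>.1 h2
    have h3 := pow_eq_zero_iff two_ne_zero |>.1 h3
    exact ha (plane_ext (by rw [hx, h2]; ring) (by rw [hy, h3]; ring))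
  have e1 : ∀ᶠ z in 𝓝 q, 0 < φ z :=
    hφ.continuousAt.eventually_const_lt (by rw [hφq]; positivity)
  have e2 : ∀ᶠ z in 𝓝 q, φ z < L :=
    hφ.continuousAt.eventually_lt_const (by rw [hφq]; nlinarith)
  filter_upwards [e1, e2] with z z1 z2
  have hdet : det2 (b - a) (z - q) = det2 (b - a) (z - a) := by
    simp only [det2, PiLp.sub_apply, hx, hy]; ring
  rw [hdet]
  refine ⟨det2_eq_zero_of_mem_segment, fun h => ?_⟩
  simp only [det2, PiLp.sub_apply] at h
  refine mem_segment_iff.2 ⟨φ z / L, by positivity, by rw [div_le_one hL]; exact z2.le, ?_, ?_⟩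
  · have : z 0 - a 0 = φ z / L * (b 0 - a 0) := by
      field_simp
      simp only [φ, L]
      linear_combination (-(b 1 - a 1)) * h
    linarith
  · have : z 1 - a 1 = φ z / L * (b 1 - a 1) := by
      field_simp
      simp only [φ, L]
      linear_combination (b 0 - a 0) * h
    linarith

/-! ### Consequences of general position -/

section
variable {N : Type*} {P : N → Plane}

theorem GenPos.eq_of_mem_of_mem (hP : GenPos P) {s t : Sym2 N} (hs : ¬ s.IsDiag)
    (ht : ¬ t.IsDiag) (hst : s ≠ t) {n : N} (h1 : n ∈ s) (h2 : n ∈ t) {q : Plane}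
    (q1 : q ∈ sseg P s) (q2 : q ∈ sseg P t) : q = P n := by
  obtain ⟨a, rfl⟩ := Sym2.mem_iff_exists.1 h1
  obtain ⟨b, rfl⟩ := Sym2.mem_iff_exists.1 h2
  simp only [Sym2.mk_isDiag_iff] at hs ht
  have hab : a ≠ b := by rintro rfl; exact hst rfl
  exact segment_inter_of_det_ne (hP.noncol n a b hs ht hab) q1 q2

theorem GenPos.mem_of_mem_sseg (hP : GenPos P) {s : Sym2 N} (hs : ¬ s.IsDiag) {n : N}
    (h : P n ∈ sseg P s) : n ∈ s := by
  induction s using Sym2.ind with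
  | _ a b =>
    by_contra hn
    simp only [Sym2.mk_isDiag_iff, Sym2.mem_iff, not_or] at hs hn
    exact hP.noncol a b n hs (Ne.symm hn.1) (Ne.symm hn.2) (det2_eq_zero_of_mem_segment h)

/-- Parallel segments with a common point lie on one line, which would contain the distinct nodes
`a`, `b`, `c`. -/
theorem GenPos.det_ne (hP : GenPos P) {a b c d : N} (hs : a ≠ b) (ht : c ≠ d)
    (hst : Apart s(a, b) s(c, d)) {q : Plane} (q1 : q ∈ sseg P s(a, b))
    (q2 : q ∈ sseg P s(c, d)) : det2 (P b - P a) (P d - P c) ≠ 0 := by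
  intro h
  have hac : a ≠ c := by rintro rfl; exact hst a (by simp) (by simp)
  have hbc : b ≠ c := by rintro rfl; exact hst b (by simp) (by simp)
  apply hP.noncol a b c hs hac hbc
  have h1 := det2_eq_zero_of_mem_segment q1
  obtain ⟨t, -, -, hx, hy⟩ := mem_segment_iff.1 q2
  simp only [det2, PiLp.sub_apply, hx, hy] at h1 h ⊢
  linear_combination h1 - t * h

theorem GenPos.inter_unique (hP : GenPos P) {s t : Sym2 N} (hs : ¬ s.IsDiag) (ht : ¬ t.IsDiag)
    (hst : Apart s t) {q q' : Plane} (q1 : q ∈ sseg P s) (q2 : q ∈ sseg P t)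
    (q1' : q' ∈ sseg P s) (q2' : q' ∈ sseg P t) : q = q' := by
  induction s using Sym2.ind with
  | _ a b =>
  induction t using Sym2.ind with
  | _ c d =>
  simp only [Sym2.mk_isDiag_iff] at hs ht
  have h := hP.det_ne hs ht hst q1 q2
  obtain ⟨t, -, -, hx, hy⟩ := mem_segment_iff.1 q1
  obtain ⟨t', -, -, hx', hy'⟩ := mem_segment_iff.1 q1'
  have e := det2_eq_zero_of_mem_segment q2
  have e' := det2_eq_zero_of_mem_segment q2'
  simp only [det2, PiLp.sub_apply] at h e e'
  have : (t - t') * ((P b 0 - P a 0) * (P d 1 - P c 1) - (P b 1 - P a 1) * (P d 0 - P c 0)) = 0 := by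
    rw [hx, hy] at e
    rw [hx', hy'] at e'
    linear_combination e' - e
  have := (mul_eq_zero.1 this).resolve_right h
  have : t = t' := by linarith
  subst this
  exact plane_ext (by rw [hx, hx']) (by rw [hy, hy'])

end

/-! ### Polygonal drawings -/

/-- The pairs in `S` are the consecutive pairs of a sequence of distinct nodes from `a` to `b`. -/
def IsNodePath {N : Type*} (S : Set (Sym2 N)) (a b : N) : Prop :=
  ∃ (l : ℕ) (x : ℕ → N), x 0 = a ∧ x l = b ∧ InjOn x (Iic l) ∧
    S = {s | ∃ i < l, s = s(x i, x (i + 1))}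

theorem IsNodePath.symm {N : Type*} {S : Set (Sym2 N)} {a b : N} (h : IsNodePath S a b) :
    IsNodePath S b a := by
  obtain ⟨l, x, h0, hl, hx, rfl⟩ := h
  refine ⟨l, fun i => x (l - i), by simpa, by simpa, ?_, ?_⟩
  · intro i hi j hj hij
    have := hx (by simp : l - i ∈ Iic l) (by simp : l - j ∈ Iic l) hij
    simp only [mem_Iic] at hi hj
    omega
  · ext s
    constructor
    · rintro ⟨i, hi, rfl⟩
      refine ⟨l - 1 - i, by omega, ?_⟩
      dsimp only
      rw [Sym2.eq_swap, show l - (l - 1 - i) = i + 1 by omega,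
        show l - (l - 1 - i + 1) = i by omega]
    · rintro ⟨i, hi, rfl⟩
      refine ⟨l - 1 - i, by omega, ?_⟩
      dsimp only
      rw [Sym2.eq_swap, show l - 1 - i + 1 = l - i by omega,
        show l - 1 - i = l - (i + 1) by omega]

/-- A walk through pairs of `S` contains a path. Discarding the other pairs is harmless, because all
conditions on a drawing except reachability pass to subsets. -/
theorem exists_isNodePath {N : Type*} {S : Set (Sym2 N)} {a b : N}
    (h : Relation.ReflTransGen (fun a b => s(a, b) ∈ S) a b) :
    ∃ T ⊆ S, IsNodePath T a b := by
  have hr : (SimpleGraph.fromEdgeSet S).Reachable a b := by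
    induction h with
    | refl => rfl
    | @tail c d _ hcd ih =>
      by_cases hne : c = d
      · exact hne ▸ ih
      · exact ih.trans (SimpleGraph.Adj.reachable (by simp [hne, hcd]))
  obtain ⟨p, hp⟩ := hr.exists_isPath
  refine ⟨{s | ∃ i < p.length, s = s(p.getVert i, p.getVert (i + 1))}, ?_, p.length, p.getVert,
    p.getVert_zero, p.getVert_length, hp.getVert_injOn, rfl⟩
  rintro s ⟨i, hi, rfl⟩
  have := p.adj_getVert_succ hi
  rw [SimpleGraph.fromEdgeSet_adj] at this
  exact this.1

/-- A drawing of `G` by segments between the points of a family indexed by `N`, without any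
genericity: `S e` is the set of segments that represent the edge `e`. -/
structure PreDrawing {V : Type*} (G : SimpleGraph V) (N : Type*) where
  vert : V → N
  P : N → Plane
  S : Sym2 V → Set (Sym2 N)
  vert_inj : Function.Injective vert
  reach : ∀ u v, G.Adj u v →
    Relation.ReflTransGen (fun a b => s(a, b) ∈ S s(u, v)) (vert u) (vert v)
  common : ∀ e ∈ G.edgeSet, ∀ f ∈ G.edgeSet, e ≠ f → ∀ s ∈ S e, ∀ t ∈ S f, ∀ n, n ∈ s → n ∈ t →
    ∃ v, v ∈ e ∧ v ∈ f ∧ n = vert v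
  vert_mem : ∀ e ∈ G.edgeSet, ∀ s ∈ S e, ∀ v, vert v ∈ s → v ∈ e
  simple : ∀ e ∈ G.edgeSet, ∀ s ∈ S e, ∀ t ∈ S e, Apart s t → Disjoint (sseg P s) (sseg P t)

/-- The pairs of intersecting segments of `e` and `f` without common nodes. -/
def PreDrawing.pairs {V N : Type*} {G : SimpleGraph V} (K : PreDrawing G N) (e f : Sym2 V) :
    Set (Sym2 N × Sym2 N) :=
  {z | z.1 ∈ K.S e ∧ z.2 ∈ K.S f ∧ Apart z.1 z.2 ∧ ¬ Disjoint (sseg K.P z.1) (sseg K.P z.2)}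

/-- A drawing by polygonal paths in general position. -/
structure PolyDrawing {V : Type*} (G : SimpleGraph V) (N : Type*) extends PreDrawing G N where
  path : ∀ u v, G.Adj u v → IsNodePath (S s(u, v)) (vert u) (vert v)
  gen : GenPos P

/-- Segments are closed, so a small enough motion keeps all disjoint pairs disjoint while reaching
general position. Neither this motion nor the passage to a path inside each `S e` can create an
intersecting pair. -/
theorem PreDrawing.exists_poly {V N : Type*} [Finite N] {G : SimpleGraph V}
    (K : PreDrawing G N) :
    ∃ K' : PolyDrawing G N, ∀ e ∈ G.edgeSet, ∀ f ∈ G.edgeSet, K'.pairs e f ⊆ K.pairs e f := by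
  classical
  have hev : ∀ᶠ Q in 𝓝 K.P, ∀ s t, Disjoint (sseg K.P s) (sseg K.P t) →
      Disjoint (sseg Q s) (sseg Q t) := by
    have := Fintype.ofFinite N
    rw [eventually_all]
    intro s
    rw [eventually_all]
    intro t
    by_cases h : Disjoint (sseg K.P s) (sseg K.P t)
    · have := eventually_disjoint_sseg (Q := fun Q : N → Plane => Q)
        (fun n => (continuous_apply n).tendsto K.P) h
      filter_upwards [this] with Q hQ _ using hQ
    · exact Eventually.of_forall fun Q h' => (h h').elim
  obtain ⟨Q, hQ, hd⟩ := exists_genPos hev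
  have hT : ∀ e, ∃ T ⊆ K.S e, ∀ u v, G.Adj u v → e = s(u, v) →
      IsNodePath T (K.vert u) (K.vert v) := by
    intro e
    by_cases he : e ∈ G.edgeSet
    · induction e using Sym2.ind with
      | _ u v =>
        obtain ⟨T, hTS, hT⟩ := exists_isNodePath (K.reach u v he)
        refine ⟨T, hTS, fun u' v' _ h => ?_⟩
        rcases Sym2.eq_iff.1 h with ⟨rfl, rfl⟩ | ⟨rfl, rfl⟩
        · exact hT
        · exact hT.symm
    · exact ⟨∅, empty_subset _, fun u v h h' => (he (h' ▸ h)).elim⟩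
  choose T hTS hT using hT
  have hreach : ∀ {S : Set (Sym2 N)} {a b : N}, IsNodePath S a b →
      Relation.ReflTransGen (fun a b => s(a, b) ∈ S) a b := by
    rintro S a b ⟨l, x, rfl, rfl, -, rfl⟩
    have : ∀ k ≤ l, Relation.ReflTransGen
        (fun a b => s(a, b) ∈ {s | ∃ i < l, s = s(x i, x (i + 1))}) (x 0) (x k) := by
      intro k
      induction k with
      | zero => exact fun _ => .refl
      | succ k ih => exact fun hk => (ih (by omega)).tail ⟨k, by omega, rfl⟩
    exact this l le_rfl
  refine ⟨{ vert := K.vert, P := Q, S := T, vert_inj := K.vert_inj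
            reach := fun u v h => hreach (hT _ u v h rfl)
            common := fun e he f hf hef s hs t ht =>
              K.common e he f hf hef s (hTS e hs) t (hTS f ht)
            vert_mem := fun e he s hs => K.vert_mem e he s (hTS e hs)
            simple := fun e he s hs t ht hst =>
              hd s t (K.simple e he s (hTS e hs) t (hTS e ht) hst)
            path := fun u v h => hT _ u v h rfl
            gen := hQ }, ?_⟩
  rintro e - f - ⟨s, t⟩ ⟨hs, ht, hst, hdis⟩
  exact ⟨hTS e hs, hTS f ht, hst, fun h => hdis (hd s t h)⟩

namespace PolyDrawing
variable {V N : Type*} {G : SimpleGraph V} (K : PolyDrawing G N)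

/-- The union of the segments of an edge. -/
def curve (e : Sym2 V) : Set Plane := {q | ∃ s ∈ K.S e, q ∈ sseg K.P s}

theorem not_isDiag {e : Sym2 V} (he : e ∈ G.edgeSet) {s : Sym2 N} (hs : s ∈ K.S e) :
    ¬ s.IsDiag := by
  induction e using Sym2.ind with
  | _ u v =>
    obtain ⟨l, x, -, -, hx, hS⟩ := K.path u v he
    rw [hS] at hs
    obtain ⟨i, hi, rfl⟩ := hs
    rw [Sym2.mk_isDiag_iff]
    intro h
    have := hx (by simp; omega) (by simp; omega) h
    omega

theorem exists_common_of_mem {e : Sym2 V} (he : e ∈ G.edgeSet) {s t : Sym2 N} (hs : s ∈ K.S e)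
    (ht : t ∈ K.S e) (hst : s ≠ t) {q : Plane} (q1 : q ∈ sseg K.P s) (q2 : q ∈ sseg K.P t) :
    ∃ n, n ∈ s ∧ n ∈ t ∧ q = K.P n := by
  by_cases h : Apart s t
  · exact ((Set.disjoint_left.1 (K.simple e he s hs t ht h)) q1 q2).elim
  · simp only [Apart, not_forall, not_not] at h
    obtain ⟨n, h1, h2⟩ := h
    exact ⟨n, h1, h2,
      K.gen.eq_of_mem_of_mem (K.not_isDiag he hs) (K.not_isDiag he ht) hst h1 h2 q1 q2⟩

/-- Both nodes of a common segment would be common vertices, and two edges with two common vertices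
are equal. -/
theorem ne_of_ne {e f : Sym2 V} (he : e ∈ G.edgeSet) (hf : f ∈ G.edgeSet) (hef : e ≠ f)
    {s t : Sym2 N} (hs : s ∈ K.S e) (ht : t ∈ K.S f) : s ≠ t := by
  rintro rfl
  have hd := K.not_isDiag he hs
  induction s using Sym2.ind with
  | _ a b =>
    obtain ⟨v, v1, v2, rfl⟩ := K.common e he f hf hef _ hs _ ht a (by simp) (by simp)
    obtain ⟨w, w1, w2, rfl⟩ := K.common e he f hf hef _ hs _ ht b (by simp) (by simp)
    have hvw : v ≠ w := by rintro rfl; exact hd (by simp)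
    exact hef (Sym2.eq_of_ne_mem hvw v1 w1 v2 w2)

/-- A point where segments of different edges without common nodes meet lies on no other segment
of the first edge. -/
theorem eq_of_mem_crossing {e f : Sym2 V} (he : e ∈ G.edgeSet) (hf : f ∈ G.edgeSet)
    {s s' t : Sym2 N} (hs : s ∈ K.S e) (hs' : s' ∈ K.S e) (ht : t ∈ K.S f) (hst : Apart s t)
    {q : Plane} (q1 : q ∈ sseg K.P s) (q2 : q ∈ sseg K.P t) (q3 : q ∈ sseg K.P s') : s' = s := by
  by_contra hne
  obtain ⟨n, h1, h2, rfl⟩ := K.exists_common_of_mem he hs' hs hne q3 q1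
  exact hst n h2 (K.gen.mem_of_mem_sseg (K.not_isDiag hf ht) q2)

theorem isArc_curve (u v : V) (h : G.Adj u v) :
    IsArc (K.P (K.vert u)) (K.P (K.vert v)) (K.curve s(u, v)) := by
  obtain ⟨l, x, h0, hl, hx, hS⟩ := K.path u v h
  have hxi : ∀ i ≤ l, ∀ j ≤ l, x i = x j → i = j := fun i hi j hj hij => hx hi hj hij
  have hmem : ∀ i < l, s(x i, x (i + 1)) ∈ K.S s(u, v) := fun i hi => hS ▸ ⟨i, hi, rfl⟩
  -- Segments are appended one at a time. The new segment shares only the node `x (k + 1)` with the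
  -- earlier ones: segments without common nodes are disjoint, and those with a common node meet
  -- only there.
  have key : ∀ k, k + 1 ≤ l → IsArc (K.P (x 0)) (K.P (x (k + 1)))
      {q | ∃ i < k + 1, q ∈ sseg K.P s(x i, x (i + 1))} := by
    intro k
    induction k with
    | zero =>
      intro hk
      have hne : K.P (x 0) ≠ K.P (x 1) := fun hh => by
        have := hxi 0 (by omega) 1 hk (K.gen.inj hh)
        omega
      convert isArc_segment hne using 1
      ext q
      simp
    | succ k ih =>
      intro hk
      have hne : K.P (x (k + 1)) ≠ K.P (x (k + 2)) := fun hh => by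
        have := hxi (k + 1) (by omega) (k + 2) hk (K.gen.inj hh)
        omega
      convert (ih (by omega)).append (isArc_segment hne) ?_ using 1
      · ext q
        constructor
        · rintro ⟨i, hi, hq⟩
          rcases Nat.lt_succ_iff_lt_or_eq.1 hi with h | rfl
          · exact Or.inl ⟨i, h, hq⟩
          · exact Or.inr hq
        · rintro (⟨i, hi, hq⟩ | hq)
          · exact ⟨i, by omega, hq⟩
          · exact ⟨k + 1, by omega, hq⟩
      · rintro q ⟨i, hi, hq⟩ hq'
        have hne' : s(x i, x (i + 1)) ≠ s(x (k + 1), x (k + 2)) := by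
          intro hh
          have : x (k + 2) ∈ s(x i, x (i + 1)) := by rw [hh]; simp
          rcases Sym2.mem_iff.1 this with hh | hh
          · have := hxi _ (by omega) _ (by omega) hh; omega
          · have := hxi _ (by omega) _ (by omega) hh; omega
        obtain ⟨n, n1, n2, rfl⟩ := K.exists_common_of_mem h (hmem i (by omega))
          (hmem (k + 1) (by omega)) hne' hq hq'
        rcases Sym2.mem_iff.1 n2 with rfl | rfl
        · rfl
        · rcases Sym2.mem_iff.1 n1 with hh | hh
          · have := hxi _ (by omega) _ (by omega) hh; omega
          · have := hxi _ (by omega) _ (by omega) hh; omega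
  have hlpos : l ≠ 0 := by
    rintro rfl
    exact h.ne (K.vert_inj (h0.symm.trans hl))
  obtain ⟨k, rfl⟩ := Nat.exists_eq_succ_of_ne_zero hlpos
  rw [← h0, ← hl]
  convert key k le_rfl using 1
  ext q
  simp only [curve, hS]
  constructor
  · rintro ⟨s, ⟨i, hi, rfl⟩, hq⟩
    exact ⟨i, hi, hq⟩
  · rintro ⟨i, hi, hq⟩
    exact ⟨_, ⟨i, hi, rfl⟩, hq⟩

/-- If the two segments had a common node, they would meet only there, and the node would be a
common vertex; relative interiors exclude such points. -/
theorem exists_apart_of_mem {e f : Sym2 V} (he : e ∈ G.edgeSet) (hf : f ∈ G.edgeSet)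
    (hef : e ≠ f) {q : Plane}
    (hq : q ∈ curveInterior (fun v => K.P (K.vert v)) (K.curve e) e ∩
      curveInterior (fun v => K.P (K.vert v)) (K.curve f) f) :
    ∃ s ∈ K.S e, ∃ t ∈ K.S f, Apart s t ∧ q ∈ sseg K.P s ∧ q ∈ sseg K.P t := by
  obtain ⟨⟨⟨s, hs, q1⟩, hq1⟩, ⟨⟨t, ht, q2⟩, -⟩⟩ := hq
  refine ⟨s, hs, t, ht, fun n n1 n2 => hq1 ?_, q1, q2⟩
  obtain ⟨v, v1, -, rfl⟩ := K.common e he f hf hef s hs t ht n n1 n2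
  exact ⟨v, v1, (K.gen.eq_of_mem_of_mem (K.not_isDiag he hs) (K.not_isDiag hf ht)
    (K.ne_of_ne he hf hef hs ht) n1 n2 q1 q2).symm⟩

/-- The finitely many other segments of `e` are closed and miss `q`, so near `q` the curve is a
single segment, with `q` in its interior. -/
theorem eventually_mem_curve_iff [Finite N] {e f : Sym2 V} (he : e ∈ G.edgeSet)
    (hf : f ∈ G.edgeSet) {a b : N} {t : Sym2 N} (hs : s(a, b) ∈ K.S e) (ht : t ∈ K.S f)
    (hst : Apart s(a, b) t) {q : Plane} (q1 : q ∈ sseg K.P s(a, b)) (q2 : q ∈ sseg K.P t) :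
    ∀ᶠ z in 𝓝 q, z ∈ K.curve e ↔ det2 (K.P b - K.P a) (z - q) = 0 := by
  have hnode : ∀ n ∈ s(a, b), q ≠ K.P n := by
    rintro n hn rfl
    exact hst n hn (K.gen.mem_of_mem_sseg (K.not_isDiag hf ht) q2)
  have h1 := eventually_mem_segment_iff q1 (hnode a (by simp)) (hnode b (by simp))
  have h2 : ∀ᶠ z in 𝓝 q, ∀ s' : Sym2 N, s' ∈ K.S e → s' ≠ s(a, b) → z ∉ sseg K.P s' := by
    have := Fintype.ofFinite N
    rw [eventually_all]
    intro s'
    by_cases h : s' ∈ K.S e ∧ s' ≠ s(a, b)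
    · have : q ∉ sseg K.P s' := fun h' => h.2 (K.eq_of_mem_crossing he hf hs h.1 ht hst q1 q2 h')
      filter_upwards [(isClosed_sseg K.P s').isOpen_compl.mem_nhds this] with z hz _ _ using hz
    · exact Eventually.of_forall fun z z1 z2 => (h ⟨z1, z2⟩).elim
  filter_upwards [h1, h2] with z z1 z2
  rw [← z1]
  constructor
  · rintro ⟨s', hs', hz⟩
    by_cases hh : s' = s(a, b)
    · subst hh
      exact hz
    · exact (z2 s' hs' hh hz).elim
  · exact fun hz => ⟨_, hs, hz⟩

/-- Each crossing selects a pair of segments through it, and this is injective because two segments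
without common nodes meet at most once in general position. -/
theorem crossing_injOn [Finite N] {e f : Sym2 V} (he : e ∈ G.edgeSet) (hf : f ∈ G.edgeSet)
    (hef : e ≠ f) :
    (curveInterior (fun v => K.P (K.vert v)) (K.curve e) e ∩
      curveInterior (fun v => K.P (K.vert v)) (K.curve f) f).Finite ∧
    (curveInterior (fun v => K.P (K.vert v)) (K.curve e) e ∩
      curveInterior (fun v => K.P (K.vert v)) (K.curve f) f).ncard ≤ (K.pairs e f).ncard := by
  classical
  have := fun q : {q // q ∈ curveInterior (fun v => K.P (K.vert v)) (K.curve e) e ∩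
      curveInterior (fun v => K.P (K.vert v)) (K.curve f) f} =>
    K.exists_apart_of_mem he hf hef q.2
  choose s hs t ht hst q1 q2 using this
  -- Outside the set of crossings the value is arbitrary.
  let F : Plane → Sym2 N × Sym2 N := fun q => if h : _ then (s ⟨q, h⟩, t ⟨q, h⟩) else (s(K.vert e.out.1, K.vert e.out.1), s(K.vert e.out.1, K.vert e.out.1))
  have hF : MapsTo F (curveInterior (fun v => K.P (K.vert v)) (K.curve e) e ∩
      curveInterior (fun v => K.P (K.vert v)) (K.curve f) f) (K.pairs e f) := by
    intro q hq
    simp only [F, dif_pos hq]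
    exact ⟨hs _, ht _, hst _, Set.not_disjoint_iff.2 ⟨q, q1 ⟨q, hq⟩, q2 ⟨q, hq⟩⟩⟩
  have hI : InjOn F (curveInterior (fun v => K.P (K.vert v)) (K.curve e) e ∩
      curveInterior (fun v => K.P (K.vert v)) (K.curve f) f) := by
    intro q hq q' hq' h
    simp only [F, dif_pos hq, dif_pos hq', Prod.mk.injEq] at h
    exact K.gen.inter_unique (K.not_isDiag he (hs ⟨q, hq⟩)) (K.not_isDiag hf (ht ⟨q, hq⟩))
      (hst _) (q1 ⟨q, hq⟩) (q2 ⟨q, hq⟩) (h.1 ▸ q1 ⟨q', hq'⟩) (h.2 ▸ q2 ⟨q', hq'⟩)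
  have hfin : (K.pairs e f).Finite := toFinite _
  exact ⟨Finite.of_injOn hF hI hfin, ncard_le_ncard_of_injOn F hF hI hfin⟩

/-- The drawing given by a polygonal drawing. -/
def toDrawing [Finite N] : Drawing G where
  pos v := K.P (K.vert v)
  curve := K.curve
  pos_injective _ _ h := K.vert_inj (K.gen.inj h)
  isSimpleCurve := K.isArc_curve
  pos_notMem := by
    rintro e he v hv ⟨s, hs, h⟩
    exact hv (K.vert_mem e he s hs v (K.gen.mem_of_mem_sseg (K.not_isDiag he hs) h))
  not_tangent := by
    intro e he f hf hef q hq
    obtain ⟨s, hs, t, ht, hst, q1, q2⟩ := K.exists_apart_of_mem he hf hef hq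
    have ds := K.not_isDiag he hs
    have dt := K.not_isDiag hf ht
    induction s using Sym2.ind with
    | _ a b =>
    induction t using Sym2.ind with
    | _ c d =>
    rw [Sym2.mk_isDiag_iff] at ds dt
    exact crossProperlyAt_of_local (K.gen.det_ne ds dt hst q1 q2)
      (K.eventually_mem_curve_iff he hf hs ht hst q1 q2)
      (K.eventually_mem_curve_iff hf he ht hs hst.symm q2 q1)
  no_triple := by
    intro e he f hf g hg hef heg hfg
    rw [eq_empty_iff_forall_notMem]
    rintro q ⟨⟨q1, q2⟩, q3⟩
    obtain ⟨s, hs, t, ht, hst, a1, a2⟩ := K.exists_apart_of_mem he hf hef ⟨q1, q2⟩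
    obtain ⟨s', hs', u, hu, hsu, b1, b2⟩ := K.exists_apart_of_mem he hg heg ⟨q1, q3⟩
    obtain ⟨t', ht', u', hu', htu, c1, c2⟩ := K.exists_apart_of_mem hf hg hfg ⟨q2, q3⟩
    obtain rfl := K.eq_of_mem_crossing he hf hs hs' ht hst a1 a2 b1
    obtain rfl := K.eq_of_mem_crossing hf he ht ht' hs hst.symm a2 a1 c1
    obtain rfl := K.eq_of_mem_crossing hg he hu hu' hs hsu.symm b2 b1 c2
    exact K.gen.nonconc _ _ _ (K.not_isDiag he hs) (K.not_isDiag hf ht) (K.not_isDiag hg hu)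
      hst hsu htu q a1 a2 b2
  finite_crossings e he f hf hef := (K.crossing_injOn he hf hef).1

theorem ncard_crossings_toDrawing_le [Finite N] {e f : Sym2 V} (he : e ∈ G.edgeSet)
    (hf : f ∈ G.edgeSet) (hef : e ≠ f) :
    (K.toDrawing.crossings e f).ncard ≤ (K.pairs e f).ncard :=
  (K.crossing_injOn he hf hef).2

end PolyDrawing
end CrossingNumber

namespace CrossingNumber
open Set Filter Topology Metric

/-! ### Polygonal chains -/

/-- `x` and `y` are joined by a polygonal chain inside `S`. -/
def PolyReach (S : Set Plane) : Plane → Plane → Prop :=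
  Relation.ReflTransGen fun x y => segment ℝ x y ⊆ S

theorem PolyReach.mono {S T : Set Plane} (h : S ⊆ T) {x y : Plane} (hxy : PolyReach S x y) :
    PolyReach T x y := by
  induction hxy with
  | refl => exact .refl
  | tail _ h' ih => exact .tail ih (h'.trans h)

/-- Nearby points of the curve are joined by a segment inside a ball of the thickening. The relation
is transitive, so it spreads over the connected image. -/
theorem polyReach_thickening {γ : ℝ → Plane} (hγ : Continuous γ) {s t : ℝ} (hst : s ≤ t) {η : ℝ}
    (hη : 0 < η) : PolyReach (thickening η (γ '' Icc s t)) (γ s) (γ t) := by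
  have hpre : IsPreconnected (γ '' Icc s t) := isPreconnected_Icc.image _ hγ.continuousOn
  refine hpre.induction₂' (PolyReach (thickening η (γ '' Icc s t))) ?_
    (fun x y z _ _ _ h1 h2 => h1.trans h2) (mem_image_of_mem _ ⟨le_rfl, hst⟩)
    (mem_image_of_mem _ ⟨hst, le_rfl⟩)
  intro x hx
  have hball : ball x η ⊆ thickening η (γ '' Icc s t) := ball_subset_thickening hx η
  filter_upwards [mem_nhdsWithin_of_mem_nhds (ball_mem_nhds x hη)] with y hy
  have h := (convex_ball x η).segment_subset (mem_ball_self hη) hy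
  exact ⟨.single (h.trans hball), .single ((segment_symm ℝ y x ▸ h).trans hball)⟩

/-- A polygonal chain inside `S` without self-intersections. -/
structure SimpleChain (S : Set Plane) (l : ℕ) (Q : ℕ → Plane) : Prop where
  subset : ∀ i < l, segment ℝ (Q i) (Q (i + 1)) ⊆ S
  disjoint : ∀ i j, i + 1 < j → j < l →
    Disjoint (segment ℝ (Q i) (Q (i + 1))) (segment ℝ (Q j) (Q (j + 1)))
  first : ∀ i, 0 < i → i < l → Q 0 ∉ segment ℝ (Q i) (Q (i + 1))
  last : ∀ i, i + 1 < l → Q l ∉ segment ℝ (Q i) (Q (i + 1))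

/-- A chain with the least number of segments works: every forbidden incidence would permit a
shortcut inside the segments already used. -/
theorem exists_simpleChain {S : Set Plane} {x y : Plane} (h : PolyReach S x y) :
    ∃ l Q, Q 0 = x ∧ Q l = y ∧ SimpleChain S l Q := by
  classical
  have hex : ∃ l : ℕ, ∃ Q : ℕ → Plane, Q 0 = x ∧ Q l = y ∧
      ∀ i < l, segment ℝ (Q i) (Q (i + 1)) ⊆ S := by
    induction h with
    | refl => exact ⟨0, fun _ => x, rfl, rfl, by simp⟩
    | @tail b c _ hbc ih =>
      obtain ⟨l, Q, h0, hl, hS⟩ := ih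
      refine ⟨l + 1, fun i => if i ≤ l then Q i else c, by simpa, by simp, fun i hi => ?_⟩
      rcases Nat.lt_succ_iff_lt_or_eq.1 hi with h | rfl
      · simp only [h.le, if_true, Nat.succ_le_of_lt h]
        exact hS i h
      · simpa [hl] using hbc
  obtain ⟨Q, h0, hl, hS⟩ := Nat.find_spec hex
  set l := Nat.find hex with hldef
  have hmin : ∀ m, m < l → ∀ R : ℕ → Plane, R 0 = x → R m = y →
      (∀ i < m, segment ℝ (R i) (R (i + 1)) ⊆ S) → False :=
    fun m hm R r1 r2 r3 => Nat.find_min hex hm ⟨R, r1, r2, r3⟩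
  have sub : ∀ {a b p q : Plane}, p ∈ segment ℝ a b → q ∈ segment ℝ a b →
      segment ℝ p q ⊆ segment ℝ a b := fun hp hq => (convex_segment _ _).segment_subset hp hq
  refine ⟨l, Q, h0, hl, hS, ?_, ?_, ?_⟩
  · intro i j hij hj
    rw [Set.disjoint_left]
    intro p p1 p2
    -- Shortcut through the intersection point: follow the chain to `Q i`, then `p`, then continue
    -- with `Q (j + 1)`.
    refine hmin (l - (j - i - 1)) (by omega)
      (fun n => if n ≤ i then Q n else if n = i + 1 then p else Q (n + (j - i - 1)))
      (by simpa) ?_ ?_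
    · rw [if_neg (by omega), if_neg (by omega), show l - (j - i - 1) + (j - i - 1) = l by omega, hl]
    · intro n hn
      rcases lt_trichotomy n i with h | rfl | h
      · rw [if_pos h.le, if_pos (by omega)]
        exact hS n (by omega)
      · rw [if_pos le_rfl, if_neg (by omega), if_pos rfl]
        exact (sub (left_mem_segment _ _ _) p1).trans (hS n (by omega))
      · rw [if_neg (show ¬ n ≤ i by omega), if_neg (show ¬ n + 1 ≤ i by omega),
          if_neg (show n + 1 ≠ i + 1 by omega)]
        by_cases h' : n = i + 1
        · rw [if_pos h', show n + 1 + (j - i - 1) = j + 1 by omega]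
          exact (sub p2 (right_mem_segment _ _ _)).trans (hS j hj)
        · rw [if_neg h', show n + 1 + (j - i - 1) = n + (j - i - 1) + 1 by omega]
          exact hS _ (by omega)
  · intro i hi hil hmem
    -- The initial point lies on segment `i`, so the chain may go straight to `Q (i + 1)`.
    refine hmin (l - i) (by omega) (fun n => if n = 0 then Q 0 else Q (n + i)) (by simpa) ?_ ?_
    · rw [if_neg (by omega), show l - i + i = l by omega, hl]
    · intro n hn
      rw [if_neg (show n + 1 ≠ 0 by omega), show n + 1 + i = n + i + 1 by omega]
      split_ifs with h
      · subst h
        rw [zero_add]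
        exact (sub hmem (right_mem_segment _ _ _)).trans (hS i hil)
      · exact hS _ (by omega)
  · intro i hi hmem
    -- The final point already lies on segment `i`, so the chain may stop there.
    refine hmin (i + 1) hi (fun n => if n ≤ i then Q n else Q l) (by simpa) (by simpa) ?_
    intro n hn
    rw [if_pos (by omega)]
    split_ifs with h
    · exact hS n (by omega)
    · obtain rfl : n = i := by omega
      exact (sub (left_mem_segment _ _ _) hmem).trans (hS n (by omega))

/-- A curve from the centre of a ball to the centre of another ball has a part that leads from
one boundary circle to the other without entering the open balls. -/
theorem exists_between_balls {γ : ℝ → Plane} (hγ : Continuous γ) {u v r : ℝ} (huv : u < v)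
    (hr : 0 < r) (h : 2 * r < dist (γ u) (γ v)) :
    ∃ s t, u < s ∧ s ≤ t ∧ t < v ∧ dist (γ s) (γ u) = r ∧ dist (γ t) (γ v) = r ∧
      ∀ x ∈ Icc s t, r ≤ dist (γ x) (γ u) ∧ r ≤ dist (γ x) (γ v) := by
  have hc1 : Continuous fun x => dist (γ x) (γ u) := by fun_prop
  have hc2 : Continuous fun x => dist (γ x) (γ v) := by fun_prop
  -- `s` is the last time in the closed disc around the starting point; `t` below is the first time
  -- after `s` in the closed disc around the final point.
  obtain ⟨s, ⟨hs, hsr⟩, hsmax⟩ : ∃ s, IsGreatest (Icc u v ∩ {x | dist (γ x) (γ u) ≤ r}) s :=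
    (isCompact_Icc.inter_right (isClosed_le hc1 continuous_const)).exists_isGreatest
      ⟨u, ⟨le_rfl, huv.le⟩, by simp [hr.le]⟩
  have hsr' : dist (γ s) (γ u) ≤ r := hsr
  have hsv : s < v := by
    refine lt_of_le_of_ne hs.2 ?_
    rintro rfl
    rw [dist_comm] at hsr'
    linarith
  have hgt : ∀ x, s < x → x ≤ v → r < dist (γ x) (γ u) := by
    intro x h1 h2
    by_contra h3
    exact absurd (hsmax ⟨⟨hs.1.trans h1.le, h2⟩, not_lt.1 h3⟩) (not_le.2 h1)
  have hsr : dist (γ s) (γ u) = r := by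
    refine le_antisymm hsr' ?_
    have hcl : s ∈ closure (Ioc s v) := by
      rw [closure_Ioc hsv.ne]
      exact ⟨le_rfl, hsv.le⟩
    have : IsClosed {x | r ≤ dist (γ x) (γ u)} := isClosed_le continuous_const hc1
    exact closure_minimal (fun x hx => (hgt x hx.1 hx.2).le) this hcl
  have hus : u < s := by
    refine lt_of_le_of_ne hs.1 ?_
    rintro rfl
    simp at hsr
    linarith
  obtain ⟨t, ⟨ht, htr⟩, htmin⟩ : ∃ t, IsLeast (Icc s v ∩ {x | dist (γ x) (γ v) ≤ r}) t :=
    (isCompact_Icc.inter_right (isClosed_le hc2 continuous_const)).exists_isLeast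
      ⟨v, ⟨hsv.le, le_rfl⟩, by simp [hr.le]⟩
  have htr' : dist (γ t) (γ v) ≤ r := htr
  have hst : s < t := by
    refine lt_of_le_of_ne ht.1 ?_
    rintro rfl
    have := dist_triangle_left (γ u) (γ v) (γ s)
    linarith
  have hlt : ∀ x, s ≤ x → x < t → r < dist (γ x) (γ v) := by
    intro x h1 h2
    by_contra h3
    exact absurd (htmin ⟨⟨h1, h2.le.trans ht.2⟩, not_lt.1 h3⟩) (not_le.2 h2)
  have htr : dist (γ t) (γ v) = r := by
    refine le_antisymm htr' ?_
    have hcl : t ∈ closure (Ico s t) := by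
      rw [closure_Ico hst.ne]
      exact ⟨hst.le, le_rfl⟩
    have : IsClosed {x | r ≤ dist (γ x) (γ v)} := isClosed_le continuous_const hc2
    exact closure_minimal (fun x hx => (hlt x hx.1 hx.2).le) this hcl
  have htv : t < v := by
    refine lt_of_le_of_ne ht.2 ?_
    rintro rfl
    simp at htr
    linarith
  refine ⟨s, t, hus, hst.le, htv, hsr, htr, fun x hx => ⟨?_, ?_⟩⟩
  · rcases hx.1.eq_or_lt with rfl | hx'
    · exact hsr.ge
    · exact (hgt x hx' (hx.2.trans htv.le)).le
  · rcases hx.2.eq_or_lt with rfl | hx'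
    · exact htr.ge
    · exact (hlt x hx.1 hx').le

/-- The radial segment between the circles of radius `r - η` and `r` around `z`. -/
theorem exists_radial {z p : Plane} {r η : ℝ} (hη : 0 < η) (hηr : η < r) (hp : dist p z = r) :
    ∃ c, dist c z = r - η ∧ ∀ x ∈ segment ℝ c p,
      dist x p ≤ η ∧ dist x z ≤ r ∧ (dist x z ≤ r - η → x = c) := by
  have hr : 0 < r := hη.trans hηr
  have hd : ∀ a b : ℝ, dist (AffineMap.lineMap z p a : Plane) (AffineMap.lineMap z p b) =
      |a - b| * r := by
    intro a b
    rw [dist_lineMap_lineMap, Real.dist_eq, dist_comm z p, hp]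
  have hz : (AffineMap.lineMap z p (0 : ℝ) : Plane) = z := by simp
  have h1 : (AffineMap.lineMap z p (1 : ℝ) : Plane) = p := by simp
  let a₀ : ℝ := (r - η) / r
  have ha₀ : a₀ * r = r - η := by simp only [a₀]; field_simp
  have ha0 : 0 < a₀ := div_pos (by linarith) hr
  have ha1 : a₀ < 1 := by rw [div_lt_one hr]; linarith
  refine ⟨AffineMap.lineMap z p a₀, ?_, ?_⟩
  · have := hd a₀ 0
    rw [hz, sub_zero, abs_of_pos ha0, ha₀] at this
    exact this
  · intro x hx
    obtain ⟨a, haa, ha1', rfl⟩ : ∃ a, a₀ ≤ a ∧ a ≤ 1 ∧ x = AffineMap.lineMap z p a := by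
      rw [segment_eq_image_lineMap] at hx
      obtain ⟨t, ht, rfl⟩ := hx
      refine ⟨a₀ + t * (1 - a₀), by nlinarith [ht.1], by nlinarith [ht.2], ?_⟩
      apply plane_ext <;> simp [AffineMap.lineMap_apply] <;> ring
    refine ⟨?_, ?_, fun h => ?_⟩
    · have := hd a 1
      rw [h1] at this
      rw [this, abs_of_nonpos (by linarith)]
      nlinarith
    · have := hd a 0
      rw [hz] at this
      rw [this, sub_zero, abs_of_pos (by linarith)]
      nlinarith
    · have := hd a 0
      rw [hz] at this
      rw [this, sub_zero, abs_of_pos (by linarith), ← ha₀] at h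
      have : a = a₀ := le_antisymm (le_of_mul_le_mul_right h hr) haa
      rw [this]

/-- Finitely many curves that meet each other and the finite set `Z` at most in their endpoints,
which belong to `Z`, can be replaced by disjoint simple polygonal chains between the boundary circles
of small balls around the points of `Z`. -/
theorem exists_chains {A : Type*} [Finite A] {Z : Set Plane} (hZ : Z.Finite) {γ : A → ℝ → Plane}
    {u v : A → ℝ} (huv : ∀ a, u a < v a) (hγ : ∀ a, Continuous (γ a))
    (hu : ∀ a, γ a (u a) ∈ Z) (hv : ∀ a, γ a (v a) ∈ Z) (hne : ∀ a, γ a (u a) ≠ γ a (v a))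
    (hint : ∀ a, ∀ t ∈ Ioo (u a) (v a), γ a t ∉ Z)
    (hdisj : ∀ a b, a ≠ b → ∀ s ∈ Ioo (u a) (v a), ∀ t ∈ Ioo (u b) (v b), γ a s ≠ γ b t) :
    ∃ ρ > 0, (∀ w ∈ Z, ∀ w' ∈ Z, w ≠ w' → 2 * ρ < dist w w') ∧
      ∃ (l : A → ℕ) (Q : A → ℕ → Plane) (S : A → Set Plane),
        (∀ a, SimpleChain (S a) (l a) (Q a)) ∧
        (∀ a b, a ≠ b → Disjoint (S a) (S b)) ∧
        (∀ a, dist (Q a 0) (γ a (u a)) = ρ ∧ dist (Q a (l a)) (γ a (v a)) = ρ) ∧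
        ∀ a, ∀ w ∈ Z, ∀ x ∈ S a, dist x w ≤ ρ →
          (w = γ a (u a) ∧ x = Q a 0) ∨ (w = γ a (v a) ∧ x = Q a (l a)) := by
  classical
  have := Fintype.ofFinite A
  have := hZ.fintype
  -- a radius for the balls
  have hr : ∀ᶠ r in 𝓝[>] (0 : ℝ), 0 < r ∧
      (∀ w : Z, ∀ w' : Z, w ≠ w' → 2 * r < dist w w') ∧
      ∀ a, ∀ w : Z, w.1 ≠ γ a (u a) → w.1 ≠ γ a (v a) → ∀ t ∈ Icc (u a) (v a),
        r < dist (γ a t) w := by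
    refine (eventually_mem_nhdsWithin).and (Eventually.and ?_ ?_)
    · rw [eventually_all]
      intro w
      rw [eventually_all]
      intro w'
      by_cases h : w = w'
      · exact Eventually.of_forall fun r h' => (h' h).elim
      · have : (0 : ℝ) < dist w w' / 2 := half_pos (dist_pos.2 h)
        filter_upwards [mem_nhdsWithin_of_mem_nhds (Iio_mem_nhds this)] with r hr _
        have : r < dist w w' / 2 := hr
        linarith
    · rw [eventually_all]
      intro a
      rw [eventually_all]
      intro w
      by_cases h : w.1 ≠ γ a (u a) ∧ w.1 ≠ γ a (v a)
      · obtain ⟨t₀, ht₀, hmin⟩ := isCompact_Icc.exists_isMinOn (nonempty_Icc.2 (huv a).le)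
          (f := fun t => dist (γ a t) w) (by have := hγ a; fun_prop)
        have hpos : 0 < dist (γ a t₀) w := by
          rw [dist_pos]
          intro h0
          rcases ht₀.1.eq_or_lt with h1 | h1
          · exact h.1 (by rw [h1, h0])
          rcases ht₀.2.eq_or_lt with h2 | h2
          · exact h.2 (by rw [← h2, h0])
          exact hint a t₀ ⟨h1, h2⟩ (h0 ▸ w.2)
        filter_upwards [mem_nhdsWithin_of_mem_nhds (Iio_mem_nhds hpos)] with r hr _ _ t ht
        exact lt_of_lt_of_le hr (hmin ht)
      · exact Eventually.of_forall fun r h1 h2 => (h ⟨h1, h2⟩).elim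
  obtain ⟨r, hr0, hrZ, hrγ⟩ := hr.exists
  have hrZ : ∀ w ∈ Z, ∀ w' ∈ Z, w ≠ w' → 2 * r < dist w w' := fun w hw w' hw' h =>
    hrZ ⟨w, hw⟩ ⟨w', hw'⟩ (fun h' => h (congrArg Subtype.val h'))
  have hmid := fun a => exists_between_balls (hγ a) (huv a) hr0 (hrZ _ (hu a) _ (hv a) (hne a))
  choose s t hus hst htv hs ht hM using hmid
  let M : A → Set Plane := fun a => γ a '' Icc (s a) (t a)
  have hMc : ∀ a, IsCompact (M a) := fun a => isCompact_Icc.image (hγ a)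
  have hMZ : ∀ a, ∀ x ∈ M a, ∀ w ∈ Z, r ≤ dist x w := by
    rintro a _ ⟨x, hx, rfl⟩ w hw
    by_cases h1 : w = γ a (u a)
    · exact h1 ▸ (hM a x hx).1
    by_cases h2 : w = γ a (v a)
    · exact h2 ▸ (hM a x hx).2
    exact (hrγ a ⟨w, hw⟩ h1 h2 x ⟨(hus a).le.trans hx.1, hx.2.trans (htv a).le⟩).le
  have hη : ∀ᶠ η in 𝓝[>] (0 : ℝ), 0 < η ∧ η < r ∧ ∀ a b, a ≠ b →
      Disjoint (cthickening η (M a)) (cthickening η (M b)) := by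
    refine (eventually_mem_nhdsWithin).and
      (Eventually.and (mem_nhdsWithin_of_mem_nhds (Iio_mem_nhds hr0)) ?_)
    rw [eventually_all]
    intro a
    rw [eventually_all]
    intro b
    by_cases h : a = b
    · exact Eventually.of_forall fun r h' => (h' h).elim
    · have : Disjoint (M a) (M b) := by
        rw [Set.disjoint_left]
        rintro _ ⟨x, hx, rfl⟩ ⟨y, hy, hxy⟩
        exact hdisj a b h x ⟨(hus a).trans_le hx.1, hx.2.trans_lt (htv a)⟩ y
          ⟨(hus b).trans_le hy.1, hy.2.trans_lt (htv b)⟩ hxy.symm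
      obtain ⟨δ, hδ, hd⟩ := this.exists_cthickenings (hMc a) (hMc b).isClosed
      filter_upwards [mem_nhdsWithin_of_mem_nhds (Iio_mem_nhds hδ)] with η hη _
      exact hd.mono (cthickening_mono (le_of_lt hη) _) (cthickening_mono (le_of_lt hη) _)
  obtain ⟨η, hη0, hηr, hηd⟩ := hη.exists
  choose c hc hcs using fun a => exists_radial hη0 hηr (hs a)
  choose c' hc' hcs' using fun a => exists_radial hη0 hηr (ht a)
  -- The thickened middle part stays farther than `r - η` from `Z`. The radial segments lead from it
  -- to the circles of radius `ρ = r - η`, so these circles are touched only at the two ends of the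
  -- chain.
  let S : A → Set Plane := fun a =>
    segment ℝ (c a) (γ a (s a)) ∪ thickening η (M a) ∪ segment ℝ (c' a) (γ a (t a))
  have hreach : ∀ a, PolyReach (S a) (c a) (c' a) := by
    intro a
    refine .head (b := γ a (s a)) (fun x hx => Or.inl (Or.inl hx)) (Relation.ReflTransGen.tail
      (b := γ a (t a)) ?_ fun x hx => Or.inr (segment_symm ℝ (c' a) _ ▸ hx))
    exact (polyReach_thickening (hγ a) (hst a) hη0).mono fun x hx => Or.inl (Or.inr hx)
  choose l Q hQ0 hQl hQ using fun a => exists_simpleChain (hreach a)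
  refine ⟨r - η, by linarith, fun w hw w' hw' h => by linarith [hrZ w hw w' hw' h], l, Q, S, hQ,
    ?_, fun a => ⟨by rw [hQ0, hc], by rw [hQl, hc']⟩, ?_⟩
  · have hsub : ∀ a, S a ⊆ cthickening η (M a) := by
      rintro a x ((hx | hx) | hx)
      · exact mem_cthickening_of_dist_le x _ η _ (mem_image_of_mem _ ⟨le_rfl, hst a⟩)
          (hcs a x hx).1
      · exact thickening_subset_cthickening _ _ hx
      · exact mem_cthickening_of_dist_le x _ η _ (mem_image_of_mem _ ⟨hst a, le_rfl⟩)
          (hcs' a x hx).1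
    exact fun a b h => (hηd a b h).mono (hsub a) (hsub b)
  · intro a w hw x hx hxw
    rw [hQ0, hQl]
    have hfar : ∀ z ∈ Z, dist x z ≤ r → w = z := by
      intro z hz hxz
      by_contra h
      have := hrZ w hw z hz h
      have := dist_triangle_left w z x
      linarith
    rcases hx with (hx | hx) | hx
    · obtain ⟨-, h2, h3⟩ := hcs a x hx
      have := hfar _ (hu a) h2
      exact Or.inl ⟨this, h3 (this ▸ hxw)⟩
    · obtain ⟨y, hy, hxy⟩ := mem_thickening_iff.1 hx
      have := hMZ a y hy w hw
      have := dist_triangle_left y w x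
      linarith
    · obtain ⟨-, h2, h3⟩ := hcs' a x hx
      have := hfar _ (hv a) h2
      exact Or.inr ⟨this, h3 (this ▸ hxw)⟩

end CrossingNumber

/-! ### Cutting the curves of a drawing at vertices and crossings -/

namespace CrossingNumber
open Set Filter Topology Metric

theorem exists_enumeration {T : Set ℝ} (hT : T.Finite) (h0 : (0 : ℝ) ∈ T) (h1 : (1 : ℝ) ∈ T)
    (hsub : T ⊆ Icc 0 1) : ∃ (k : ℕ) (τ : ℕ → ℝ), 0 < k ∧ τ 0 = 0 ∧ τ k = 1 ∧
      (∀ i j, i < j → j ≤ k → τ i < τ j) ∧ (∀ i ≤ k, τ i ∈ T) ∧ ∀ t ∈ T, ∃ i ≤ k, t = τ i := by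
  classical
  let F := hT.toFinset
  have hF : ∀ t, t ∈ F ↔ t ∈ T := fun t => hT.mem_toFinset
  have hcard : 1 < F.card :=
    Finset.one_lt_card.2 ⟨0, (hF 0).2 h0, 1, (hF 1).2 h1, zero_ne_one⟩
  obtain ⟨k, hk⟩ : ∃ k, F.card = k + 1 := ⟨F.card - 1, by omega⟩
  let φ := F.orderEmbOfFin hk
  let τ : ℕ → ℝ := fun i => if h : i < k + 1 then φ ⟨i, h⟩ else 0
  have hτ : ∀ i (h : i < k + 1), τ i = φ ⟨i, h⟩ := fun i h => dif_pos h
  have hmono : ∀ i j, i < j → j ≤ k → τ i < τ j := by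
    intro i j hij hj
    rw [hτ i (by omega), hτ j (by omega)]
    exact φ.strictMono hij
  have hmem : ∀ i ≤ k, τ i ∈ T := by
    intro i hi
    rw [hτ i (by omega), ← hF]
    exact F.orderEmbOfFin_mem hk _
  have hsurj : ∀ t ∈ T, ∃ i ≤ k, t = τ i := by
    intro t ht
    have : t ∈ range φ := by
      rw [Finset.range_orderEmbOfFin]
      exact (hF t).2 ht
    obtain ⟨i, rfl⟩ := this
    exact ⟨i, by omega, (hτ i i.2).symm⟩
  have hle : ∀ i j, i ≤ j → j ≤ k → τ i ≤ τ j := by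
    intro i j hij hj
    rcases hij.eq_or_lt with rfl | h
    · exact le_rfl
    · exact (hmono i j h hj).le
  refine ⟨k, τ, by omega, ?_, ?_, hmono, hmem, hsurj⟩
  · obtain ⟨i, hi, h⟩ := hsurj 0 h0
    exact le_antisymm (h ▸ hle 0 i (Nat.zero_le _) hi) (hsub (hmem 0 (Nat.zero_le _))).1
  · obtain ⟨i, hi, h⟩ := hsurj 1 h1
    exact le_antisymm (hsub (hmem k le_rfl)).2 (h ▸ hle i k hi le_rfl)

/-- A decomposition of the curves of a drawing: the edge `e` passes through the points
`c e 0, …, c e (k e)`, which include all its common points with other edges, and polygonal chains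
`Q e i` replace the curve between the circles of radius `ρ` around consecutive ones. -/
structure ChainSystem {V : Type*} {G : SimpleGraph V} (D : Drawing G) where
  p : Sym2 V → V
  q : Sym2 V → V
  k : Sym2 V → ℕ
  c : Sym2 V → ℕ → Plane
  ρ : ℝ
  l : Sym2 V → ℕ → ℕ
  Q : Sym2 V → ℕ → ℕ → Plane
  S : Sym2 V → ℕ → Set Plane
  ends : ∀ e, s(p e, q e) = e
  k_pos : ∀ e ∈ G.edgeSet, 0 < k e
  c_zero : ∀ e ∈ G.edgeSet, c e 0 = D.pos (p e)
  c_k : ∀ e ∈ G.edgeSet, c e (k e) = D.pos (q e)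
  c_inj : ∀ e ∈ G.edgeSet, ∀ i ≤ k e, ∀ j ≤ k e, c e i = c e j → i = j
  c_mem : ∀ e ∈ G.edgeSet, ∀ i ≤ k e, c e i ∈ D.curve e
  ρ_pos : 0 < ρ
  far : ∀ e ∈ G.edgeSet, ∀ f ∈ G.edgeSet, ∀ i ≤ k e, ∀ j ≤ k f, c e i ≠ c f j →
    2 * ρ < dist (c e i) (c f j)
  chain : ∀ e ∈ G.edgeSet, ∀ i < k e, SimpleChain (S e i) (l e i) (Q e i)
  disj : ∀ e ∈ G.edgeSet, ∀ f ∈ G.edgeSet, ∀ i < k e, ∀ j < k f, (e, i) ≠ (f, j) →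
    Disjoint (S e i) (S f j)
  start : ∀ e ∈ G.edgeSet, ∀ i < k e, dist (Q e i 0) (c e i) = ρ
  finish : ∀ e ∈ G.edgeSet, ∀ i < k e, dist (Q e i (l e i)) (c e (i + 1)) = ρ
  touch : ∀ e ∈ G.edgeSet, ∀ f ∈ G.edgeSet, ∀ i < k e, ∀ j ≤ k f, ∀ x ∈ S e i,
    dist x (c f j) ≤ ρ →
      (c f j = c e i ∧ x = Q e i 0) ∨ (c f j = c e (i + 1) ∧ x = Q e i (l e i))

/-- Let `Z` be the finite set of vertices and crossings. Any common point of two edges lies in `Z`,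
so cutting every curve at its parameters in `Z` gives finitely many open arcs that avoid `Z` and
each other, as `exists_chains` requires. -/
theorem exists_chainSystem {V : Type*} [Finite V] {G : SimpleGraph V} (D : Drawing G) :
    Nonempty (ChainSystem D) := by
  classical
  have hfinE : Finite (Sym2 V) := inferInstance
  have hends : ∀ e : Sym2 V, ∃ a : V × V, s(a.1, a.2) = e := by
    intro e
    induction e using Sym2.ind with
    | _ a b => exact ⟨(a, b), rfl⟩
  choose pq hpq using hends
  let Z : Set Plane := range D.pos ∪ ⋃ a : {a : Sym2 V × Sym2 V // a.1 ∈ G.edgeSet ∧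
    a.2 ∈ G.edgeSet ∧ a.1 ≠ a.2}, D.crossings a.1.1 a.1.2
  have hZ : Z.Finite := (finite_range _).union (finite_iUnion fun a =>
    D.finite_crossings _ a.2.1 _ a.2.2.1 a.2.2.2)
  have hposZ : ∀ v, D.pos v ∈ Z := fun v => Or.inl (mem_range_self v)
  have hcommon : ∀ e ∈ G.edgeSet, ∀ f ∈ G.edgeSet, e ≠ f → ∀ x ∈ D.curve e, x ∈ D.curve f →
      x ∈ Z := by
    intro e he f hf hef x h1 h2
    by_cases h : x ∈ D.crossings e f
    · exact Or.inr (mem_iUnion.2 ⟨⟨(e, f), he, hf, hef⟩, h⟩)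
    · have : x ∈ D.pos '' {v | v ∈ e} ∨ x ∈ D.pos '' {v | v ∈ f} := by
        by_contra h3
        rw [not_or] at h3
        exact h ⟨⟨h1, h3.1⟩, ⟨h2, h3.2⟩⟩
      rcases this with ⟨v, -, rfl⟩ | ⟨v, -, rfl⟩ <;> exact hposZ v
  have hγ : ∀ e, ∃ γ : ℝ → Plane, e ∈ G.edgeSet → Continuous γ ∧ InjOn γ (Icc 0 1) ∧
      γ 0 = D.pos (pq e).1 ∧ γ 1 = D.pos (pq e).2 ∧ ∀ t ∈ Icc (0 : ℝ) 1, γ t ∈ D.curve e := by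
    intro e
    by_cases he : e ∈ G.edgeSet
    · have he' : G.Adj (pq e).1 (pq e).2 := by rw [← hpq e] at he; exact he
      obtain ⟨γ, hinj, hr⟩ := D.isSimpleCurve _ _ he'
      rw [hpq e] at hr
      refine ⟨γ.extend, fun _ => ⟨γ.continuous_extend, ?_, γ.extend_zero, γ.extend_one, ?_⟩⟩
      · intro s hs t ht hst
        rw [γ.extend_apply hs, γ.extend_apply ht] at hst
        exact congrArg Subtype.val (hinj hst)
      · intro t ht
        rw [γ.extend_apply ht, ← hr]
        exact mem_range_self _
    · exact ⟨0, fun h => (he h).elim⟩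
  choose γ hγ using hγ
  have hτ : ∀ e, ∃ (k : ℕ) (τ : ℕ → ℝ), e ∈ G.edgeSet → 0 < k ∧ τ 0 = 0 ∧ τ k = 1 ∧
      (∀ i j, i < j → j ≤ k → τ i < τ j) ∧ (∀ i ≤ k, τ i ∈ Icc (0 : ℝ) 1 ∩ γ e ⁻¹' Z) ∧
      ∀ t ∈ Icc (0 : ℝ) 1 ∩ γ e ⁻¹' Z, ∃ i ≤ k, t = τ i := by
    intro e
    by_cases he : e ∈ G.edgeSet
    · obtain ⟨h1, h2, h3, h4, h5⟩ := hγ e he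
      have hfin : (Icc (0 : ℝ) 1 ∩ γ e ⁻¹' Z).Finite :=
        Finite.of_injOn (f := γ e) (fun t ht => ht.2) (h2.mono inter_subset_left) hZ
      obtain ⟨k, τ, h⟩ := exists_enumeration hfin ⟨by simp, by rw [mem_preimage, h3]; exact hposZ _⟩
        ⟨by simp, by rw [mem_preimage, h4]; exact hposZ _⟩ inter_subset_left
      exact ⟨k, τ, fun _ => h⟩
    · exact ⟨0, 0, fun h => (he h).elim⟩
  choose k τ hτ using hτ
  have hIcc : ∀ e ∈ G.edgeSet, ∀ i < k e, ∀ t ∈ Ioo (τ e i) (τ e (i + 1)), t ∈ Icc (0 : ℝ) 1 := by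
    intro e he i hi t ht
    obtain ⟨-, -, -, -, h, -⟩ := hτ e he
    exact ⟨(h i hi.le).1.1.trans ht.1.le, ht.2.le.trans (h (i + 1) hi).1.2⟩
  have hint : ∀ e ∈ G.edgeSet, ∀ i < k e, ∀ t ∈ Ioo (τ e i) (τ e (i + 1)), γ e t ∉ Z := by
    intro e he i hi t ht hZt
    obtain ⟨-, -, -, h1, -, h2⟩ := hτ e he
    obtain ⟨j, hj, rfl⟩ := h2 t ⟨hIcc e he i hi t ht, hZt⟩
    rcases le_or_gt j i with hji | hji
    · rcases hji.eq_or_lt with rfl | hji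
      · exact lt_irrefl _ ht.1
      · exact lt_asymm ht.1 (h1 j i hji hi.le)
    · rcases (Nat.succ_le_of_lt hji).eq_or_lt with rfl | hji
      · exact lt_irrefl _ ht.2
      · exact lt_asymm ht.2 (h1 (i + 1) j hji hj)
  let A := {a : Sym2 V × ℕ // a.1 ∈ G.edgeSet ∧ a.2 < k a.1}
  have hA : Finite A := by
    obtain ⟨K, hK⟩ := (finite_range k).bddAbove
    refine Finite.Set.subset ((univ : Set (Sym2 V)) ×ˢ Iio K) ?_
    rintro ⟨e, i⟩ ⟨-, hi⟩
    exact ⟨mem_univ _, hi.trans_le (hK (mem_range_self e))⟩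
  obtain ⟨ρ, hρ, hfar, l, Q, S, hQ, hS, hQc, htouch⟩ := exists_chains (A := A) hZ
    (γ := fun a => γ a.1.1) (u := fun a => τ a.1.1 a.1.2) (v := fun a => τ a.1.1 (a.1.2 + 1))
    (fun a => (hτ _ a.2.1).2.2.2.1 _ _ (Nat.lt_succ_self _) a.2.2) (fun a => (hγ _ a.2.1).1)
    (fun a => ((hτ _ a.2.1).2.2.2.2.1 _ a.2.2.le).2)
    (fun a => ((hτ _ a.2.1).2.2.2.2.1 _ a.2.2).2)
    (fun a h => by
      have h1 := (hτ _ a.2.1).2.2.2.2.1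
      have h2 := (hτ _ a.2.1).2.2.2.1 _ _ (Nat.lt_succ_self a.1.2) a.2.2
      exact h2.ne ((hγ _ a.2.1).2.1 (h1 _ a.2.2.le).1 (h1 _ a.2.2).1 h))
    (fun a => hint _ a.2.1 _ a.2.2) (by
      rintro ⟨⟨e, i⟩, he, hi⟩ ⟨⟨f, j⟩, hf, hj⟩ hab s hs t ht hst
      dsimp only at he hi hf hj hs ht hst
      have hs' := hIcc e he i hi s hs
      have ht' := hIcc f hf j hj t ht
      by_cases hef : e = f
      · subst hef
        have hij : i ≠ j := by rintro rfl; exact hab rfl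
        obtain rfl := (hγ e he).2.1 hs' ht' hst
        have hm := (hτ e he).2.2.2.1
        have hle : ∀ i j, i ≤ j → j ≤ k e → τ e i ≤ τ e j := by
          intro i j hij hj
          rcases hij.eq_or_lt with rfl | h
          · exact le_rfl
          · exact (hm i j h hj).le
        rcases hij.lt_or_gt with h | h
        · exact absurd (hs.2.trans_le (hle _ _ h hj.le)) (not_lt.2 ht.1.le)
        · exact absurd (ht.2.trans_le (hle _ _ h hi.le)) (not_lt.2 hs.1.le)
      · exact hint e he i hi s hs (hcommon e he f hf hef _ ((hγ e he).2.2.2.2 s hs')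
          (hst ▸ (hγ f hf).2.2.2.2 t ht')))
  exact ⟨{
    p := fun e => (pq e).1
    q := fun e => (pq e).2
    k := k
    c := fun e i => γ e (τ e i)
    ρ := ρ
    l := fun e i => if h : e ∈ G.edgeSet ∧ i < k e then l ⟨(e, i), h⟩ else 0
    Q := fun e i => if h : e ∈ G.edgeSet ∧ i < k e then Q ⟨(e, i), h⟩ else 0
    S := fun e i => if h : e ∈ G.edgeSet ∧ i < k e then S ⟨(e, i), h⟩ else ∅
    ends := hpq
    k_pos := fun e he => (hτ e he).1
    c_zero := fun e he => by rw [(hτ e he).2.1, (hγ e he).2.2.1]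
    c_k := fun e he => by rw [(hτ e he).2.2.1, (hγ e he).2.2.2.1]
    c_inj := fun e he i hi j hj h => by
      have h1 := (hτ e he).2.2.2.2.1
      have h2 := (hγ e he).2.1 (h1 i hi).1 (h1 j hj).1 h
      have hm := (hτ e he).2.2.2.1
      by_contra hij
      rcases Ne.lt_or_gt hij with h | h
      · exact (hm i j h hj).ne h2
      · exact (hm j i h hi).ne h2.symm
    c_mem := fun e he i hi => (hγ e he).2.2.2.2 _ ((hτ e he).2.2.2.2.1 i hi).1
    ρ_pos := hρ
    far := fun e he f hf i hi j hj h =>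
      hfar _ ((hτ e he).2.2.2.2.1 i hi).2 _ ((hτ f hf).2.2.2.2.1 j hj).2 h
    chain := fun e he i hi => by
      simp only [dif_pos (show e ∈ G.edgeSet ∧ i < k e from ⟨he, hi⟩)]
      exact hQ _
    disj := fun e he f hf i hi j hj h => by
      simp only [dif_pos (show e ∈ G.edgeSet ∧ i < k e from ⟨he, hi⟩),
        dif_pos (show f ∈ G.edgeSet ∧ j < k f from ⟨hf, hj⟩)]
      exact hS _ _ fun h' => h (congrArg Subtype.val h')
    start := fun e he i hi => by
      simp only [dif_pos (show e ∈ G.edgeSet ∧ i < k e from ⟨he, hi⟩)]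
      exact (hQc ⟨(e, i), he, hi⟩).1
    finish := fun e he i hi => by
      simp only [dif_pos (show e ∈ G.edgeSet ∧ i < k e from ⟨he, hi⟩)]
      exact (hQc ⟨(e, i), he, hi⟩).2
    touch := fun e he f hf i hi j hj => by
      simp only [dif_pos (show e ∈ G.edgeSet ∧ i < k e from ⟨he, hi⟩)]
      exact htouch ⟨(e, i), he, hi⟩ _ ((hτ f hf).2.2.2.2.1 j hj).2 }⟩

end CrossingNumber

/-! ### The polygonal drawing of a chain system -/

namespace CrossingNumber
open Set Filter Topology Metric

/-- Discs are strictly convex, so a chord meets the boundary circle only in its endpoints. -/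
theorem eq_or_eq_of_mem_segment_of_dist_eq {a b w x : Plane} {ρ : ℝ} (hρ : 0 < ρ)
    (hx : x ∈ segment ℝ a b) (ha : dist a w ≤ ρ) (hb : dist b w ≤ ρ) (hxw : dist x w = ρ) :
    x = a ∨ x = b := by
  by_cases hab : a = b
  · subst hab
    rw [segment_same] at hx
    exact Or.inl hx
  rw [← insert_endpoints_openSegment] at hx
  rcases hx with rfl | rfl | hx
  · exact Or.inl rfl
  · exact Or.inr rfl
  · have := (strictConvex_closedBall ℝ w ρ).openSegment_subset (mem_closedBall.2 ha)
      (mem_closedBall.2 hb) hab hx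
    rw [interior_closedBall _ hρ.ne', mem_ball] at this
    exact absurd hxw this.ne

namespace ChainSystem
variable {V : Type*} {G : SimpleGraph V} {D : Drawing G} (C : ChainSystem D)

theorem l_pos {e : Sym2 V} (he : e ∈ G.edgeSet) {i : ℕ} (hi : i < C.k e) : 0 < C.l e i := by
  by_contra h
  have h0 : C.l e i = 0 := by omega
  have h1 := C.start e he i hi
  have h2 := C.finish e he i hi
  rw [h0] at h2
  have h3 := C.far e he e he i hi.le (i + 1) hi fun h => by
    have := C.c_inj e he i hi.le (i + 1) hi h
    omega
  have := dist_triangle_left (C.c e i) (C.c e (i + 1)) (C.Q e i 0)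
  linarith

theorem first_mem {e : Sym2 V} (he : e ∈ G.edgeSet) {i : ℕ} (hi : i < C.k e) :
    C.Q e i 0 ∈ C.S e i :=
  (C.chain e he i hi).subset 0 (C.l_pos he hi) (left_mem_segment _ _ _)

theorem last_mem {e : Sym2 V} (he : e ∈ G.edgeSet) {i : ℕ} (hi : i < C.k e) :
    C.Q e i (C.l e i) ∈ C.S e i := by
  have := C.l_pos he hi
  have h := (C.chain e he i hi).subset (C.l e i - 1) (by omega) (right_mem_segment _ _ _)
  rwa [show C.l e i - 1 + 1 = C.l e i by omega] at h

/-- The nodes of the polygonal drawing built from a chain system. -/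
abbrev Node (V : Type*) (K L : ℕ) : Type _ := V ⊕ (Sym2 V × Fin (K + 1) × Fin (L + 1))

/-- The node for the point `Q e i j`. -/
def node (K L : ℕ) (e : Sym2 V) (i j : ℕ) : Node V K L :=
  -- `Fin.ofNat` reduces modulo the size, which changes nothing for the indices in use, bounded by
  -- `K` and `L`.
  Sum.inr (e, Fin.ofNat (K + 1) i, Fin.ofNat (L + 1) j)

/-- The positions of the nodes. -/
def P (K L : ℕ) : Node V K L → Plane :=
  Sum.elim D.pos fun a => C.Q a.1 a.2.1 a.2.2

theorem P_node {K L : ℕ} {e : Sym2 V} {i j : ℕ} (hi : i ≤ K) (hj : j ≤ L) :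
    C.P K L (node K L e i j) = C.Q e i j := by
  simp [P, node, Nat.mod_eq_of_lt (Nat.lt_succ_of_le hi), Nat.mod_eq_of_lt (Nat.lt_succ_of_le hj)]

/-- The node where `e` enters the ball around `c e i`. -/
def left (K L : ℕ) (e : Sym2 V) (i : ℕ) : Node V K L :=
  if i = 0 then Sum.inl (C.p e) else node K L e (i - 1) (C.l e (i - 1))

/-- The node where `e` leaves the ball around `c e i`. -/
def right (K L : ℕ) (e : Sym2 V) (i : ℕ) : Node V K L :=
  if i = C.k e then Sum.inl (C.q e) else node K L e i 0

/-- The segments that represent `e`. -/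
def segs (K L : ℕ) (e : Sym2 V) : Set (Sym2 (Node V K L)) :=
  {s | (∃ i < C.k e, ∃ j < C.l e i, s = s(node K L e i j, node K L e i (j + 1))) ∨
    ∃ i ≤ C.k e, s = s(C.left K L e i, C.right K L e i)}

theorem mem_of_mem_segs {K L : ℕ} {e : Sym2 V} {s : Sym2 (Node V K L)} (hs : s ∈ C.segs K L e)
    {n : Node V K L} (hn : n ∈ s) : (∃ a, n = Sum.inr (e, a)) ∨ ∃ v ∈ e, n = Sum.inl v := by
  have hp : C.p e ∈ e := by
    have : C.p e ∈ s(C.p e, C.q e) := by simp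
    rwa [C.ends e] at this
  have hq : C.q e ∈ e := by
    have : C.q e ∈ s(C.p e, C.q e) := by simp
    rwa [C.ends e] at this
  rcases hs with ⟨i, hi, j, hj, rfl⟩ | ⟨i, hi, rfl⟩
  · rcases Sym2.mem_iff.1 hn with rfl | rfl <;> exact Or.inl ⟨_, rfl⟩
  · rcases Sym2.mem_iff.1 hn with rfl | rfl
    · unfold left
      split_ifs
      · exact Or.inr ⟨_, hp, rfl⟩
      · exact Or.inl ⟨_, rfl⟩
    · unfold right
      split_ifs
      · exact Or.inr ⟨_, hq, rfl⟩
      · exact Or.inl ⟨_, rfl⟩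

section
variable {K L : ℕ} (hK : ∀ e, C.k e ≤ K) (hL : ∀ e, ∀ i < C.k e, C.l e i ≤ L)
include hK hL

theorem left_cases {e : Sym2 V} (he : e ∈ G.edgeSet) {i : ℕ} (hi : i ≤ C.k e) :
    C.P K L (C.left K L e i) = C.c e i ∨ ∃ j, i = j + 1 ∧ C.left K L e i = node K L e j (C.l e j) ∧
      C.P K L (C.left K L e i) = C.Q e j (C.l e j) ∧
      dist (C.P K L (C.left K L e i)) (C.c e i) = C.ρ := by
  rcases i with _ | j
  · left
    simp [left, P, C.c_zero e he]
  · right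
    have h : C.left K L e (j + 1) = node K L e j (C.l e j) := by simp [left]
    have h2 := C.P_node (e := e) (i := j) (j := C.l e j)
      (by have := hK e; omega : j ≤ K) (hL e j hi)
    refine ⟨j, rfl, h, by rw [h, h2], by rw [h, h2]; exact C.finish e he j hi⟩

omit hL in
theorem right_cases {e : Sym2 V} (he : e ∈ G.edgeSet) {i : ℕ} (hi : i ≤ C.k e) :
    C.P K L (C.right K L e i) = C.c e i ∨ (i < C.k e ∧ C.right K L e i = node K L e i 0 ∧
      C.P K L (C.right K L e i) = C.Q e i 0 ∧
      dist (C.P K L (C.right K L e i)) (C.c e i) = C.ρ) := by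
  rcases hi.eq_or_lt with rfl | hi
  · left
    simp [right, P, C.c_k e he]
  · right
    have h : C.right K L e i = node K L e i 0 := by simp [right, hi.ne]
    have h2 := C.P_node (L := L) (e := e) (i := i) (j := 0)
      (by have := hK e; omega : i ≤ K) (Nat.zero_le _)
    exact ⟨hi, h, by rw [h, h2], by rw [h, h2]; exact C.start e he i hi⟩

theorem dist_left_le {e : Sym2 V} (he : e ∈ G.edgeSet) {i : ℕ} (hi : i ≤ C.k e) :
    dist (C.P K L (C.left K L e i)) (C.c e i) ≤ C.ρ := by
  rcases C.left_cases hK hL he hi with h | ⟨j, -, -, -, h⟩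
  · rw [h, dist_self]
    exact C.ρ_pos.le
  · exact h.le

omit hL in
theorem dist_right_le {e : Sym2 V} (he : e ∈ G.edgeSet) {i : ℕ} (hi : i ≤ C.k e) :
    dist (C.P K L (C.right K L e i)) (C.c e i) ≤ C.ρ := by
  rcases C.right_cases hK he hi with h | ⟨-, -, -, h⟩
  · rw [h, dist_self]
    exact C.ρ_pos.le
  · exact h.le

theorem dist_le_of_mem {e : Sym2 V} (he : e ∈ G.edgeSet) {i : ℕ} (hi : i ≤ C.k e) {x : Plane}
    (hx : x ∈ sseg (C.P K L) s(C.left K L e i, C.right K L e i)) :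
    dist x (C.c e i) ≤ C.ρ :=
  mem_closedBall.1 ((convex_closedBall (C.c e i) C.ρ).segment_subset
    (mem_closedBall.2 (C.dist_left_le hK hL he hi))
    (mem_closedBall.2 (C.dist_right_le hK he hi)) hx)

theorem sseg_node {e : Sym2 V} {i j : ℕ} (hi : i < C.k e) (hj : j < C.l e i) :
    sseg (C.P K L) s(node K L e i j, node K L e i (j + 1)) =
      segment ℝ (C.Q e i j) (C.Q e i (j + 1)) := by
  have h1 : i ≤ K := by have := hK e; omega
  have h2 : j + 1 ≤ L := by have := hL e i hi; omega
  rw [sseg_mk, C.P_node h1 (by omega), C.P_node h1 h2]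

theorem eq_of_connectors {e f : Sym2 V} (he : e ∈ G.edgeSet) (hf : f ∈ G.edgeSet) {i j : ℕ}
    (hi : i ≤ C.k e) (hj : j ≤ C.k f) {x : Plane}
    (h1 : x ∈ sseg (C.P K L) s(C.left K L e i, C.right K L e i))
    (h2 : x ∈ sseg (C.P K L) s(C.left K L f j, C.right K L f j)) : C.c e i = C.c f j := by
  by_contra h
  have := C.far e he f hf i hi j hj h
  have := dist_triangle_left (C.c e i) (C.c f j) x
  have := C.dist_le_of_mem hK hL he hi h1
  have := C.dist_le_of_mem hK hL hf hj h2
  linarith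

/-- A chain reaches the closed disc only with an end point on the circle, and a connector meets the
circle only in its own end points. A common point is thus an end of both; as chains are disjoint, it
is the end of the same chain. Then either the two segments share that node, or the chain returns to
its own end, which `SimpleChain` forbids. -/
theorem disjoint_connector {e f : Sym2 V} (he : e ∈ G.edgeSet) (hf : f ∈ G.edgeSet) {i i' j : ℕ}
    (hi : i < C.k e) (hj : j < C.l e i) (hi' : i' ≤ C.k f)
    (h : Apart s(node K L e i j, node K L e i (j + 1)) s(C.left K L f i', C.right K L f i')) :
    Disjoint (sseg (C.P K L) s(node K L e i j, node K L e i (j + 1)))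
      (sseg (C.P K L) s(C.left K L f i', C.right K L f i')) := by
  rw [Set.disjoint_left]
  intro x h1 h2
  rw [C.sseg_node hK hL hi hj] at h1
  have hch := C.chain e he i hi
  have hxS := hch.subset j hj h1
  have hle := C.dist_le_of_mem hK hL hf hi' h2
  have hne : C.c e i ≠ C.c e (i + 1) := fun h => by
    have := C.c_inj e he i hi.le (i + 1) hi h
    omega
  have hx : dist x (C.c f i') = C.ρ := by
    rcases C.touch e he f hf i hi i' hi' x hxS hle with ⟨h3, rfl⟩ | ⟨h3, rfl⟩
    · rw [h3]; exact C.start e he i hi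
    · rw [h3]; exact C.finish e he i hi
  have hself : ∀ g ∈ G.edgeSet, ∀ m < C.k g, x ∈ C.S g m → (e, i) = (g, m) := by
    intro g hg m hm hxm
    by_contra hne
    exact Set.disjoint_left.1 (C.disj e he g hg i hi m hm hne) hxS hxm
  have hρ := C.ρ_pos
  rcases eq_or_eq_of_mem_segment_of_dist_eq hρ h2 (C.dist_left_le hK hL hf hi')
    (C.dist_right_le hK hf hi') hx with hxa | hxa
  · rcases C.left_cases hK hL hf hi' with h5 | ⟨m, rfl, h6, h7, h8⟩
    · rw [hxa, h5, dist_self] at hx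
      exact hρ.ne hx
    · have := hself f hf m hi' (by rw [hxa, h7]; exact C.last_mem hf hi')
      simp only [Prod.mk.injEq] at this
      obtain ⟨rfl, rfl⟩ := this
      by_cases hjl : j + 1 = C.l e i
      · exact h (node K L e i (j + 1)) (by simp) (by rw [h6, hjl]; simp)
      · exact hch.last j (by omega) (by rw [← h7, ← hxa]; exact h1)
  · rcases C.right_cases hK hf hi' with h5 | ⟨hlt, h6, h7, h8⟩
    · rw [hxa, h5, dist_self] at hx
      exact hρ.ne hx
    · have := hself f hf i' hlt (by rw [hxa, h7]; exact C.first_mem hf hlt)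
      simp only [Prod.mk.injEq] at this
      obtain ⟨rfl, rfl⟩ := this
      by_cases hj0 : j = 0
      · subst hj0
        exact h (node K L e i 0) (by simp) (by rw [h6]; simp)
      · exact hch.first j (by omega) hj (by rw [← h7, ← hxa]; exact h1)

theorem segs_simple {e : Sym2 V} (he : e ∈ G.edgeSet) {s t : Sym2 (Node V K L)}
    (hs : s ∈ C.segs K L e) (ht : t ∈ C.segs K L e) (hst : Apart s t) :
    Disjoint (sseg (C.P K L) s) (sseg (C.P K L) t) := by
  rcases hs with ⟨i, hi, j, hj, rfl⟩ | ⟨i, hi, rfl⟩ <;>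
    rcases ht with ⟨i', hi', j', hj', rfl⟩ | ⟨i', hi', rfl⟩
  · rw [C.sseg_node hK hL hi hj, C.sseg_node hK hL hi' hj']
    by_cases hii : i = i'
    · subst hii
      have h1 : j ≠ j' := by rintro rfl; exact hst _ (Sym2.mem_mk_left _ _) (Sym2.mem_mk_left _ _)
      have h2 : j + 1 ≠ j' := by
        rintro rfl; exact hst _ (Sym2.mem_mk_right _ _) (Sym2.mem_mk_left _ _)
      have h3 : j ≠ j' + 1 := by
        rintro rfl; exact hst _ (Sym2.mem_mk_left _ _) (Sym2.mem_mk_right _ _)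
      rcases Nat.lt_or_gt_of_ne h1 with h | h
      · exact (C.chain e he i hi).disjoint j j' (by omega) hj'
      · exact ((C.chain e he i hi).disjoint j' j (by omega) hj).symm
    · exact (C.disj e he e he i hi i' hi' (by simp [hii])).mono
        ((C.chain e he i hi).subset j hj) ((C.chain e he i' hi').subset j' hj')
  · exact C.disjoint_connector hK hL he he hi hj hi' hst
  · exact (C.disjoint_connector hK hL he he hi' hj' hi hst.symm).symm
  · rw [Set.disjoint_left]
    intro x h1 h2
    obtain rfl := C.c_inj e he i hi i' hi' (C.eq_of_connectors hK hL he he hi hi' h1 h2)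
    exact hst _ (Sym2.mem_mk_left _ _) (Sym2.mem_mk_left _ _)

omit hK hL in
theorem segs_reach (e : Sym2 V) :
    Relation.ReflTransGen (fun a b => s(a, b) ∈ C.segs K L e) (Sum.inl (C.p e))
      (Sum.inl (C.q e)) := by
  have key : ∀ i ≤ C.k e, Relation.ReflTransGen (fun a b => s(a, b) ∈ C.segs K L e)
      (Sum.inl (C.p e)) (C.right K L e i) := by
    intro i
    induction i with
    | zero =>
      intro hi
      refine .single (Or.inr ⟨0, hi, ?_⟩)
      simp [left]
    | succ i ih =>
      intro hi
      have h1 := ih (by omega)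
      have h2 : ∀ j ≤ C.l e i, Relation.ReflTransGen (fun a b => s(a, b) ∈ C.segs K L e)
          (Sum.inl (C.p e)) (node K L e i j) := by
        intro j
        induction j with
        | zero =>
          intro _
          rwa [right, if_neg (by omega)] at h1
        | succ j ihj =>
          exact fun hj => (ihj (by omega)).tail (Or.inl ⟨i, by omega, j, by omega, rfl⟩)
      exact (h2 _ le_rfl).tail (Or.inr ⟨i + 1, hi, by simp [left]⟩)
  have := key (C.k e) le_rfl
  rwa [right, if_pos rfl] at this

/-- The polygonal drawing built from a chain system. -/
def toPreDrawing : PreDrawing G (Node V K L) where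
  vert := Sum.inl
  P := C.P K L
  S := C.segs K L
  vert_inj := Sum.inl_injective
  reach u v _ := by
    have h := C.segs_reach (K := K) (L := L) s(u, v)
    rcases Sym2.eq_iff.1 (C.ends s(u, v)) with ⟨h1, h2⟩ | ⟨h1, h2⟩
    · rwa [h1, h2] at h
    · rw [h1, h2] at h
      have : Std.Symm fun a b => s(a, b) ∈ C.segs K L s(u, v) :=
        ⟨fun a b hab => (Sym2.eq_swap (a := b) (b := a)) ▸ hab⟩
      exact Relation.ReflTransGen.stdSymm.symm _ _ h
  common e he f hf hef s hs t ht n hn hn' := by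
    rcases C.mem_of_mem_segs hs hn with ⟨a, rfl⟩ | ⟨v, hv, rfl⟩ <;>
      rcases C.mem_of_mem_segs ht hn' with ⟨b, hb⟩ | ⟨w, hw, hb⟩
    · simp only [Sum.inr.injEq, Prod.mk.injEq] at hb
      exact (hef hb.1).elim
    · simp at hb
    · simp at hb
    · simp only [Sum.inl.injEq] at hb
      exact ⟨v, hv, hb ▸ hw, rfl⟩
  vert_mem e he s hs v hv := by
    rcases C.mem_of_mem_segs hs hv with ⟨a, ha⟩ | ⟨w, hw, hb⟩
    · simp at ha
    · simp only [Sum.inl.injEq] at hb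
      exact hb ▸ hw
  simple e he s hs t ht hst := C.segs_simple hK hL he hs ht hst

omit hK hL in
theorem vert_mem_connector {e : Sym2 V} (he : e ∈ G.edgeSet) {i : ℕ} (hi : i ≤ C.k e) {v : V}
    (hv : v ∈ e) (h : C.c e i = D.pos v) :
    (Sum.inl v : Node V K L) ∈ s(C.left K L e i, C.right K L e i) := by
  rw [← C.ends e, Sym2.mem_iff] at hv
  rcases hv with rfl | rfl
  · rw [← C.c_zero e he] at h
    obtain rfl := C.c_inj e he _ hi _ (Nat.zero_le _) h
    simp [left]
  · rw [← C.c_k e he] at h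
    obtain rfl := C.c_inj e he _ hi _ le_rfl h
    simp [right]

/-- Only connectors in the same disc can meet, and each edge has at most one connector there, so the
centre determines the pair. The centre is a crossing: if it were a vertex, that vertex would be a
node of both connectors. -/
theorem ncard_pairs_le {e f : Sym2 V} (he : e ∈ G.edgeSet) (hf : f ∈ G.edgeSet) (hef : e ≠ f) :
    ((C.toPreDrawing hK hL).pairs e f).ncard ≤ (D.crossings e f).ncard := by
  let ie := Function.invFunOn (C.c e) (Iic (C.k e))
  let jf := Function.invFunOn (C.c f) (Iic (C.k f))
  have hie : ∀ i ≤ C.k e, ie (C.c e i) = i := fun i hi =>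
    InjOn.leftInvOn_invFunOn (fun a ha b hb h => C.c_inj e he a ha b hb h) hi
  have hjf : ∀ i ≤ C.k f, jf (C.c f i) = i := fun i hi =>
    InjOn.leftInvOn_invFunOn (fun a ha b hb h => C.c_inj f hf a ha b hb h) hi
  let g : Plane → Sym2 (Node V K L) × Sym2 (Node V K L) := fun x =>
    (s(C.left K L e (ie x), C.right K L e (ie x)), s(C.left K L f (jf x), C.right K L f (jf x)))
  have hfin : (D.crossings e f).Finite := D.finite_crossings e he f hf hef
  refine (ncard_le_ncard ?_ (hfin.image g)).trans (ncard_image_le hfin)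
  rintro ⟨s, t⟩ ⟨hs, ht, hst, hdis⟩
  rcases hs with ⟨i, hi, j, hj, rfl⟩ | ⟨i, hi, rfl⟩ <;>
    rcases ht with ⟨i', hi', j', hj', rfl⟩ | ⟨i', hi', rfl⟩
  · refine (hdis ?_).elim
    change Disjoint (sseg (C.P K L) s(node K L e i j, node K L e i (j + 1)))
      (sseg (C.P K L) s(node K L f i' j', node K L f i' (j' + 1)))
    rw [C.sseg_node hK hL hi hj, C.sseg_node hK hL hi' hj']
    exact (C.disj e he f hf i hi i' hi' (by simp [hef])).mono
      ((C.chain e he i hi).subset j hj) ((C.chain f hf i' hi').subset j' hj')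
  · exact (hdis (C.disjoint_connector hK hL he hf hi hj hi' hst)).elim
  · exact (hdis (C.disjoint_connector hK hL hf he hi' hj' hi hst.symm).symm).elim
  · obtain ⟨x, h1, h2⟩ := Set.not_disjoint_iff.1 hdis
    have hc := C.eq_of_connectors hK hL he hf hi hi' h1 h2
    have m1 := C.c_mem e he i hi
    have m2 := C.c_mem f hf i' hi'
    refine ⟨C.c e i, ⟨⟨m1, ?_⟩, ⟨hc ▸ m2, ?_⟩⟩, ?_⟩
    · rintro ⟨v, hv, h⟩
      have hvf : v ∈ f := by
        by_contra hv'
        exact D.pos_notMem f hf v hv' (by rw [h, hc]; exact m2)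
      exact hst _ (C.vert_mem_connector he hi hv h.symm)
        (C.vert_mem_connector hf hi' hvf (hc.symm.trans h.symm))
    · rintro ⟨v, hv, h⟩
      have hve : v ∈ e := by
        by_contra hv'
        exact D.pos_notMem e he v hv' (by rw [h]; exact m1)
      exact hst _ (C.vert_mem_connector he hi hve h.symm)
        (C.vert_mem_connector hf hi' hv (hc.symm.trans h.symm))
    · simp only [g, hie i hi]
      rw [hc, hjf i' hi']

end
end ChainSystem

/-- Every drawing can be replaced by a polygonal drawing in general position without increasing
the number of crossings of any two edges. -/
theorem exists_polyDrawing {V : Type u} [Finite V] {G : SimpleGraph V} (D : Drawing G) :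
    ∃ (N : Type u) (_ : Finite N) (K : PolyDrawing G N), ∀ e ∈ G.edgeSet, ∀ f ∈ G.edgeSet, e ≠ f →
      (K.pairs e f).ncard ≤ (D.crossings e f).ncard := by
  obtain ⟨C⟩ := exists_chainSystem D
  obtain ⟨K, hK⟩ := (finite_range C.k).bddAbove
  have hK : ∀ e, C.k e ≤ K := fun e => hK (mem_range_self e)
  obtain ⟨L, hL⟩ := (finite_range fun a : Sym2 V × Fin K => C.l a.1 a.2).bddAbove
  have hL : ∀ e, ∀ i < C.k e, C.l e i ≤ L := fun e i hi =>
    hL ⟨(e, ⟨i, hi.trans_le (hK e)⟩), rfl⟩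
  obtain ⟨K', hK'⟩ := (C.toPreDrawing hK hL).exists_poly
  exact ⟨_, inferInstance, K', fun e he f hf hef =>
    (ncard_le_ncard (hK' e he f hf) (toFinite _)).trans (C.ncard_pairs_le hK hL he hf hef)⟩

end CrossingNumber

namespace CrossingNumber
open Set Filter Topology

/-! ### Parallel lanes -/

theorem eventually_pos_of_continuous {f : ℝ → ℝ} (hf : Continuous f) (h : 0 < f 0) :
    ∀ᶠ ε in 𝓝[>] (0 : ℝ), 0 < f ε :=
  eventually_nhdsWithin_of_eventually_nhds (hf.continuousAt.eventually_const_lt h)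

/-- Two lanes along a segment are disjoint. -/
theorem eventually_disjoint_lanes {a b d d' : Plane} (h1 : 0 < det2 (b - a) d)
    (h2 : 0 < det2 (b - a) d') {s s' : ℝ} (hs : s ≠ s') :
    ∀ᶠ ε in 𝓝[>] (0 : ℝ), Disjoint (segment ℝ (a + (ε * s) • d) (b + (ε * s) • d'))
      (segment ℝ (a + (ε * s') • d) (b + (ε * s') • d')) := by
  have e1 := eventually_pos_of_continuous
    (f := fun ε => det2 (b - a + (ε * s) • (d' - d)) d) (by unfold det2; fun_prop)
    (by simpa using h1)
  have e2 := eventually_pos_of_continuous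
    (f := fun ε => det2 (b - a + (ε * s) • (d' - d)) d') (by unfold det2; fun_prop)
    (by simpa using h2)
  filter_upwards [e1, e2, self_mem_nhdsWithin] with ε k1 k2 hε
  have hε : 0 < ε := hε
  rw [Set.disjoint_left]
  intro q q1 q2
  obtain ⟨t, t0, t1, hx, hy⟩ := mem_segment_iff.1 q1
  obtain ⟨t', t0', t1', hx', hy'⟩ := mem_segment_iff.1 q2
  simp only [det2, PiLp.add_apply, PiLp.sub_apply, PiLp.smul_apply, smul_eq_mul] at k1 k2 hx hy hx' hy'
  -- Compare the points of the two lanes with the direction of the first lane: their determinant is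
  -- a nonzero multiple of a convex combination of the positive numbers `k1` and `k2`.
  have key : (s - s') * ε * ((1 - t') * ((b 0 - a 0 + ε * s * (d' 0 - d 0)) * d 1 -
      (b 1 - a 1 + ε * s * (d' 1 - d 1)) * d 0) + t' * ((b 0 - a 0 + ε * s * (d' 0 - d 0)) * d' 1 -
      (b 1 - a 1 + ε * s * (d' 1 - d 1)) * d' 0)) = 0 := by
    linear_combination (b 0 - a 0 + ε * s * (d' 0 - d 0)) * (hy' - hy) -
      (b 1 - a 1 + ε * s * (d' 1 - d 1)) * (hx' - hx)
  have hpos : 0 < (1 - t') * ((b 0 - a 0 + ε * s * (d' 0 - d 0)) * d 1 -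
      (b 1 - a 1 + ε * s * (d' 1 - d 1)) * d 0) + t' * ((b 0 - a 0 + ε * s * (d' 0 - d 0)) * d' 1 -
      (b 1 - a 1 + ε * s * (d' 1 - d 1)) * d' 0) := by
    rcases t0'.eq_or_lt with h | h
    · rw [← h]
      linarith
    · have := mul_pos h k2
      have := mul_nonneg (sub_nonneg.2 t1') k1.le
      linarith
  have := (mul_eq_zero.1 key).resolve_right hpos.ne'
  exact (mul_ne_zero (sub_ne_zero.2 hs) hε.ne') this

/-- Different lanes along consecutive segments are disjoint. -/
theorem eventually_disjoint_turn {a b c da db dc : Plane} (h1 : 0 < det2 (b - a) db)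
    (h2 : 0 < det2 (c - b) db) {s s' : ℝ} (hs : s ≠ s') :
    ∀ᶠ ε in 𝓝[>] (0 : ℝ), Disjoint (segment ℝ (a + (ε * s) • da) (b + (ε * s) • db))
      (segment ℝ (b + (ε * s') • db) (c + (ε * s') • dc)) := by
  have e1 := eventually_pos_of_continuous
    (f := fun ε => det2 (b - a + (ε * s) • (db - da)) db) (by unfold det2; fun_prop)
    (by simpa using h1)
  have e2 := eventually_pos_of_continuous
    (f := fun ε => det2 (c - b + (ε * s') • (dc - db)) db) (by unfold det2; fun_prop)
    (by simpa using h2)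
  filter_upwards [e1, e2, self_mem_nhdsWithin] with ε k1 k2 hε
  have hε : 0 < ε := hε
  rw [Set.disjoint_left]
  intro q q1 q2
  obtain ⟨t, t0, t1, hx, hy⟩ := mem_segment_iff.1 q1
  obtain ⟨t', t0', t1', hx', hy'⟩ := mem_segment_iff.1 q2
  simp only [det2, PiLp.add_apply, PiLp.sub_apply, PiLp.smul_apply, smul_eq_mul] at h1 k1 k2 hx hy hx' hy'
  -- The functional `det2 · db` increases along both segments and takes the same value at the end of
  -- the first and the start of the second. They could meet only with `t = 1` and `t' = 0`, but
  -- these two points differ as `s ≠ s'`.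
  have key : (1 - t) * ((b 0 - a 0 + ε * s * (db 0 - da 0)) * db 1 -
      (b 1 - a 1 + ε * s * (db 1 - da 1)) * db 0) + t' * ((c 0 - b 0 + ε * s' * (dc 0 - db 0)) * db 1 -
      (c 1 - b 1 + ε * s' * (dc 1 - db 1)) * db 0) = 0 := by
    linear_combination db 1 * (hx - hx') - db 0 * (hy - hy')
  have m1 := mul_nonneg (sub_nonneg.2 t1) k1.le
  have m2 := mul_nonneg t0' k2.le
  have n1 := (mul_eq_zero.1 (show _ = 0 by linarith : (1 - t) * ((b 0 - a 0 + ε * s * (db 0 - da 0)) * db 1 -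
      (b 1 - a 1 + ε * s * (db 1 - da 1)) * db 0) = 0)).resolve_right k1.ne'
  have n2 := (mul_eq_zero.1 (show _ = 0 by linarith : t' * ((c 0 - b 0 + ε * s' * (dc 0 - db 0)) * db 1 -
      (c 1 - b 1 + ε * s' * (dc 1 - db 1)) * db 0) = 0)).resolve_right k2.ne'
  obtain rfl : t = 1 := by linarith
  subst n2
  have z0 : (ε * (s - s')) * db 0 = 0 := by linear_combination hx' - hx
  have z1 : (ε * (s - s')) * db 1 = 0 := by linear_combination hy' - hy
  have hne : ε * (s - s') ≠ 0 := mul_ne_zero hε.ne' (sub_ne_zero.2 hs)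
  have z0 := (mul_eq_zero.1 z0).resolve_left hne
  have z1 := (mul_eq_zero.1 z1).resolve_left hne
  rw [z0, z1] at h1
  simp at h1

/-- At a bend, some direction points to the left of both segments. -/
theorem exists_left_direction {a b c : Plane} (h : det2 (b - a) (c - a) ≠ 0) :
    ∃ d, 0 < det2 (b - a) d ∧ 0 < det2 (c - b) d := by
  have hD : det2 (b - a) (c - b) ≠ 0 := by
    intro h'
    apply h
    simp only [det2, PiLp.sub_apply] at h' ⊢
    linear_combination h'
  -- With `u = b - a` and `w = c - b`, the vector `(w - u) / det2 u w` has determinant 1 with both.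
  refine ⟨(det2 (b - a) (c - b))⁻¹ • ((c - b) - (b - a)), ?_, ?_⟩
  · have : det2 (b - a) ((det2 (b - a) (c - b))⁻¹ • ((c - b) - (b - a))) = 1 := by
      have : det2 (b - a) ((det2 (b - a) (c - b))⁻¹ • ((c - b) - (b - a))) =
          (det2 (b - a) (c - b))⁻¹ * det2 (b - a) (c - b) := by
        simp only [det2, PiLp.sub_apply, PiLp.smul_apply, smul_eq_mul]
        ring
      rw [this, inv_mul_cancel₀ hD]
    rw [this]
    exact one_pos
  · have : det2 (c - b) ((det2 (b - a) (c - b))⁻¹ • ((c - b) - (b - a))) = 1 := by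
      have : det2 (c - b) ((det2 (b - a) (c - b))⁻¹ • ((c - b) - (b - a))) =
          (det2 (b - a) (c - b))⁻¹ * det2 (b - a) (c - b) := by
        simp only [det2, PiLp.sub_apply, PiLp.smul_apply, smul_eq_mul]
        ring
      rw [this, inv_mul_cancel₀ hD]
    rw [this]
    exact one_pos

namespace PolyDrawing
variable {V N : Type*} {G : SimpleGraph V} (K : PolyDrawing G N)

/-- The sequence of nodes of an edge, with a direction to the left at every bend. -/
theorem exists_lanes {u v : V} (h : G.Adj u v) :
    ∃ (l : ℕ) (x : ℕ → N) (d : N → Plane), 0 < l ∧ x 0 = K.vert u ∧ x l = K.vert v ∧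
      (∀ i ≤ l, ∀ j ≤ l, x i = x j → i = j) ∧
      (∀ s, s ∈ K.S s(u, v) ↔ ∃ i < l, s = s(x i, x (i + 1))) ∧ (∀ w, d (K.vert w) = 0) ∧
      ∀ i, i + 1 < l → 0 < det2 (K.P (x (i + 1)) - K.P (x i)) (d (x (i + 1))) ∧
        0 < det2 (K.P (x (i + 2)) - K.P (x (i + 1))) (d (x (i + 1))) := by
  classical
  obtain ⟨l, x, h0, hl, hx, hS⟩ := K.path u v h
  have hxi : ∀ i ≤ l, ∀ j ≤ l, x i = x j → i = j := fun i hi j hj hij => hx hi hj hij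
  have hlpos : 0 < l := by
    rcases Nat.eq_zero_or_pos l with rfl | h'
    · exact (h.ne (K.vert_inj (h0.symm.trans hl))).elim
    · exact h'
  have hd : ∀ i, ∃ d, i + 1 < l → 0 < det2 (K.P (x (i + 1)) - K.P (x i)) d ∧
      0 < det2 (K.P (x (i + 2)) - K.P (x (i + 1))) d := by
    intro i
    by_cases hi : i + 1 < l
    · have hne : ∀ a b, a ≤ l → b ≤ l → a ≠ b → x a ≠ x b := fun a b ha hb hab h =>
        hab (hxi a ha b hb h)
      obtain ⟨d, hd⟩ := exists_left_direction (K.gen.noncol (x i) (x (i + 1)) (x (i + 2))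
        (hne _ _ (by omega) (by omega) (by omega)) (hne _ _ (by omega) (by omega) (by omega))
        (hne _ _ (by omega) (by omega) (by omega)))
      exact ⟨d, fun _ => hd⟩
    · exact ⟨0, fun h => (hi h).elim⟩
  choose d hd using hd
  -- The default value 0 applies at the vertices, which are never interior nodes of the path; it
  -- makes every lane start and end exactly at the vertices.
  let d' : N → Plane := fun n => if h : ∃ i, i + 1 < l ∧ n = x (i + 1) then d h.choose else 0
  have hd' : ∀ i, i + 1 < l → d' (x (i + 1)) = d i := by
    intro i hi
    have hex : ∃ j, j + 1 < l ∧ x (i + 1) = x (j + 1) := ⟨i, hi, rfl⟩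
    have h1 := hex.choose_spec
    have h2 := hxi (i + 1) hi.le _ h1.1.le h1.2
    simp only [d', dif_pos hex]
    congr 1
    omega
  refine ⟨l, x, d', hlpos, h0, hl, hxi, fun s => by rw [hS]; rfl, ?_, ?_⟩
  · intro w
    refine dif_neg ?_
    rintro ⟨i, hi, hw⟩
    have hmem : w ∈ s(u, v) := K.vert_mem s(u, v) h s(x i, x (i + 1))
      (by rw [hS]; exact ⟨i, by omega, rfl⟩) w (by rw [hw]; simp)
    rcases Sym2.mem_iff.1 hmem with rfl | rfl
    · have := hxi (i + 1) hi.le 0 (by omega) (by rw [h0, hw])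
      omega
    · have := hxi (i + 1) hi.le l (by omega) (by rw [hl, hw])
      omega
  · intro i hi
    rw [hd' i hi]
    exact hd i hi

/-- A vertex on `e` is an end of its path, and an end node belongs to only one segment. -/
theorem end_seg_unique {e : Sym2 V} (he : e ∈ G.edgeSet) {s t : Sym2 N} (hs : s ∈ K.S e)
    (ht : t ∈ K.S e) {v : V} (h1 : K.vert v ∈ s) (h2 : K.vert v ∈ t) : s = t := by
  have hv := K.vert_mem e he s hs v h1
  obtain ⟨w, rfl⟩ := Sym2.mem_iff_exists.1 hv
  obtain ⟨l, x, h0, -, hx, hS⟩ := K.path v w he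
  rw [hS] at hs ht
  have key : ∀ i < l, K.vert v ∈ s(x i, x (i + 1)) → i = 0 := by
    intro i hi h
    rw [← h0] at h
    rcases Sym2.mem_iff.1 h with h | h
    · exact (hx (by simp) (by simp; omega) h).symm
    · have := hx (by simp) (by simp; omega) h
      omega
  obtain ⟨i, hi, rfl⟩ := hs
  obtain ⟨j, hj, rfl⟩ := ht
  rw [key i hi h1, key j hj h2]

/-- A common vertex determines the end segment of `e` and that of `f`, hence the pair. -/
theorem ncard_end_pairs_le [Finite V] {e f : Sym2 V} (he : e ∈ G.edgeSet) (hf : f ∈ G.edgeSet) :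
    {z : Sym2 N × Sym2 N | z.1 ∈ K.S e ∧ z.2 ∈ K.S f ∧ ∃ v, K.vert v ∈ z.1 ∧ K.vert v ∈ z.2}.ncard ≤
      {v | v ∈ e ∧ v ∈ f}.ncard := by
  classical
  let F : Sym2 V → V → Sym2 N := fun e v =>
    if h : ∃ s ∈ K.S e, K.vert v ∈ s then h.choose else s(K.vert v, K.vert v)
  have hF : ∀ e ∈ G.edgeSet, ∀ s ∈ K.S e, ∀ v, K.vert v ∈ s → F e v = s := by
    intro e he s hs v hv
    have hex : ∃ s ∈ K.S e, K.vert v ∈ s := ⟨s, hs, hv⟩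
    simp only [F, dif_pos hex]
    exact K.end_seg_unique he hex.choose_spec.1 hs hex.choose_spec.2 hv
  refine (ncard_le_ncard (t := (fun v => (F e v, F f v)) '' {v | v ∈ e ∧ v ∈ f}) ?_
    (toFinite _)).trans (ncard_image_le (toFinite _))
  rintro ⟨s, t⟩ ⟨hs, ht, v, h1, h2⟩
  exact ⟨v, ⟨K.vert_mem e he s hs v h1, K.vert_mem f hf t ht v h2⟩,
    Prod.ext (hF e he s hs v h1) (hF f hf t ht v h2)⟩

end PolyDrawing

/-! ### Polygonal drawings of blow-ups -/

section
variable {V N : Type*} {m : ℕ}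

/-- The node of the blow-up drawing that the copy `e` of an edge has in place of the node `n`. -/
noncomputable def laneNode (vert : V → N) (e : Sym2 (V × Fin m)) (n : N) :
    (V × Fin m) ⊕ (Sym2 (V × Fin m) × N) :=
  open Classical in if h : ∃ a ∈ e, vert a.1 = n then Sum.inl h.choose else Sum.inr (e, n)

theorem mem_of_laneNode_eq_inl {vert : V → N} {e : Sym2 (V × Fin m)} {n : N} {a : V × Fin m}
    (h : laneNode vert e n = Sum.inl a) : a ∈ e ∧ vert a.1 = n := by
  unfold laneNode at h
  split_ifs at h with h'
  have := h'.choose_spec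
  rw [Sum.inl.inj h] at this
  exact this

theorem eq_of_laneNode_eq_inr {vert : V → N} {e e' : Sym2 (V × Fin m)} {n n' : N}
    (h : laneNode vert e n = Sum.inr (e', n')) : e = e' := by
  unfold laneNode at h
  split_ifs at h with h'
  exact congrArg Prod.fst (Sum.inr.inj h)

theorem laneNode_vert {G : SimpleGraph V} {vert : V → N} (hv : Function.Injective vert)
    {e : Sym2 (V × Fin m)} (he : e ∈ (G.comap Prod.fst).edgeSet) {a : V × Fin m} (ha : a ∈ e) :
    laneNode vert e (vert a.1) = Sum.inl a := by
  have hex : ∃ b ∈ e, vert b.1 = vert a.1 := ⟨a, ha, rfl⟩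
  unfold laneNode
  rw [dif_pos hex]
  congr 1
  have h1 := hex.choose_spec
  by_contra hne
  have hab := (Sym2.mem_and_mem_iff hne).1 ⟨h1.1, ha⟩
  rw [hab] at he
  exact SimpleGraph.Adj.ne he (hv h1.2)

theorem mem_edgeSet_comap {G : SimpleGraph V} {e : Sym2 (V × Fin m)} :
    e ∈ (G.comap Prod.fst).edgeSet ↔ e.map Prod.fst ∈ G.edgeSet := by
  induction e using Sym2.ind with
  | _ a b => rfl

/-- The positions of the nodes of the blow-up drawing. -/
noncomputable def lanePos (K : N → Plane) (vert : V → N) (d : Sym2 V → N → Plane)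
    (σ : Sym2 (V × Fin m) → ℝ) (ε : ℝ) : (V × Fin m) ⊕ (Sym2 (V × Fin m) × N) → Plane :=
  -- All copies of a vertex are placed at the same point; they are separated only by the later
  -- perturbation to general position.
  Sum.elim (fun a => K (vert a.1)) fun a => K a.2 + (ε * σ a.1) • d (a.1.map Prod.fst) a.2

theorem lanePos_laneNode (P : N → Plane) (vert : V → N) (d : Sym2 V → N → Plane)
    (σ : Sym2 (V × Fin m) → ℝ) (ε : ℝ) (e : Sym2 (V × Fin m))
    (hd : ∀ w, d (e.map Prod.fst) (vert w) = 0) (n : N) :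
    lanePos P vert d σ ε (laneNode vert e n) = P n + (ε * σ e) • d (e.map Prod.fst) n := by
  rcases h : laneNode vert e n with a | ⟨e', n'⟩
  · obtain ⟨-, rfl⟩ := mem_of_laneNode_eq_inl h
    rw [hd]
    simp [lanePos]
  · unfold laneNode at h
    split_ifs at h with h'
    obtain ⟨rfl, rfl⟩ := Prod.mk.inj (Sum.inr.inj h)
    rfl

end

/-- The copies of an edge run in lanes at distances proportional to a small `ε`. Lanes of different
edges can meet only where the original segments meet, that is, at crossings or at common vertices.
Lanes of one edge are disjoint apart from their first and last segments, which contain a common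
vertex of the underlying edge; the second summand pays for these. -/
theorem PolyDrawing.exists_blowup {V N : Type u} [Finite V] [Finite N] {G : SimpleGraph V}
    (K : PolyDrawing G N) (m : ℕ) :
    ∃ (N' : Type u) (_ : Finite N') (K' : PreDrawing (G.comap (Prod.fst : V × Fin m → V)) N'),
      ∀ e ∈ (G.comap (Prod.fst : V × Fin m → V)).edgeSet,
      ∀ f ∈ (G.comap (Prod.fst : V × Fin m → V)).edgeSet, e ≠ f →
        (K'.pairs e f).ncard ≤ {z | e.map Prod.fst ≠ f.map Prod.fst ∧
          z ∈ K.pairs (e.map Prod.fst) (f.map Prod.fst)}.ncard +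
          {v | v ∈ e.map Prod.fst ∧ v ∈ f.map Prod.fst}.ncard := by
  classical
  let π : Sym2 (V × Fin m) → Sym2 V := Sym2.map Prod.fst
  let H := G.comap (Prod.fst : V × Fin m → V)
  have hlanes : ∀ e : Sym2 V, ∃ (d : N → Plane), e ∈ G.edgeSet → (∀ w, d (K.vert w) = 0) ∧
      ∃ (l : ℕ) (x : ℕ → N), (∃ u, x 0 = K.vert u) ∧ (∃ v, x l = K.vert v) ∧
      (∀ s, s ∈ K.S e ↔ ∃ i < l, s = s(x i, x (i + 1))) ∧
      (∀ i ≤ l, ∀ j ≤ l, x i = x j → i = j) ∧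
      ∀ i, i + 1 < l → 0 < det2 (K.P (x (i + 1)) - K.P (x i)) (d (x (i + 1))) ∧
        0 < det2 (K.P (x (i + 2)) - K.P (x (i + 1))) (d (x (i + 1))) := by
    intro e
    by_cases he : e ∈ G.edgeSet
    · induction e using Sym2.ind with
      | _ u v =>
        obtain ⟨l, x, d, -, h0, hl, hx, hS, hd, hdet⟩ := K.exists_lanes he
        exact ⟨d, fun _ => ⟨hd, l, x, ⟨u, h0⟩, ⟨v, hl⟩, hS, hx, hdet⟩⟩
    · exact ⟨0, fun h => (he h).elim⟩
  choose d hd using hlanes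
  obtain ⟨k, ⟨φ⟩⟩ := Finite.exists_equiv_fin (Sym2 (V × Fin m))
  -- Any injective choice of offsets separates the lanes.
  let σ : Sym2 (V × Fin m) → ℝ := fun e => (φ e : ℕ)
  have hσ : ∀ e f, e ≠ f → σ e ≠ σ f := by
    intro e f hef h
    have h' : (φ e : ℕ) = φ f := Nat.cast_injective (R := ℝ) h
    exact hef (φ.injective (Fin.ext h'))
  let ν := fun e : Sym2 (V × Fin m) => laneNode K.vert e
  let P' := lanePos K.P K.vert d σ
  let Lane : ℝ → Sym2 (V × Fin m) → N → Plane := fun ε e n => K.P n + (ε * σ e) • d (π e) n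
  have hsseg : ∀ ε, ∀ e ∈ H.edgeSet, ∀ s : Sym2 N,
      sseg (P' ε) (s.map (ν e)) = sseg (Lane ε e) s := by
    intro ε e he s
    induction s using Sym2.ind with
    | _ a b =>
      rw [Sym2.map_mk]
      simp only [sseg_mk, P', ν, Lane]
      rw [lanePos_laneNode _ _ _ _ _ _ (hd _ (mem_edgeSet_comap.1 he)).1,
        lanePos_laneNode _ _ _ _ _ _ (hd _ (mem_edgeSet_comap.1 he)).1]
  have hlim : ∀ e n, Tendsto (fun ε => Lane ε e n) (𝓝[>] 0) (𝓝 (K.P n)) := by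
    intro e n
    have : Continuous fun ε => Lane ε e n := by fun_prop
    have := this.tendsto 0
    simp only [Lane, zero_mul, zero_smul, add_zero] at this
    exact this.mono_left nhdsWithin_le_nhds
  have hlimd : ∀ e f (s t : Sym2 N), Disjoint (sseg K.P s) (sseg K.P t) →
      ∀ᶠ ε in 𝓝[>] (0 : ℝ), Disjoint (sseg (Lane ε e) s) (sseg (Lane ε f) t) := by
    intro e f s t h
    induction s using Sym2.ind with
    | _ a b =>
    induction t using Sym2.ind with
    | _ a' b' =>
      exact eventually_disjoint_segment (hlim e a) (hlim e b) (hlim f a') (hlim f b') h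
  -- The pairs whose lanes may meet: true crossings of different underlying edges, and pairs of
  -- segments with a common vertex. The second set includes the end segments of two copies of one
  -- edge.
  let Bad : Sym2 (V × Fin m) → Sym2 (V × Fin m) → Set (Sym2 N × Sym2 N) := fun e f =>
    {z | π e ≠ π f ∧ z ∈ K.pairs (π e) (π f)} ∪
      {z | z.1 ∈ K.S (π e) ∧ z.2 ∈ K.S (π f) ∧ ∃ v, K.vert v ∈ z.1 ∧ K.vert v ∈ z.2}
  have hev : ∀ᶠ ε in 𝓝[>] (0 : ℝ), ∀ e f : Sym2 (V × Fin m), ∀ s t : Sym2 N,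
      e ∈ H.edgeSet → f ∈ H.edgeSet → s ∈ K.S (π e) → t ∈ K.S (π f) →
      (Disjoint (sseg K.P s) (sseg K.P t) → Disjoint (sseg (Lane ε e) s) (sseg (Lane ε f) t)) ∧
      (e ≠ f → (s, t) ∉ Bad e f → Disjoint (sseg (Lane ε e) s) (sseg (Lane ε f) t)) := by
    have := Fintype.ofFinite V
    have := Fintype.ofFinite N
    simp only [eventually_all]
    intro e f s t he hf hs ht
    have he' : π e ∈ G.edgeSet := mem_edgeSet_comap.1 he
    have hf' : π f ∈ G.edgeSet := mem_edgeSet_comap.1 hf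
    by_cases hdis : Disjoint (sseg K.P s) (sseg K.P t)
    · filter_upwards [hlimd e f s t hdis] with ε hε
      exact ⟨fun _ => hε, fun _ _ => hε⟩
    by_cases hef : e ≠ f ∧ (s, t) ∉ Bad e f
    swap
    · refine Eventually.of_forall fun ε => ⟨fun h => (hdis h).elim, fun h1 h2 =>
        (hef ⟨h1, h2⟩).elim⟩
    suffices ∀ᶠ ε in 𝓝[>] (0 : ℝ), Disjoint (sseg (Lane ε e) s) (sseg (Lane ε f) t) by
      filter_upwards [this] with ε hε
      exact ⟨fun _ => hε, fun _ _ => hε⟩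
    obtain ⟨hef, hbad⟩ := hef
    simp only [Bad, mem_union, not_or] at hbad
    obtain ⟨hbad1, hbad2⟩ := hbad
    by_cases hπ : π e = π f
    swap
    · exfalso
      by_cases hst : Apart s t
      · exact hbad1 ⟨hπ, hs, ht, hst, hdis⟩
      · simp only [Apart, not_forall, not_not] at hst
        obtain ⟨n, n1, n2⟩ := hst
        obtain ⟨v, -, -, rfl⟩ := K.common _ he' _ hf' hπ s hs t ht n n1 n2
        exact hbad2 ⟨hs, ht, v, n1, n2⟩
    -- From here on `e` and `f` are copies of one edge. Its path is simple, so intersecting segments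
    -- are equal or consecutive.
    have hst : ¬ Apart s t := fun h => hdis (K.simple _ he' s hs t (hπ ▸ ht) h)
    obtain ⟨-, l, x, ⟨u, hu⟩, ⟨v, hv⟩, hS, hx, hdet⟩ := hd _ he'
    have hend : ∀ w, K.vert w ∈ s → K.vert w ∉ t := fun w h1 h2 => hbad2 ⟨hs, ht, w, h1, h2⟩
    rw [hS] at hs
    rw [← hπ, hS] at ht
    obtain ⟨i, hi, rfl⟩ := hs
    obtain ⟨j, hj, rfl⟩ := ht
    simp only [Lane, sseg_mk, ← hπ]
    have hij : i = j ∨ i + 1 = j ∨ j + 1 = i := by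
      by_contra hne
      apply hst
      intro n n1 n2
      rcases Sym2.mem_iff.1 n1 with rfl | rfl <;> rcases Sym2.mem_iff.1 n2 with h | h
      · have := hx _ (by omega) _ (by omega) h; omega
      · have := hx _ (by omega) _ (by omega) h; omega
      · have := hx _ (by omega) _ (by omega) h; omega
      · have := hx _ (by omega) _ (by omega) h; omega
    rcases hij with rfl | rfl | rfl
    -- Equal segments: a first or last one would contain a vertex and belong to `Bad`, so both ends
    -- are bends and have directions to the left.
    · rcases i with _ | i
      · exact (hend u (by simp [hu]) (by simp [hu])).elim
      by_cases hil : i + 1 + 1 = l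
      · exact (hend v (by simp [← hv, hil]) (by simp [← hv, hil])).elim
      · exact eventually_disjoint_lanes (hdet i hi).2 (hdet (i + 1) (by omega)).1 (hσ e f hef)
    · exact eventually_disjoint_turn (hdet i hj).1 (hdet i hj).2 (hσ e f hef)
    · filter_upwards [eventually_disjoint_turn (da := d (π e) (x j))
        (dc := d (π e) (x (j + 1 + 1))) (hdet j hi).1 (hdet j hi).2 (hσ f e hef.symm)] with ε hε
      exact hε.symm
  obtain ⟨ε, hε⟩ := hev.exists
  let K' : PreDrawing H ((V × Fin m) ⊕ (Sym2 (V × Fin m) × N)) :=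
    { vert := Sum.inl
      P := P' ε
      S := fun e => Sym2.map (ν e) '' K.S (π e)
      vert_inj := Sum.inl_injective
      reach := by
        intro a b hab
        have h := K.reach a.1 b.1 hab
        have key : ∀ n n', Relation.ReflTransGen (fun a' b' => s(a', b') ∈ K.S s(a.1, b.1)) n n' →
            Relation.ReflTransGen (fun a' b' => s(a', b') ∈ Sym2.map (ν s(a, b)) '' K.S (π s(a, b)))
              (ν s(a, b) n) (ν s(a, b) n') := by
          intro n n' h
          induction h with
          | refl => exact .refl
          | tail _ h ih => exact .tail ih ⟨_, h, Sym2.map_mk ..⟩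
        have := key _ _ h
        rwa [show ν s(a, b) (K.vert a.1) = Sum.inl a from
            laneNode_vert (G := G) K.vert_inj hab (by simp),
          show ν s(a, b) (K.vert b.1) = Sum.inl b from
            laneNode_vert (G := G) K.vert_inj hab (by simp)] at this
      common := by
        rintro e he f hf hef _ ⟨s, hs, rfl⟩ _ ⟨t, ht, rfl⟩ n n1 n2
        obtain ⟨a, ha, rfl⟩ := Sym2.mem_map.1 n1
        obtain ⟨b, hb, hab⟩ := Sym2.mem_map.1 n2
        rcases h : ν e a with c | ⟨e', n'⟩
        · exact ⟨c, (mem_of_laneNode_eq_inl h).1, (mem_of_laneNode_eq_inl (hab.trans h)).1, rfl⟩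
        · exact (hef ((eq_of_laneNode_eq_inr h).trans
            (eq_of_laneNode_eq_inr (hab.trans h)).symm)).elim
      vert_mem := by
        rintro e he _ ⟨s, hs, rfl⟩ v hv
        obtain ⟨a, ha, hav⟩ := Sym2.mem_map.1 hv
        exact (mem_of_laneNode_eq_inl hav).1
      simple := by
        rintro e he _ ⟨s, hs, rfl⟩ _ ⟨t, ht, rfl⟩ hst
        rw [hsseg ε e he, hsseg ε e he]
        refine (hε e e s t he he hs ht).1 (K.simple _ (mem_edgeSet_comap.1 he) s hs t ht ?_)
        exact fun n n1 n2 => hst (ν e n) (Sym2.mem_map.2 ⟨n, n1, rfl⟩) (Sym2.mem_map.2 ⟨n, n2, rfl⟩) }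
  refine ⟨_, inferInstance, K', fun e he f hf hef => ?_⟩
  have hsub : K'.pairs e f ⊆ (Prod.map (Sym2.map (ν e)) (Sym2.map (ν f))) '' Bad e f := by
    rintro ⟨_, _⟩ ⟨⟨s, hs, rfl⟩, ⟨t, ht, rfl⟩, -, hdis⟩
    refine ⟨(s, t), ?_, rfl⟩
    by_contra hbad
    apply hdis
    change Disjoint (sseg (P' ε) (s.map (ν e))) (sseg (P' ε) (t.map (ν f)))
    rw [hsseg ε e he, hsseg ε f hf]
    exact (hε e f s t he hf hs ht).2 hef hbad
  refine (ncard_le_ncard hsub (toFinite _)).trans ((ncard_image_le (toFinite _)).trans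
    ((ncard_union_le _ _).trans (Nat.add_le_add_left ?_ _)))
  exact K.ncard_end_pairs_le (mem_edgeSet_comap.1 he) (mem_edgeSet_comap.1 hf)

end CrossingNumber

namespace CrossingNumber
open Set Filter Topology

/-! ### Rerouting an edge along an adjacent edge -/

theorem exists_linear_separating {a b p : Plane} (hp : p ∈ segment ℝ a b) (ha : p ≠ a)
    (hb : p ≠ b) : ∃ φ : Plane →ₗ[ℝ] ℝ, φ a < φ p ∧ φ p < φ b := by
  have hab : a ≠ b := by
    rintro rfl
    rw [segment_same] at hp
    exact ha hp
  let φ : Plane →ₗ[ℝ] ℝ := (innerSL ℝ (b - a)).toLinearMap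
  have hφ : ∀ z, φ z = inner ℝ (b - a) z := fun z => rfl
  have hL : 0 < φ b - φ a := by
    rw [← map_sub, hφ, real_inner_self_eq_norm_sq]
    have : 0 < ‖b - a‖ := norm_pos_iff.2 (sub_ne_zero.2 hab.symm)
    positivity
  rw [segment_eq_image] at hp
  obtain ⟨t, ht, rfl⟩ := hp
  have h0 : 0 < t := by
    refine lt_of_le_of_ne ht.1 ?_
    rintro rfl
    simp at ha
  have h1 : t < 1 := by
    refine lt_of_le_of_ne ht.2 ?_
    rintro rfl
    simp at hb
  refine ⟨φ, ?_, ?_⟩ <;> simp only [map_add, map_smul, smul_eq_mul] <;> nlinarith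

theorem le_of_mem_segment {φ : Plane →ₗ[ℝ] ℝ} {a b q : Plane} {r : ℝ} (ha : r ≤ φ a)
    (hb : r ≤ φ b) (hq : q ∈ segment ℝ a b) : r ≤ φ q :=
  (convex_halfSpace_ge φ.isLinear r).segment_subset ha hb hq

theorem ge_of_mem_segment {φ : Plane →ₗ[ℝ] ℝ} {a b q : Plane} {r : ℝ} (ha : φ a ≤ r)
    (hb : φ b ≤ r) (hq : q ∈ segment ℝ a b) : φ q ≤ r :=
  (convex_halfSpace_le φ.isLinear r).segment_subset ha hb hq

theorem right_notMem_segment {a b p : Plane} (hp : p ∈ segment ℝ a b) (ha : p ≠ a)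
    (hb : p ≠ b) : b ∉ segment ℝ a p := by
  obtain ⟨φ, h1, h2⟩ := exists_linear_separating hp ha hb
  exact fun h => absurd (ge_of_mem_segment h1.le le_rfl h) (not_le.2 h2)

theorem left_notMem_segment {a b p : Plane} (hp : p ∈ segment ℝ a b) (ha : p ≠ a)
    (hb : p ≠ b) : a ∉ segment ℝ p b := by
  obtain ⟨φ, h1, h2⟩ := exists_linear_separating hp ha hb
  exact fun h => absurd (le_of_mem_segment le_rfl h2.le h) (not_le.2 h1)

theorem segment_tail {a b p : Plane} (hp : p ∈ segment ℝ a b) (ha : p ≠ a)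
    (hb : p ≠ b) {ε : ℝ} (h0 : 0 < ε) (h1 : ε < 1) :
    segment ℝ (p + ε • (b - p)) b ⊆ segment ℝ a b ∧
      Disjoint (segment ℝ (p + ε • (b - p)) b) (segment ℝ a p) := by
  constructor
  · refine (convex_segment a b).segment_subset ?_ (right_mem_segment _ _ _)
    refine (convex_segment a b).segment_subset hp (right_mem_segment _ _ _) ?_
    exact ⟨1 - ε, ε, by linarith, h0.le, by ring, by module⟩
  · obtain ⟨φ, h2, h3⟩ := exists_linear_separating hp ha hb
    rw [Set.disjoint_left]
    intro q q1 q2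
    have k1 := ge_of_mem_segment h2.le le_rfl q2
    have k2 : φ p + ε * (φ b - φ p) ≤ φ q := by
      refine le_of_mem_segment ?_ ?_ q1
      · simp
      · nlinarith
    nlinarith

theorem disjoint_segment_of_mul_det_pos {σ : ℝ} {a b c d : Plane}
    (hc : 0 < σ * det2 (b - a) (c - a)) (hd : 0 < σ * det2 (b - a) (d - a)) :
    Disjoint (segment ℝ a b) (segment ℝ c d) := by
  rw [Set.disjoint_left]
  intro q h1 h2
  have h := det2_eq_zero_of_mem_segment h1
  obtain ⟨t, h0, h1', hx, hy⟩ := mem_segment_iff.1 h2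
  have : σ * det2 (b - a) (q - a) =
      (1 - t) * (σ * det2 (b - a) (c - a)) + t * (σ * det2 (b - a) (d - a)) := by
    simp only [det2, PiLp.sub_apply, hx, hy]
    ring
  rw [h, mul_zero] at this
  rcases h0.eq_or_lt with rfl | h0
  · linarith
  · nlinarith [mul_pos h0 hd, mul_nonneg (sub_nonneg.2 h1') hc.le]

theorem sseg_map {N M : Type*} (P : M → Plane) (f : N → M) (s : Sym2 N) :
    sseg P (s.map f) = sseg (fun n => P (f n)) s := by
  induction s using Sym2.ind with
  | _ a b => rfl

/-- The sequence of nodes of the edge `uv`, with directions to the left at its bends. -/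
structure LaneSeq {V N : Type*} {G : SimpleGraph V} (K : PolyDrawing G N) (u v : V) where
  l : ℕ
  x : ℕ → N
  d : N → Plane
  l_pos : 0 < l
  x_zero : x 0 = K.vert u
  x_l : x l = K.vert v
  inj : ∀ i ≤ l, ∀ j ≤ l, x i = x j → i = j
  mem_iff : ∀ s, s ∈ K.S s(u, v) ↔ ∃ i < l, s = s(x i, x (i + 1))
  d_vert : ∀ w, d (K.vert w) = 0
  det : ∀ i, i + 1 < l → 0 < det2 (K.P (x (i + 1)) - K.P (x i)) (d (x (i + 1))) ∧
        0 < det2 (K.P (x (i + 2)) - K.P (x (i + 1))) (d (x (i + 1)))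

theorem PolyDrawing.nonempty_laneSeq {V N : Type*} {G : SimpleGraph V} (K : PolyDrawing G N)
    {u v : V} (h : G.Adj u v) : Nonempty (LaneSeq K u v) := by
  obtain ⟨l, x, d, h1, h2, h3, h4, h5, h6, h7⟩ := K.exists_lanes h
  exact ⟨⟨l, x, d, h1, h2, h3, h4, h5, h6, h7⟩⟩

namespace LaneSeq
variable {V N : Type*} {G : SimpleGraph V} {K : PolyDrawing G N} {u v : V} (A : LaneSeq K u v)

/-- The `n`-th segment. -/
def seg (n : ℕ) : Sym2 N := s(A.x n, A.x (n + 1))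

/-- The part of the edge from its first node to the point `p` of the segment `i`. -/
def pre (i : ℕ) (p : Plane) : Set Plane :=
  {q | (∃ n < i, q ∈ sseg K.P (A.seg n)) ∨ q ∈ segment ℝ (K.P (A.x i)) p}

theorem seg_mem {n : ℕ} (hn : n < A.l) : A.seg n ∈ K.S s(u, v) := (A.mem_iff _).2 ⟨n, hn, rfl⟩

theorem mem_seg {a n : ℕ} (ha : a ≤ A.l) (hn : n < A.l) (h : A.x a ∈ A.seg n) :
    a = n ∨ a = n + 1 := by
  rcases Sym2.mem_iff.1 h with h | h
  · exact Or.inl (A.inj _ ha _ hn.le h)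
  · exact Or.inr (A.inj _ ha _ hn h)

theorem apart {n m : ℕ} (hn : n < A.l) (hm : m < A.l) (h1 : n ≠ m) (h2 : n + 1 ≠ m)
    (h3 : m + 1 ≠ n) : Apart (A.seg n) (A.seg m) := by
  intro z z1 z2
  rcases Sym2.mem_iff.1 z1 with rfl | rfl
  · rcases A.mem_seg hn.le hm z2 with h | h <;> omega
  · rcases A.mem_seg hn hm z2 with h | h <;> omega

theorem seg_ne {n m : ℕ} (hn : n < A.l) (hm : m < A.l) (h : n ≠ m) : A.seg n ≠ A.seg m := by
  intro he
  have h1 : A.x n ∈ A.seg m := he ▸ Sym2.mem_mk_left _ _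
  have h2 : A.x (n + 1) ∈ A.seg m := he ▸ Sym2.mem_mk_right _ _
  rcases A.mem_seg hn.le hm h1 with h | h <;> rcases A.mem_seg hn hm h2 with h' | h' <;> omega

theorem first_of_mem {n : ℕ} (hn : n < A.l) (h : K.vert u ∈ A.seg n) : n = 0 := by
  rw [← A.x_zero] at h
  rcases A.mem_seg (Nat.zero_le _) hn h with h | h <;> omega

theorem last_of_mem {n : ℕ} (hn : n < A.l) (h : K.vert v ∈ A.seg n) : n + 1 = A.l := by
  rw [← A.x_l] at h
  rcases A.mem_seg le_rfl hn h with h | h <;> omega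

theorem vert_mem_pre (i : ℕ) (p : Plane) : K.P (K.vert u) ∈ A.pre i p := by
  rw [← A.x_zero]
  rcases Nat.eq_zero_or_pos i with rfl | h
  · exact Or.inr (left_mem_segment _ _ _)
  · exact Or.inl ⟨0, h, left_mem_segment _ _ _⟩

theorem mem_pre_self (i : ℕ) (p : Plane) : p ∈ A.pre i p := Or.inr (right_mem_segment _ _ _)

end LaneSeq

/-- A crossing `p` of the edges `va` and `vb`. -/
structure Meeting {V N : Type*} {G : SimpleGraph V} (K : PolyDrawing G N) (v a b : V) where
  adjA : G.Adj v a
  adjB : G.Adj v b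
  ne : a ≠ b
  A : LaneSeq K v a
  B : LaneSeq K v b
  i : ℕ
  j : ℕ
  p : Plane
  hi : i < A.l
  hj : j < B.l
  memA : p ∈ sseg K.P (A.seg i)
  memB : p ∈ sseg K.P (B.seg j)
  apart : Apart (A.seg i) (B.seg j)

/-- The pairs of crossing segments of two edges whose crossing lies in `X`. -/
def PreDrawing.pairsIn {V N : Type*} {G : SimpleGraph V} (K : PreDrawing G N) (e f : Sym2 V)
    (X : Set Plane) : Set (Sym2 N × Sym2 N) :=
  {z | z ∈ K.pairs e f ∧ ∃ q ∈ X, q ∈ sseg K.P z.1 ∧ q ∈ sseg K.P z.2}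

namespace Meeting
variable {V N : Type*} {G : SimpleGraph V} {K : PolyDrawing G N} {v a b : V} (M : Meeting K v a b)

/-- The meeting with the roles of the two edges exchanged. -/
def swap : Meeting K v b a where
  adjA := M.adjB
  adjB := M.adjA
  ne := M.ne.symm
  A := M.B
  B := M.A
  i := M.j
  j := M.i
  p := M.p
  hi := M.hj
  hj := M.hi
  memA := M.memB
  memB := M.memA
  apart := M.apart.symm

theorem edge_ne (M : Meeting K v a b) : s(v, a) ≠ s(v, b) := by
  intro h
  rcases Sym2.eq_iff.1 h with ⟨-, h⟩ | ⟨h1, h2⟩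
  · exact M.ne h
  · exact M.ne (h2.trans h1)

theorem eq_of_mem_both (M : Meeting K v a b) {w : V} (h1 : w ∈ s(v, a)) (h2 : w ∈ s(v, b)) : w = v := by
  rcases Sym2.mem_iff.1 h1 with rfl | rfl
  · rfl
  · rcases Sym2.mem_iff.1 h2 with h | h
    · exact h
    · exact (M.ne h).elim

theorem p_ne {n : N} (hn : n ∈ M.A.seg M.i) : M.p ≠ K.P n := by
  intro h
  exact M.apart n hn (K.gen.mem_of_mem_sseg (K.not_isDiag M.adjB (M.B.seg_mem M.hj))
    (h ▸ M.memB))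

theorem p_ne_left : M.p ≠ K.P (M.A.x M.i) := M.p_ne (Sym2.mem_mk_left _ _)

theorem p_ne_right : M.p ≠ K.P (M.A.x (M.i + 1)) := M.p_ne (Sym2.mem_mk_right _ _)

theorem segA_eq {n : ℕ} (hn : n < M.A.l) (h : M.p ∈ sseg K.P (M.A.seg n)) : n = M.i := by
  by_contra hne
  exact M.A.seg_ne hn M.hi hne (K.eq_of_mem_crossing M.adjA M.adjB (M.A.seg_mem M.hi)
    (M.A.seg_mem hn) (M.B.seg_mem M.hj) M.apart M.memA M.memB h)

/-- The side of `va` to which `vb` continues after the crossing. -/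
noncomputable def σ : ℝ := open Classical in
  if 0 < det2 (K.P (M.A.x (M.i + 1)) - K.P (M.A.x M.i)) (K.P (M.B.x (M.j + 1)) - M.p) then 1 else -1

theorem σ_ne : M.σ ≠ 0 := by
  unfold σ
  split_ifs <;> norm_num

theorem σ_mul_self : M.σ * M.σ = 1 := by
  unfold σ
  split_ifs <;> norm_num

theorem σ_mul_det_pos : 0 < M.σ *
    det2 (K.P (M.A.x (M.i + 1)) - K.P (M.A.x M.i)) (K.P (M.B.x (M.j + 1)) - M.p) := by
  have hA := K.not_isDiag M.adjA (M.A.seg_mem M.hi)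
  have hB := K.not_isDiag M.adjB (M.B.seg_mem M.hj)
  have hdet := K.gen.det_ne (by simpa [LaneSeq.seg] using hA) (by simpa [LaneSeq.seg] using hB)
    M.apart M.memA M.memB
  obtain ⟨t, -, ht, hx, hy⟩ := mem_segment_iff.1 M.memB
  have hne := M.swap.p_ne_right
  have ht : t ≠ 1 := by
    rintro rfl
    exact hne (plane_ext (by simp only [swap]; linarith) (by simp only [swap]; linarith))
  have h : det2 (K.P (M.A.x (M.i + 1)) - K.P (M.A.x M.i)) (K.P (M.B.x (M.j + 1)) - M.p) ≠ 0 := by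
    have : det2 (K.P (M.A.x (M.i + 1)) - K.P (M.A.x M.i)) (K.P (M.B.x (M.j + 1)) - M.p) =
        (1 - t) * det2 (K.P (M.A.x (M.i + 1)) - K.P (M.A.x M.i))
          (K.P (M.B.x (M.j + 1)) - K.P (M.B.x M.j)) := by
      simp only [det2, PiLp.sub_apply, hx, hy]
      ring
    rw [this]
    exact mul_ne_zero (sub_ne_zero.2 ht.symm) hdet
  unfold σ
  split_ifs with h'
  · linarith
  · have := lt_of_le_of_ne (not_lt.1 h') h
    linarith

/-- The positions of the nodes after rerouting `vb` along `va`. -/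
noncomputable def pos (ε : ℝ) : N ⊕ Option N → Plane :=
  -- The node `inr none` is the junction of lane and tail, on `vb` slightly beyond the crossing; the
  -- nodes `inr (some n)` are the bends of the lane.
  Sum.elim K.P fun n => n.elim (M.p + ε • (K.P (M.B.x (M.j + 1)) - M.p))
    fun n => K.P n + (ε * M.σ) • M.A.d n

/-- The nodes of the lane along `va`. -/
noncomputable def laneMap (n : N) : N ⊕ Option N := open Classical in
  if n = M.A.x 0 then Sum.inl n else if n = M.A.x (M.i + 1) then Sum.inr none
    else Sum.inr (some n)

/-- The nodes of the remaining part of `vb`. -/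
noncomputable def tailMap (n : N) : N ⊕ Option N := open Classical in
  if n = M.B.x M.j then Sum.inr none else Sum.inl n

/-- The lane positions for `ε = 0`. -/
noncomputable def laneLim (n : ℕ) : Plane :=
  if n = M.i + 1 then M.p else K.P (M.A.x n)

/-- The directions in which the lane positions move. -/
noncomputable def laneDir (n : ℕ) : Plane :=
  -- Since `σ * σ = 1`, the factor `σ` cancels the one in the offset `ε * σ`, so the last node of
  -- the lane moves along `vb`.
  if n = M.i + 1 then M.σ • (K.P (M.B.x (M.j + 1)) - M.p) else M.A.d (M.A.x n)

theorem pos_laneMap (ε : ℝ) {n : ℕ} (hn : n ≤ M.i + 1) :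
    M.pos ε (M.laneMap (M.A.x n)) = M.laneLim n + (ε * M.σ) • M.laneDir n := by
  have hi := M.hi
  unfold laneLim laneDir
  by_cases h0 : n = 0
  · subst h0
    rw [if_neg (by omega), if_neg (by omega), laneMap, if_pos rfl, M.A.x_zero, M.A.d_vert]
    simp [pos]
  · have h1 : M.A.x n ≠ M.A.x 0 := fun h => h0 (M.A.inj _ (by omega) _ (by omega) h)
    rw [laneMap, if_neg h1]
    by_cases h2 : n = M.i + 1
    · subst h2
      rw [if_pos rfl, if_pos rfl, if_pos rfl, smul_smul, mul_assoc, M.σ_mul_self, mul_one]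
      rfl
    · have h3 : M.A.x n ≠ M.A.x (M.i + 1) := fun h => h2 (M.A.inj _ (by omega) _ (by omega) h)
      rw [if_neg h3, if_neg h2, if_neg h2]
      rfl

theorem sseg_lane (ε : ℝ) {n : ℕ} (hn : n ≤ M.i) :
    sseg (M.pos ε) ((M.A.seg n).map M.laneMap) =
      segment ℝ (M.laneLim n + (ε * M.σ) • M.laneDir n)
        (M.laneLim (n + 1) + (ε * M.σ) • M.laneDir (n + 1)) := by
  rw [LaneSeq.seg, Sym2.map_mk, sseg_mk, M.pos_laneMap ε (by omega),
    M.pos_laneMap ε (by omega)]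

/-- The part of `va` along which the segment `n` of the lane runs. -/
def limSeg (n : ℕ) : Set Plane := segment ℝ (M.laneLim n) (M.laneLim (n + 1))

theorem limSeg_eq {n : ℕ} (hn : n < M.i) : M.limSeg n = sseg K.P (M.A.seg n) := by
  unfold limSeg laneLim
  rw [if_neg (by omega), if_neg (by omega)]
  rfl

theorem limSeg_last : M.limSeg M.i = segment ℝ (K.P (M.A.x M.i)) M.p := by
  unfold limSeg laneLim
  rw [if_neg (by omega), if_pos rfl]

theorem limSeg_subset {n : ℕ} (hn : n ≤ M.i) : M.limSeg n ⊆ sseg K.P (M.A.seg n) := by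
  rcases hn.eq_or_lt with rfl | hn
  · rw [limSeg_last]
    exact (convex_segment _ _).segment_subset (left_mem_segment _ _ _) M.memA
  · rw [M.limSeg_eq hn]

theorem limSeg_subset_pre {n : ℕ} (hn : n ≤ M.i) : M.limSeg n ⊆ M.A.pre M.i M.p := by
  rcases hn.eq_or_lt with rfl | hn
  · rw [limSeg_last]
    exact fun q hq => Or.inr hq
  · rw [M.limSeg_eq hn]
    exact fun q hq => Or.inl ⟨n, hn, hq⟩

theorem right_notMem_limSeg : K.P (M.A.x (M.i + 1)) ∉ M.limSeg M.i := by
  rw [limSeg_last]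
  exact right_notMem_segment M.memA M.p_ne_left M.p_ne_right

theorem tendsto_lane (c d : Plane) :
    Tendsto (fun ε : ℝ => c + (ε * M.σ) • d) (𝓝[>] 0) (𝓝 c) := by
  have : Continuous fun ε : ℝ => c + (ε * M.σ) • d := by fun_prop
  have := this.tendsto 0
  simp only [zero_mul, zero_smul, add_zero] at this
  exact this.mono_left nhdsWithin_le_nhds

theorem eventually_disjoint_lane {n : ℕ} (hn : n ≤ M.i) {t : Sym2 N}
    (h : Disjoint (M.limSeg n) (sseg K.P t)) : ∀ᶠ ε in 𝓝[>] (0 : ℝ),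
      Disjoint (sseg (M.pos ε) ((M.A.seg n).map M.laneMap)) (sseg K.P t) := by
  simp only [M.sseg_lane _ hn]
  induction t using Sym2.ind with
  | _ c d =>
    exact eventually_disjoint_segment (M.tendsto_lane _ _) (M.tendsto_lane _ _)
      tendsto_const_nhds tendsto_const_nhds h

theorem eventually_disjoint_lane_lane {n m : ℕ} (hn : n ≤ M.i) (hm : m ≤ M.i)
    (h : Apart (M.A.seg n) (M.A.seg m)) : ∀ᶠ ε in 𝓝[>] (0 : ℝ),
      Disjoint (sseg (M.pos ε) ((M.A.seg n).map M.laneMap))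
        (sseg (M.pos ε) ((M.A.seg m).map M.laneMap)) := by
  have hi := M.hi
  simp only [M.sseg_lane _ hn, M.sseg_lane _ hm]
  refine eventually_disjoint_segment (M.tendsto_lane _ _) (M.tendsto_lane _ _)
    (M.tendsto_lane _ _) (M.tendsto_lane _ _) ?_
  exact (K.simple _ M.adjA _ (M.A.seg_mem (by omega)) _ (M.A.seg_mem (by omega)) h).mono
    (M.limSeg_subset hn) (M.limSeg_subset hm)

/-- The lane is disjoint from the edge along which it runs. -/
theorem eventually_disjoint_lane_edge {n m : ℕ} (hn : n ≤ M.i) (hm : m < M.A.l)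
    (h0 : ¬ (n = 0 ∧ m = 0)) : ∀ᶠ ε in 𝓝[>] (0 : ℝ),
      Disjoint (sseg (M.pos ε) ((M.A.seg n).map M.laneMap)) (sseg K.P (M.A.seg m)) := by
  have hi := M.hi
  by_cases hnear : n = m ∨ n + 1 = m ∨ m + 1 = n
  swap
  · push Not at hnear
    refine M.eventually_disjoint_lane hn ?_
    exact (K.simple _ M.adjA _ (M.A.seg_mem (by omega)) _ (M.A.seg_mem hm)
      (M.A.apart (by omega) hm hnear.1 hnear.2.1 hnear.2.2)).mono_left (M.limSeg_subset hn)
  rcases hnear with rfl | rfl | rfl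
  · obtain ⟨k, rfl⟩ : ∃ k, n = k + 1 := ⟨n - 1, by omega⟩
    have hd := M.A.det k hm
    rcases hn.eq_or_lt with hk | hk
    -- On the crossing segment the lane ends on `vb` beyond `p`. By the choice of `σ` both ends of
    -- the lane segment lie strictly on the same side of `va`.
    · have hdir : M.laneDir (k + 1) = M.A.d (M.A.x (k + 1)) := if_neg (by omega)
      have hlim : M.laneLim (k + 1) = K.P (M.A.x (k + 1)) := if_neg (by omega)
      have hdir' : M.laneDir (k + 1 + 1) = M.σ • (K.P (M.B.x (M.j + 1)) - M.p) :=
        if_pos (by omega)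
      have hlim' : M.laneLim (k + 1 + 1) = M.p := if_pos (by omega)
      have hσ := M.σ_mul_det_pos
      have hσ2 := M.σ_mul_self
      have hline := det2_eq_zero_of_mem_segment (show M.p ∈ segment ℝ _ _ from M.memA)
      rw [← hk] at hσ hline
      filter_upwards [self_mem_nhdsWithin] with ε hε
      have hε : 0 < ε := hε
      rw [M.sseg_lane ε hn, hdir, hlim, hdir', hlim']
      refine (disjoint_segment_of_mul_det_pos (σ := M.σ) ?_ ?_).symm
      · have : M.σ * det2 (K.P (M.A.x (k + 1 + 1)) - K.P (M.A.x (k + 1)))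
            (K.P (M.A.x (k + 1)) + (ε * M.σ) • M.A.d (M.A.x (k + 1)) - K.P (M.A.x (k + 1))) =
            ε * (M.σ * M.σ) * det2 (K.P (M.A.x (k + 1 + 1)) - K.P (M.A.x (k + 1)))
              (M.A.d (M.A.x (k + 1))) := by
          simp only [det2, PiLp.add_apply, PiLp.sub_apply, PiLp.smul_apply, smul_eq_mul]
          ring
        rw [this, hσ2, mul_one]
        exact mul_pos hε hd.2
      · have : M.σ * det2 (K.P (M.A.x (k + 1 + 1)) - K.P (M.A.x (k + 1)))
            (M.p + (ε * M.σ) • M.σ • (K.P (M.B.x (M.j + 1)) - M.p) - K.P (M.A.x (k + 1))) =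
            M.σ * det2 (K.P (M.A.x (k + 1 + 1)) - K.P (M.A.x (k + 1)))
              (M.p - K.P (M.A.x (k + 1))) +
            ε * (M.σ * M.σ) * (M.σ * det2 (K.P (M.A.x (k + 1 + 1)) - K.P (M.A.x (k + 1)))
              (K.P (M.B.x (M.j + 1)) - M.p)) := by
          simp only [det2, PiLp.add_apply, PiLp.sub_apply, PiLp.smul_apply, smul_eq_mul]
          ring
        rw [this, hσ2, mul_one, hline, mul_zero, zero_add]
        exact mul_pos hε hσ
    · have hd' := M.A.det (k + 1) (by omega)
      filter_upwards [eventually_disjoint_lanes hd.2 hd'.1 M.σ_ne] with ε hε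
      rw [M.sseg_lane ε hn]
      unfold laneLim laneDir
      rw [if_neg (by omega), if_neg (by omega), if_neg (by omega), if_neg (by omega)]
      simp only [mul_zero, zero_smul, add_zero] at hε
      exact hε
  · rcases hn.eq_or_lt with rfl | hn'
    -- In the limit the last lane segment stops at `p`, before the node that it would share with the
    -- next segment of `va`.
    · refine M.eventually_disjoint_lane le_rfl ?_
      rw [Set.disjoint_left]
      intro q q1 q2
      obtain ⟨z, z1, z2, rfl⟩ := K.exists_common_of_mem M.adjA (M.A.seg_mem hi) (M.A.seg_mem hm)
        (M.A.seg_ne hi hm (by omega)) (M.limSeg_subset le_rfl q1) q2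
      rcases Sym2.mem_iff.1 z1 with rfl | rfl
      · rcases M.A.mem_seg (by omega) hm z2 with h | h <;> omega
      · exact M.right_notMem_limSeg q1
    · have hd := M.A.det n hm
      filter_upwards [eventually_disjoint_turn (da := M.A.d (M.A.x n)) (dc := 0) hd.1 hd.2 M.σ_ne]
        with ε hε
      rw [M.sseg_lane ε hn]
      unfold laneLim laneDir
      rw [if_neg (by omega), if_neg (by omega), if_neg (by omega), if_neg (by omega)]
      simp only [mul_zero, zero_smul, add_zero] at hε
      exact hε
  · have hd := M.A.det m (by omega)
    -- If the lane segment is the last one, its limit is shortened to end at `p`; this scales the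
    -- determinant by a positive factor.
    have hd2 : 0 < det2 (M.laneLim (m + 1 + 1) - K.P (M.A.x (m + 1))) (M.A.d (M.A.x (m + 1))) := by
      by_cases hk : m + 1 = M.i
      · have hlim : M.laneLim (m + 1 + 1) = M.p := if_pos (by omega)
        have hmem := M.memA
        have hne := M.p_ne_left
        rw [← hk] at hmem hne
        obtain ⟨t, h0, -, hx, hy⟩ := mem_segment_iff.1
          (show M.p ∈ segment ℝ (K.P (M.A.x (m + 1))) (K.P (M.A.x (m + 1 + 1))) from hmem)
        have ht : 0 < t := by
          refine lt_of_le_of_ne h0 ?_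
          rintro rfl
          exact hne (plane_ext (by linarith) (by linarith))
        have : det2 (M.p - K.P (M.A.x (m + 1))) (M.A.d (M.A.x (m + 1))) =
            t * det2 (K.P (M.A.x (m + 2)) - K.P (M.A.x (m + 1))) (M.A.d (M.A.x (m + 1))) := by
          simp only [det2, PiLp.sub_apply, hx, hy]
          ring
        rw [hlim, this]
        exact mul_pos ht hd.2
      · have hlim : M.laneLim (m + 1 + 1) = K.P (M.A.x (m + 1 + 1)) := if_neg (by omega)
        rw [hlim]
        exact hd.2
    filter_upwards [eventually_disjoint_turn (da := 0) (dc := M.laneDir (m + 1 + 1)) hd.1 hd2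
      M.σ_ne.symm] with ε hε
    rw [M.sseg_lane ε hn]
    have hdir : M.laneDir (m + 1) = M.A.d (M.A.x (m + 1)) := if_neg (by omega)
    have hlim : M.laneLim (m + 1) = K.P (M.A.x (m + 1)) := if_neg (by omega)
    rw [hdir, hlim]
    simp only [mul_zero, zero_smul, add_zero] at hε
    exact hε.symm

theorem pos_tailMap (ε : ℝ) {n : ℕ} (h1 : M.j < n) (h2 : n ≤ M.B.l) :
    M.pos ε (M.tailMap (M.B.x n)) = K.P (M.B.x n) := by
  have : M.B.x n ≠ M.B.x M.j := fun h => by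
    have := M.B.inj _ h2 _ (by omega) h
    omega
  rw [tailMap, if_neg this]
  rfl

theorem pos_tailMap_self (ε : ℝ) :
    M.pos ε (M.tailMap (M.B.x M.j)) = M.p + ε • (K.P (M.B.x (M.j + 1)) - M.p) := by
  rw [tailMap, if_pos rfl]
  rfl

/-- The rest of `vb` is a part of it beyond the crossing. -/
theorem tail_subset {ε : ℝ} (h0 : 0 < ε) (h1 : ε < 1) {m : ℕ} (hjm : M.j ≤ m) (hm : m < M.B.l) :
    sseg (M.pos ε) ((M.B.seg m).map M.tailMap) ⊆ sseg K.P (M.B.seg m) ∧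
      Disjoint (sseg (M.pos ε) ((M.B.seg m).map M.tailMap)) (M.B.pre M.j M.p) := by
  have hj := M.hj
  have hne1 := M.swap.p_ne_left
  have hne2 := M.swap.p_ne_right
  have hmem := M.memB
  rcases hjm.eq_or_lt with rfl | hjm
  · have hs : sseg (M.pos ε) ((M.B.seg M.j).map M.tailMap) =
        segment ℝ (M.p + ε • (K.P (M.B.x (M.j + 1)) - M.p)) (K.P (M.B.x (M.j + 1))) := by
      rw [LaneSeq.seg, Sym2.map_mk, sseg_mk, M.pos_tailMap ε (Nat.lt_succ_self _) hj,
        M.pos_tailMap_self]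
    rw [hs]
    obtain ⟨k1, k2⟩ := segment_tail hmem hne1 hne2 h0 h1
    refine ⟨k1, ?_⟩
    rw [Set.disjoint_left]
    rintro q q1 (⟨n, hn, q2⟩ | q2)
    · obtain ⟨z, z1, z2, rfl⟩ := K.exists_common_of_mem M.adjB (M.B.seg_mem hj)
        (M.B.seg_mem (n := n) (by omega)) (M.B.seg_ne hj (by omega) (by omega)) (k1 q1) q2
      rcases Sym2.mem_iff.1 z1 with rfl | rfl
      · exact Set.disjoint_left.1 k2 q1 (left_mem_segment _ _ _)
      · rcases M.B.mem_seg (by omega) (by omega) z2 with h | h <;> omega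
    · exact Set.disjoint_left.1 k2 q1 q2
  · have hs : sseg (M.pos ε) ((M.B.seg m).map M.tailMap) = sseg K.P (M.B.seg m) := by
      rw [LaneSeq.seg, Sym2.map_mk, sseg_mk, M.pos_tailMap ε hjm hm.le,
        M.pos_tailMap ε (by omega) hm, sseg_mk]
    rw [hs]
    refine ⟨subset_rfl, ?_⟩
    rw [Set.disjoint_left]
    rintro q q1 (⟨n, hn, q2⟩ | q2)
    · exact Set.disjoint_left.1 (K.simple _ M.adjB _ (M.B.seg_mem hm) _ (M.B.seg_mem (n := n) (by omega))
        (M.B.apart hm (by omega) (by omega) (by omega) (by omega))) q1 q2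
    · have q3 : q ∈ sseg K.P (M.B.seg M.j) :=
        (convex_segment _ _).segment_subset (left_mem_segment _ _ _) hmem q2
      obtain ⟨z, z1, z2, rfl⟩ := K.exists_common_of_mem M.adjB (M.B.seg_mem hj)
        (M.B.seg_mem hm) (M.B.seg_ne hj hm (by omega)) q3 q1
      rcases Sym2.mem_iff.1 z1 with rfl | rfl
      · rcases M.B.mem_seg (by omega) (by omega) z2 with h | h <;> omega
      · exact right_notMem_segment hmem hne1 hne2 q2

end Meeting
end CrossingNumber

/-! ### The rerouted drawing and its crossings -/

namespace CrossingNumber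
open Set Filter Topology

theorem Apart.of_map {N M : Type*} {f : N → M} {s t : Sym2 N} (h : Apart (s.map f) (t.map f)) :
    Apart s t :=
  fun n h1 h2 => h (f n) (Sym2.mem_map.2 ⟨n, h1, rfl⟩) (Sym2.mem_map.2 ⟨n, h2, rfl⟩)

namespace Meeting
variable {V N : Type*} {G : SimpleGraph V} {K : PolyDrawing G N} {v a b : V} (M : Meeting K v a b)

theorem laneMap_zero : M.laneMap (M.A.x 0) = Sum.inl (M.A.x 0) := if_pos rfl

theorem laneMap_last : M.laneMap (M.A.x (M.i + 1)) = Sum.inr none := by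
  have : M.A.x (M.i + 1) ≠ M.A.x 0 := fun h => by
    have := M.A.inj _ M.hi _ (Nat.zero_le _) h
    omega
  rw [laneMap, if_neg this, if_pos rfl]

theorem tailMap_first : M.tailMap (M.B.x M.j) = Sum.inr none := if_pos rfl

theorem eq_of_laneMap {n c : N} (h : M.laneMap n = Sum.inl c) : c = K.vert v := by
  unfold laneMap at h
  split_ifs at h with h1
  rw [← Sum.inl.inj h, h1, M.A.x_zero]

theorem eq_of_tailMap {n c : N} (h : M.tailMap n = Sum.inl c) : c = n := by
  unfold tailMap at h
  split_ifs at h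
  exact (Sum.inl.inj h).symm

theorem vert_mem_laneMap {n : ℕ} (h : K.vert v ∈ M.A.seg n) :
    (Sum.inl (K.vert v) : N ⊕ Option N) ∈ (M.A.seg n).map M.laneMap := by
  refine Sym2.mem_map.2 ⟨K.vert v, h, ?_⟩
  rw [← M.A.x_zero]
  exact M.laneMap_zero

/-- By `hfirst` the initial part of `va` meets `vb` only at `v` and `p`, and of these the rest of
`vb` contains at most `p`. The excluded pair of segments meets at the junction. -/
theorem eventually_disjoint_lane_tail
    (hfirst : ∀ q ∈ M.A.pre M.i M.p, q ∈ K.curve s(v, b) → q = K.P (K.vert v) ∨ q = M.p)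
    {n m : ℕ} (hn : n ≤ M.i) (hjm : M.j ≤ m) (hm : m < M.B.l) (h : ¬ (n = M.i ∧ m = M.j)) :
    ∀ᶠ ε in 𝓝[>] (0 : ℝ), Disjoint (sseg (M.pos ε) ((M.A.seg n).map M.laneMap))
        (sseg (M.pos ε) ((M.B.seg m).map M.tailMap)) := by
  have hi := M.hi
  have hj := M.hj
  rcases hjm.eq_or_lt with rfl | hjm
  · have hd : Disjoint (M.limSeg n) (segment ℝ M.p (K.P (M.B.x (M.j + 1)))) := by
      rw [Set.disjoint_left]
      intro q q1 q2
      have q3 : q ∈ sseg K.P (M.B.seg M.j) :=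
        (convex_segment _ _).segment_subset M.memB (right_mem_segment _ _ _) q2
      rcases hfirst q (M.limSeg_subset_pre hn q1) ⟨_, M.B.seg_mem hj, q3⟩ with rfl | rfl
      · have hv := K.gen.mem_of_mem_sseg (K.not_isDiag M.adjB (M.B.seg_mem hj)) q3
        have hj0 := M.B.first_of_mem hj hv
        refine left_notMem_segment M.memB M.swap.p_ne_left M.swap.p_ne_right ?_
        change K.P (M.B.x M.j) ∈ _
        rw [hj0, M.B.x_zero, ← hj0]
        exact q2
      · exact h ⟨M.segA_eq (by omega) (M.limSeg_subset hn q1), rfl⟩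
    have hs : ∀ ε, sseg (M.pos ε) ((M.B.seg M.j).map M.tailMap) =
        segment ℝ (M.p + ε • (K.P (M.B.x (M.j + 1)) - M.p)) (K.P (M.B.x (M.j + 1))) := by
      intro ε
      rw [LaneSeq.seg, Sym2.map_mk, sseg_mk, M.pos_tailMap ε (Nat.lt_succ_self _) hj,
        M.pos_tailMap_self]
    simp only [M.sseg_lane _ hn, hs]
    refine eventually_disjoint_segment (M.tendsto_lane _ _) (M.tendsto_lane _ _) ?_
      tendsto_const_nhds hd
    have : Continuous fun ε : ℝ => M.p + ε • (K.P (M.B.x (M.j + 1)) - M.p) := by fun_prop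
    have := this.tendsto 0
    simp only [zero_smul, add_zero] at this
    exact this.mono_left nhdsWithin_le_nhds
  · have hs : ∀ ε, sseg (M.pos ε) ((M.B.seg m).map M.tailMap) = sseg K.P (M.B.seg m) := by
      intro ε
      rw [LaneSeq.seg, Sym2.map_mk, sseg_mk, M.pos_tailMap ε hjm hm.le,
        M.pos_tailMap ε (by omega) hm, sseg_mk]
    simp only [hs]
    refine M.eventually_disjoint_lane hn ?_
    rw [Set.disjoint_left]
    intro q q1 q2
    rcases hfirst q (M.limSeg_subset_pre hn q1) ⟨_, M.B.seg_mem hm, q2⟩ with rfl | rfl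
    · have hv := K.gen.mem_of_mem_sseg (K.not_isDiag M.adjB (M.B.seg_mem hm)) q2
      have := M.B.first_of_mem hm hv
      omega
    · have := M.swap.segA_eq hm q2
      simp only [swap] at this
      omega

/-- A lane segment can meet another edge only if the part of `va` along which it runs does, so the
intersection is charged to that part. A common node with the original segment would be `v`, which
the lane retains, or `a`, which lies beyond `p`. -/
theorem eventually_disjoint_lane_other {n : ℕ} (hn : n ≤ M.i) {g : Sym2 V} (hg : g ∈ G.edgeSet)
    (hga : g ≠ s(v, a)) {t : Sym2 N} (ht : t ∈ K.S g)
    (h : Apart ((M.A.seg n).map M.laneMap) (t.map Sum.inl)) :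
    ∀ᶠ ε in 𝓝[>] (0 : ℝ),
      Disjoint (sseg (M.pos ε) ((M.A.seg n).map M.laneMap)) (sseg K.P t) ∨
        (M.A.seg n, t) ∈ K.pairsIn s(v, a) g (M.A.pre M.i M.p) := by
  have hi := M.hi
  by_cases hd : Disjoint (M.limSeg n) (sseg K.P t)
  · filter_upwards [M.eventually_disjoint_lane hn hd] with ε hε using Or.inl hε
  refine Eventually.of_forall fun ε => Or.inr ?_
  obtain ⟨q, q1, q2⟩ := Set.not_disjoint_iff.1 hd
  have q3 := M.limSeg_subset hn q1
  have hmem := M.A.seg_mem (n := n) (by omega)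
  refine ⟨⟨hmem, ht, ?_, Set.not_disjoint_iff.2 ⟨q, q3, q2⟩⟩, q,
    M.limSeg_subset_pre hn q1, q3, q2⟩
  intro c c1 c2
  obtain ⟨w, w1, w2, rfl⟩ := K.common _ M.adjA g hg hga.symm _ hmem t ht c c1 c2
  rcases Sym2.mem_iff.1 w1 with rfl | rfl
  · exact h _ (M.vert_mem_laneMap c1) (Sym2.mem_map.2 ⟨_, c2, rfl⟩)
  · have hl := M.A.last_of_mem (by omega) c1
    obtain rfl : n = M.i := by omega
    have hq := K.gen.eq_of_mem_of_mem (K.not_isDiag M.adjA hmem) (K.not_isDiag hg ht)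
      (K.ne_of_ne M.adjA hg hga.symm hmem ht) c1 c2 q3 q2
    apply M.right_notMem_limSeg
    rw [hl, M.A.x_l, ← hq]
    exact q1

/-- The conditions on the distance of the lane that make the rerouted drawing work. -/
structure Good (ε : ℝ) : Prop where
  pos : 0 < ε
  lt_one : ε < 1
  lane_lane : ∀ n ≤ M.i, ∀ m ≤ M.i, Apart (M.A.seg n) (M.A.seg m) →
    Disjoint (sseg (M.pos ε) ((M.A.seg n).map M.laneMap))
      (sseg (M.pos ε) ((M.A.seg m).map M.laneMap))
  lane_tail : ∀ n ≤ M.i, ∀ m < M.B.l, M.j ≤ m → ¬ (n = M.i ∧ m = M.j) →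
    Disjoint (sseg (M.pos ε) ((M.A.seg n).map M.laneMap))
      (sseg (M.pos ε) ((M.B.seg m).map M.tailMap))
  lane_edge : ∀ n ≤ M.i, ∀ m < M.A.l, ¬ (n = 0 ∧ m = 0) →
    Disjoint (sseg (M.pos ε) ((M.A.seg n).map M.laneMap)) (sseg K.P (M.A.seg m))
  lane_other : ∀ n ≤ M.i, ∀ g : Sym2 V, ∀ t : Sym2 N, g ∈ G.edgeSet → g ≠ s(v, a) → t ∈ K.S g →
    Apart ((M.A.seg n).map M.laneMap) (t.map Sum.inl) →
      Disjoint (sseg (M.pos ε) ((M.A.seg n).map M.laneMap)) (sseg K.P t) ∨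
        (M.A.seg n, t) ∈ K.pairsIn s(v, a) g (M.A.pre M.i M.p)

theorem exists_good [Finite V] [Finite N]
    (hfirst : ∀ q ∈ M.A.pre M.i M.p, q ∈ K.curve s(v, b) → q = K.P (K.vert v) ∨ q = M.p) :
    ∃ ε, M.Good ε := by
  have hnat : ∀ (k : ℕ) (P : ℕ → ℝ → Prop), (∀ n < k, ∀ᶠ ε in 𝓝[>] (0 : ℝ), P n ε) →
      ∀ᶠ ε in 𝓝[>] (0 : ℝ), ∀ n < k, P n ε := by
    intro k P h
    have := (Filter.eventually_all_finset (Finset.range k)).2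
      (fun n hn => h n (Finset.mem_range.1 hn))
    filter_upwards [this] with ε hε n hn using hε n (Finset.mem_range.2 hn)
  have := Fintype.ofFinite V
  have := Fintype.ofFinite N
  have e1 : ∀ᶠ ε in 𝓝[>] (0 : ℝ), 0 < ε := self_mem_nhdsWithin
  have e2 : ∀ᶠ ε in 𝓝[>] (0 : ℝ), ε < 1 :=
    mem_nhdsWithin_of_mem_nhds (Iio_mem_nhds one_pos)
  have e3 := hnat (M.i + 1) _ fun n hn => hnat (M.i + 1) (fun m ε =>
    Apart (M.A.seg n) (M.A.seg m) → Disjoint (sseg (M.pos ε) ((M.A.seg n).map M.laneMap))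
      (sseg (M.pos ε) ((M.A.seg m).map M.laneMap))) fun m hm => by
    simp only [eventually_all]
    exact fun h => M.eventually_disjoint_lane_lane (by omega) (by omega) h
  have e4 := hnat (M.i + 1) _ fun n hn => hnat M.B.l (fun m ε =>
    M.j ≤ m → ¬ (n = M.i ∧ m = M.j) → Disjoint (sseg (M.pos ε) ((M.A.seg n).map M.laneMap))
      (sseg (M.pos ε) ((M.B.seg m).map M.tailMap))) fun m hm => by
    simp only [eventually_all]
    exact fun h1 h2 => M.eventually_disjoint_lane_tail hfirst (by omega) h1 hm h2
  have e5 := hnat (M.i + 1) _ fun n hn => hnat M.A.l (fun m ε =>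
    ¬ (n = 0 ∧ m = 0) → Disjoint (sseg (M.pos ε) ((M.A.seg n).map M.laneMap))
      (sseg K.P (M.A.seg m))) fun m hm => by
    simp only [eventually_all]
    exact fun h => M.eventually_disjoint_lane_edge (by omega) hm h
  have e6 := hnat (M.i + 1) (fun n ε => ∀ g : Sym2 V, ∀ t : Sym2 N, g ∈ G.edgeSet →
      g ≠ s(v, a) → t ∈ K.S g → Apart ((M.A.seg n).map M.laneMap) (t.map Sum.inl) →
      Disjoint (sseg (M.pos ε) ((M.A.seg n).map M.laneMap)) (sseg K.P t) ∨
        (M.A.seg n, t) ∈ K.pairsIn s(v, a) g (M.A.pre M.i M.p)) fun n hn => by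
    simp only [eventually_all]
    exact fun g t hg hga ht h => M.eventually_disjoint_lane_other (by omega) hg hga ht h
  obtain ⟨ε, h1, h2, h3, h4, h5, h6⟩ :=
    (e1.and (e2.and (e3.and (e4.and (e5.and e6))))).exists
  exact ⟨ε, h1, h2, fun n hn m hm => h3 n (by omega) m (by omega),
    fun n hn m hm => h4 n (by omega) m hm, fun n hn m hm => h5 n (by omega) m hm,
    fun n hn => h6 n (by omega)⟩

/-- The segments after rerouting. -/
def segs (g : Sym2 V) : Set (Sym2 (N ⊕ Option N)) :=
  {s | (g = s(v, b) ∧ ((∃ n ≤ M.i, s = (M.A.seg n).map M.laneMap) ∨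
    ∃ m < M.B.l, M.j ≤ m ∧ s = (M.B.seg m).map M.tailMap)) ∨
    (g ≠ s(v, b) ∧ ∃ t ∈ K.S g, s = t.map Sum.inl)}

theorem mem_of_inl_mem_segs {g : Sym2 V} {s : Sym2 (N ⊕ Option N)}
    (hs : s ∈ M.segs g) {c : N} (hc : Sum.inl c ∈ s) :
    (∃ t ∈ K.S g, c ∈ t) ∨ (g = s(v, b) ∧ c = K.vert v) := by
  rcases hs with ⟨rfl, ⟨n, hn, rfl⟩ | ⟨m, hm, hjm, rfl⟩⟩ | ⟨hg, t, ht, rfl⟩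
  · obtain ⟨z, z1, z2⟩ := Sym2.mem_map.1 hc
    exact Or.inr ⟨rfl, M.eq_of_laneMap z2⟩
  · obtain ⟨z, z1, z2⟩ := Sym2.mem_map.1 hc
    exact Or.inl ⟨_, M.B.seg_mem hm, M.eq_of_tailMap z2 ▸ z1⟩
  · obtain ⟨z, z1, z2⟩ := Sym2.mem_map.1 hc
    exact Or.inl ⟨t, ht, Sum.inl.inj z2 ▸ z1⟩

theorem eq_of_inr_mem_segs {g : Sym2 V} {s : Sym2 (N ⊕ Option N)}
    (hs : s ∈ M.segs g) {c : Option N} (hc : Sum.inr c ∈ s) : g = s(v, b) := by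
  rcases hs with ⟨rfl, _⟩ | ⟨hg, t, ht, rfl⟩
  · rfl
  · obtain ⟨z, z1, z2⟩ := Sym2.mem_map.1 hc
    simp at z2

theorem segs_reach : Relation.ReflTransGen (fun c d => s(c, d) ∈ M.segs s(v, b))
    (Sum.inl (K.vert v)) (Sum.inl (K.vert b)) := by
  have hi := M.hi
  have hj := M.hj
  have key : ∀ n ≤ M.i + 1, Relation.ReflTransGen (fun c d => s(c, d) ∈ M.segs s(v, b))
      (Sum.inl (K.vert v)) (M.laneMap (M.A.x n)) := by
    intro n
    induction n with
    | zero =>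
      intro _
      rw [M.laneMap_zero, M.A.x_zero]
    | succ n ih =>
      exact fun hn => (ih (by omega)).tail (Or.inl ⟨rfl, Or.inl ⟨n, by omega, rfl⟩⟩)
  have key2 : ∀ m, M.j + m ≤ M.B.l → Relation.ReflTransGen
      (fun c d => s(c, d) ∈ M.segs s(v, b)) (Sum.inl (K.vert v)) (M.tailMap (M.B.x (M.j + m))) := by
    intro m
    induction m with
    | zero =>
      intro _
      have := key _ le_rfl
      rwa [M.laneMap_last, ← M.tailMap_first] at this
    | succ m ih =>
      exact fun hm => (ih (by omega)).tail
        (Or.inl ⟨rfl, Or.inr ⟨M.j + m, by omega, by omega, rfl⟩⟩)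
  have := key2 (M.B.l - M.j) (by omega)
  rw [show M.j + (M.B.l - M.j) = M.B.l by omega] at this
  have hne : M.B.x M.B.l ≠ M.B.x M.j := fun h => by
    have := M.B.inj _ le_rfl _ (by omega) h
    omega
  rwa [tailMap, if_neg hne, M.B.x_l] at this

/-- The drawing after rerouting `vb` along `va`. -/
noncomputable def reroute {ε : ℝ} (hε : M.Good ε) : PreDrawing G (N ⊕ Option N) where
  vert w := Sum.inl (K.vert w)
  P := M.pos ε
  S := M.segs
  vert_inj _ _ h := K.vert_inj (Sum.inl.inj h)
  reach u w huw := by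
    by_cases h : s(u, w) = s(v, b)
    · rw [h]
      rcases Sym2.eq_iff.1 h with ⟨rfl, rfl⟩ | ⟨rfl, rfl⟩
      · exact M.segs_reach
      · have : Std.Symm fun c d => s(c, d) ∈ M.segs s(w, u) :=
          ⟨fun c d hcd => (Sym2.eq_swap (a := d) (b := c)) ▸ hcd⟩
        exact Relation.ReflTransGen.stdSymm.symm _ _ M.segs_reach
    · have key : ∀ c c', Relation.ReflTransGen (fun c d => s(c, d) ∈ K.S s(u, w)) c c' →
          Relation.ReflTransGen (fun c d => s(c, d) ∈ M.segs s(u, w)) (Sum.inl c) (Sum.inl c') := by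
        intro c c' hc
        induction hc with
        | refl => exact .refl
        | tail _ h' ih => exact .tail ih (Or.inr ⟨h, _, h', Sym2.map_mk ..⟩)
      exact key _ _ (K.reach u w huw)
  common e he f hf hef s hs t ht n hn hn' := by
    rcases n with c | c
    · rcases M.mem_of_inl_mem_segs hs hn with ⟨s', hs', hc⟩ | ⟨rfl, rfl⟩ <;>
        rcases M.mem_of_inl_mem_segs ht hn' with ⟨t', ht', hc'⟩ | ⟨rfl, hc'⟩
      · obtain ⟨w, w1, w2, rfl⟩ := K.common e he f hf hef s' hs' t' ht' c hc hc'
        exact ⟨w, w1, w2, rfl⟩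
      · subst hc'
        exact ⟨v, K.vert_mem e he s' hs' v hc, Sym2.mem_mk_left _ _, rfl⟩
      · exact ⟨v, Sym2.mem_mk_left _ _, K.vert_mem f hf t' ht' v hc', rfl⟩
      · exact (hef rfl).elim
    · exact (hef ((M.eq_of_inr_mem_segs hs hn).trans (M.eq_of_inr_mem_segs ht hn').symm)).elim
  vert_mem e he s hs w hw := by
    rcases M.mem_of_inl_mem_segs hs hw with ⟨s', hs', hc⟩ | ⟨rfl, hc⟩
    · exact K.vert_mem e he s' hs' w hc
    · rw [K.vert_inj hc]
      exact Sym2.mem_mk_left _ _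
  simple := by
    have lt : ∀ n ≤ M.i, ∀ m < M.B.l, M.j ≤ m →
        Apart ((M.A.seg n).map M.laneMap) ((M.B.seg m).map M.tailMap) →
        Disjoint (sseg (M.pos ε) ((M.A.seg n).map M.laneMap))
          (sseg (M.pos ε) ((M.B.seg m).map M.tailMap)) := by
      intro n hn m hm hjm h
      refine hε.lane_tail n hn m hm hjm ?_
      rintro ⟨rfl, rfl⟩
      exact h (Sum.inr none)
        (Sym2.mem_map.2 ⟨M.A.x (M.i + 1), Sym2.mem_mk_right _ _, M.laneMap_last⟩)
        (Sym2.mem_map.2 ⟨M.B.x M.j, Sym2.mem_mk_left _ _, M.tailMap_first⟩)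
    rintro e he s (⟨rfl, hs⟩ | ⟨hne, s', hs', rfl⟩) t (⟨h, ht⟩ | ⟨hne', t', ht', rfl⟩) hst
    · rcases hs with ⟨n, hn, rfl⟩ | ⟨n, hn, hjn, rfl⟩ <;>
        rcases ht with ⟨m, hm, rfl⟩ | ⟨m, hm, hjm, rfl⟩
      · exact hε.lane_lane n hn m hm hst.of_map
      · exact lt n hn m hm hjm hst
      · exact (lt m hm n hn hjn hst.symm).symm
      · exact (K.simple _ M.adjB _ (M.B.seg_mem hn) _ (M.B.seg_mem hm) hst.of_map).mono
          (M.tail_subset hε.pos hε.lt_one hjn hn).1 (M.tail_subset hε.pos hε.lt_one hjm hm).1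
    · exact (hne' rfl).elim
    · exact (hne h).elim
    · rw [sseg_map, sseg_map]
      exact K.simple e he s' hs' t' ht' hst.of_map

/-- The tail lies on `vb` and avoids its initial part, so its crossings are old crossings not
counted on the initial part; apart segments meet only once, so membership in `pairsIn` is decided by
this one point. -/
theorem tail_pair {ε : ℝ} (hε : M.Good ε) {m : ℕ} (hjm : M.j ≤ m) (hm : m < M.B.l) {g : Sym2 V}
    (hg : g ∈ G.edgeSet) (hgb : g ≠ s(v, b)) {t : Sym2 N} (ht : t ∈ K.S g)
    (h : Apart ((M.B.seg m).map M.tailMap) (t.map Sum.inl))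
    (hd : ¬ Disjoint (sseg (M.pos ε) ((M.B.seg m).map M.tailMap)) (sseg K.P t)) :
    (M.B.seg m, t) ∈ K.pairs s(v, b) g \ K.pairsIn s(v, b) g (M.B.pre M.j M.p) := by
  have hj := M.hj
  obtain ⟨q, q1, q2⟩ := Set.not_disjoint_iff.1 hd
  obtain ⟨h1, h2⟩ := M.tail_subset hε.pos hε.lt_one hjm hm
  have hmem := M.B.seg_mem hm
  have hq := Set.disjoint_left.1 h2 q1
  have hap : Apart (M.B.seg m) t := by
    intro c c1 c2
    obtain ⟨w, w1, w2, rfl⟩ := K.common _ M.adjB g hg hgb.symm _ hmem t ht c c1 c2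
    rcases Sym2.mem_iff.1 w1 with rfl | rfl
    · apply hq
      rw [K.gen.eq_of_mem_of_mem (K.not_isDiag M.adjB hmem) (K.not_isDiag hg ht)
        (K.ne_of_ne M.adjB hg hgb.symm hmem ht) c1 c2 (h1 q1) q2]
      exact M.B.vert_mem_pre _ _
    · refine h (Sum.inl (K.vert w)) (Sym2.mem_map.2 ⟨_, c1, ?_⟩) (Sym2.mem_map.2 ⟨_, c2, rfl⟩)
      rw [← M.B.x_l]
      refine if_neg fun h => ?_
      have := M.B.inj _ le_rfl _ (by omega) h
      omega
  refine ⟨⟨hmem, ht, hap, Set.not_disjoint_iff.2 ⟨q, h1 q1, q2⟩⟩, ?_⟩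
  rintro ⟨-, q', k1, k2, k3⟩
  exact hq (K.gen.inter_unique (K.not_isDiag M.adjB hmem) (K.not_isDiag hg ht) hap (h1 q1) q2
    k2 k3 ▸ k1)

variable [Finite N]

theorem ncard_reroute_other {ε : ℝ} (hε : M.Good ε) {g h : Sym2 V} (hg : g ≠ s(v, b))
    (hh : h ≠ s(v, b)) : ((M.reroute hε).pairs g h).ncard ≤ (K.pairs g h).ncard := by
  refine (ncard_le_ncard (t := Prod.map (Sym2.map Sum.inl) (Sym2.map Sum.inl) '' K.pairs g h) ?_
    (toFinite _)).trans (ncard_image_le (toFinite _))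
  rintro ⟨s, t⟩ ⟨hs, ht, hst, hd⟩
  rcases hs with ⟨h1, -⟩ | ⟨-, s', hs', rfl⟩
  · exact (hg h1).elim
  rcases ht with ⟨h1, -⟩ | ⟨-, t', ht', rfl⟩
  · exact (hh h1).elim
  refine ⟨(s', t'), ⟨hs', ht', hst.of_map, ?_⟩, rfl⟩
  change ¬ Disjoint (sseg (M.pos ε) _) (sseg (M.pos ε) _) at hd
  rw [sseg_map, sseg_map] at hd
  exact hd

/-- The exchange: crossings of `g` with the initial part of `vb` are replaced by those with the
initial part of `va`. -/
theorem ncard_reroute {ε : ℝ} (hε : M.Good ε) {g : Sym2 V} (hg : g ∈ G.edgeSet)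
    (hga : g ≠ s(v, a)) (hgb : g ≠ s(v, b)) : ((M.reroute hε).pairs s(v, b) g).ncard ≤
      (K.pairsIn s(v, a) g (M.A.pre M.i M.p)).ncard +
        (K.pairs s(v, b) g \ K.pairsIn s(v, b) g (M.B.pre M.j M.p)).ncard := by
  refine (ncard_le_ncard (t := Prod.map (Sym2.map M.laneMap) (Sym2.map Sum.inl) ''
      K.pairsIn s(v, a) g (M.A.pre M.i M.p) ∪ Prod.map (Sym2.map M.tailMap) (Sym2.map Sum.inl) ''
      (K.pairs s(v, b) g \ K.pairsIn s(v, b) g (M.B.pre M.j M.p))) ?_ (toFinite _)).trans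
    ((ncard_union_le _ _).trans (Nat.add_le_add (ncard_image_le (toFinite _))
      (ncard_image_le (toFinite _))))
  rintro ⟨s, t⟩ ⟨hs, ht, hst, hd⟩
  rcases ht with ⟨h1, -⟩ | ⟨-, t', ht', rfl⟩
  · exact (hgb h1).elim
  change ¬ Disjoint (sseg (M.pos ε) _) (sseg (M.pos ε) _) at hd
  dsimp only at hst hd
  rw [sseg_map _ Sum.inl] at hd
  rcases hs with ⟨-, ⟨n, hn, rfl⟩ | ⟨m, hm, hjm, rfl⟩⟩ | ⟨h1, -⟩
  · exact Or.inl ⟨(M.A.seg n, t'),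
      (hε.lane_other n hn g t' hg hga ht' hst).resolve_left hd, rfl⟩
  · exact Or.inr ⟨(M.B.seg m, t'), M.tail_pair hε hjm hm hg hgb ht' hst hd, rfl⟩
  · exact (h1 rfl).elim

/-- The lane contributes nothing against `va`, and the crossing `p` itself disappears. -/
theorem ncard_reroute_self {ε : ℝ} (hε : M.Good ε) :
    ((M.reroute hε).pairs s(v, b) s(v, a)).ncard + 1 ≤ (K.pairs s(v, b) s(v, a)).ncard := by
  have hgb : s(v, a) ≠ s(v, b) := M.edge_ne
  have hle : ((M.reroute hε).pairs s(v, b) s(v, a)).ncard ≤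
      (K.pairs s(v, b) s(v, a) \ K.pairsIn s(v, b) s(v, a) (M.B.pre M.j M.p)).ncard := by
    refine (ncard_le_ncard (t := Prod.map (Sym2.map M.tailMap) (Sym2.map Sum.inl) ''
        (K.pairs s(v, b) s(v, a) \ K.pairsIn s(v, b) s(v, a) (M.B.pre M.j M.p))) ?_
      (toFinite _)).trans (ncard_image_le (toFinite _))
    rintro ⟨s, t⟩ ⟨hs, ht, hst, hd⟩
    rcases ht with ⟨h1, -⟩ | ⟨-, t', ht', rfl⟩
    · exact (hgb h1).elim
    change ¬ Disjoint (sseg (M.pos ε) _) (sseg (M.pos ε) _) at hd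
    dsimp only at hst hd
    rw [sseg_map _ Sum.inl] at hd
    rcases hs with ⟨-, ⟨n, hn, rfl⟩ | ⟨m, hm, hjm, rfl⟩⟩ | ⟨h1, -⟩
    · obtain ⟨m, hm, rfl⟩ := (M.A.mem_iff t').1 ht'
      refine (hd (hε.lane_edge n hn m hm ?_)).elim
      rintro ⟨rfl, rfl⟩
      have hv : K.vert v ∈ M.A.seg 0 := by rw [← M.A.x_zero]; exact Sym2.mem_mk_left _ _
      exact hst _ (M.vert_mem_laneMap hv) (Sym2.mem_map.2 ⟨_, hv, rfl⟩)
    · exact ⟨(M.B.seg m, t'), M.tail_pair hε hjm hm M.adjA hgb ht' hst hd, rfl⟩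
    · exact (h1 rfl).elim
  have hlt : (K.pairs s(v, b) s(v, a) \ K.pairsIn s(v, b) s(v, a) (M.B.pre M.j M.p)).ncard <
      (K.pairs s(v, b) s(v, a)).ncard := by
    refine ncard_lt_ncard ?_ (toFinite _)
    refine ⟨sdiff_subset, fun hsub => ?_⟩
    have hp : (M.B.seg M.j, M.A.seg M.i) ∈ K.pairs s(v, b) s(v, a) :=
      ⟨M.B.seg_mem M.hj, M.A.seg_mem M.hi, M.apart.symm,
        Set.not_disjoint_iff.2 ⟨M.p, M.memB, M.memA⟩⟩
    exact (hsub hp).2 ⟨hp, M.p, M.B.mem_pre_self _ _, M.memB, M.memA⟩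
  omega

end Meeting
end CrossingNumber

namespace CrossingNumber
open Set Filter Topology

/-! ### The first crossing of two adjacent edges -/

theorem mem_segment_of_dist_le {a b p q : Plane} (hp : p ∈ segment ℝ a b)
    (hq : q ∈ segment ℝ a b) (h : dist p a ≤ dist q a) : p ∈ segment ℝ a q := by
  rw [segment_eq_image'] at hp hq
  obtain ⟨t, ht, rfl⟩ := hp
  obtain ⟨r, hr, rfl⟩ := hq
  rcases eq_or_ne a b with rfl | hab
  · simp
  have hd : 0 < ‖b - a‖ := norm_pos_iff.2 (sub_ne_zero.2 hab.symm)
  simp only [dist_self_add_left, norm_smul, Real.norm_eq_abs, abs_of_nonneg ht.1,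
    abs_of_nonneg hr.1] at h
  have htr : t ≤ r := le_of_mul_le_mul_right h hd
  rw [segment_eq_image']
  refine ⟨t / r, ⟨div_nonneg ht.1 hr.1, div_le_one_of_le₀ htr hr.1⟩, ?_⟩
  dsimp only
  rw [add_sub_cancel_left, smul_smul]
  rcases hr.1.eq_or_lt with rfl | h0
  · rw [le_antisymm htr ht.1]
    simp
  · rw [div_mul_cancel₀ _ h0.ne']

theorem eq_of_mem_segment_of_dist_le {a p q : Plane} (hq : q ∈ segment ℝ a p)
    (h : dist p a ≤ dist q a) : q = p := by
  have h1 := mem_segment_of_dist_le (right_mem_segment ℝ a p) hq h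
  have h2 := dist_add_dist_of_mem_segment h1
  have h3 := dist_add_dist_of_mem_segment hq
  have h4 : dist p q = 0 := by
    rw [dist_comm q p] at h3
    linarith [dist_nonneg (x := p) (y := q)]
  exact (dist_eq_zero.1 h4).symm

section
variable {V N : Type*} {G : SimpleGraph V} {K : PolyDrawing G N} {v a b : V}

/-- The segments `i` of `va` and `j` of `vb` cross at `p`. -/
def LaneSeq.Cross (A : LaneSeq K v a) (B : LaneSeq K v b) (i j : ℕ) (p : Plane) : Prop :=
  i < A.l ∧ j < B.l ∧ p ∈ sseg K.P (A.seg i) ∧ p ∈ sseg K.P (B.seg j) ∧ Apart (A.seg i) (B.seg j)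

theorem LaneSeq.Cross.symm {A : LaneSeq K v a} {B : LaneSeq K v b} {i j : ℕ} {p : Plane}
    (h : A.Cross B i j p) : B.Cross A j i p :=
  ⟨h.2.1, h.1, h.2.2.2.1, h.2.2.1, h.2.2.2.2.symm⟩

/-- The meeting at a crossing. -/
def LaneSeq.Cross.meeting {A : LaneSeq K v a} {B : LaneSeq K v b} {i j : ℕ} {p : Plane}
    (h : A.Cross B i j p) (ha : G.Adj v a) (hb : G.Adj v b) (hab : a ≠ b) : Meeting K v a b :=
  ⟨ha, hb, hab, A, B, i, j, p, h.1, h.2.1, h.2.2.1, h.2.2.2.1, h.2.2.2.2⟩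

theorem LaneSeq.Cross.pre_subset {A : LaneSeq K v a} {B : LaneSeq K v b} {i j i' j' : ℕ}
    {p p' : Plane} (h : A.Cross B i j p) (h' : A.Cross B i' j' p') (hi : i ≤ i')
    (hp : i = i' → dist p (K.P (A.x i)) ≤ dist p' (K.P (A.x i))) :
    A.pre i p ⊆ A.pre i' p' := by
  rintro q (⟨n, hn, hq⟩ | hq)
  · exact Or.inl ⟨n, hn.trans_le hi, hq⟩
  · rcases hi.eq_or_lt with rfl | hi
    · exact Or.inr ((convex_segment _ _).segment_subset (left_mem_segment _ _ _)
        (mem_segment_of_dist_le h.2.2.1 h'.2.2.1 (hp rfl)) hq)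
    · exact Or.inl ⟨i, hi, (convex_segment _ _).segment_subset (left_mem_segment _ _ _)
        h.2.2.1 hq⟩

/-- Take the least index `i` of a segment of `va` with a crossing and, on it, the crossing nearest
to its initial node. Other common points up to there lie at common nodes, hence at `v`. -/
theorem LaneSeq.exists_first_cross (A : LaneSeq K v a) (B : LaneSeq K v b) (ha : G.Adj v a)
    (hb : G.Adj v b) (hab : a ≠ b) (hne : ∃ i j p, A.Cross B i j p) :
    ∃ i j p, A.Cross B i j p ∧ (∀ i' j' p', A.Cross B i' j' p' → A.pre i p ⊆ A.pre i' p') ∧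
      ∀ q ∈ A.pre i p, q ∈ K.curve s(v, b) → q = K.P (K.vert v) ∨ q = p := by
  classical
  have hi := Nat.find_spec hne
  have hmin : ∀ i' j' p', A.Cross B i' j' p' → Nat.find hne ≤ i' := fun i' j' p' h =>
    Nat.find_min' hne ⟨j', p', h⟩
  generalize Nat.find hne = i at hi hmin
  let T : Set (ℕ × Plane) := {z | A.Cross B i z.1 z.2}
  have huniq : ∀ {j p p'}, A.Cross B i j p → A.Cross B i j p' → p = p' := fun h h' =>
    K.gen.inter_unique (K.not_isDiag ha (A.seg_mem h.1)) (K.not_isDiag hb (B.seg_mem h.2.1))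
      h.2.2.2.2 h.2.2.1 h.2.2.2.1 h'.2.2.1 h'.2.2.2.1
  have hT : T.Finite := by
    refine Set.Finite.of_finite_image (f := Prod.fst) ((finite_Iio B.l).subset ?_) ?_
    · rintro _ ⟨z, hz, rfl⟩
      exact hz.2.1
    · rintro ⟨j, p⟩ hz ⟨j', p'⟩ hz' rfl
      exact Prod.ext rfl (huniq hz hz')
  obtain ⟨j₀, p₀, h₀⟩ := hi
  obtain ⟨⟨j, p⟩, hc, hd⟩ := exists_min_image T (fun z => dist z.2 (K.P (A.x i))) hT ⟨(j₀, p₀), h₀⟩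
  have hc : A.Cross B i j p := hc
  refine ⟨i, j, p, hc, fun i' j' p' h => hc.pre_subset h (hmin _ _ _ h) ?_, ?_⟩
  · rintro rfl
    exact hd (j', p') h
  rintro q hq ⟨t, ht, q2⟩
  obtain ⟨m, hm, rfl⟩ := (B.mem_iff t).1 ht
  have hq' : ∃ n ≤ i, q ∈ sseg K.P (A.seg n) ∧ (n = i → q ∈ segment ℝ (K.P (A.x i)) p) := by
    rcases hq with ⟨n, hn, hq⟩ | hq
    · exact ⟨n, hn.le, hq, fun h => absurd h hn.ne⟩
    · exact ⟨i, le_rfl, (convex_segment _ _).segment_subset (left_mem_segment _ _ _)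
        hc.2.2.1 hq, fun _ => hq⟩
  obtain ⟨n, hn, q1, q3⟩ := hq'
  have hnl : n < A.l := hn.trans_lt hc.1
  by_cases hap : Apart (A.seg n) (B.seg m)
  · have hx : A.Cross B n m q := ⟨hnl, hm, q1, q2, hap⟩
    obtain rfl := hn.antisymm (hmin _ _ _ hx)
    exact Or.inr (eq_of_mem_segment_of_dist_le (q3 rfl) (hd (m, q) hx))
  · have hM := hc.meeting ha hb hab
    simp only [Apart, not_forall, not_not] at hap
    obtain ⟨c, c1, c2⟩ := hap
    obtain ⟨w, w1, w2, rfl⟩ := K.common _ ha _ hb hM.edge_ne _ (A.seg_mem hnl) _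
      (B.seg_mem hm) c c1 c2
    obtain rfl := hM.eq_of_mem_both w1 w2
    exact Or.inl (K.gen.eq_of_mem_of_mem (K.not_isDiag ha (A.seg_mem hnl))
      (K.not_isDiag hb (B.seg_mem hm)) (K.ne_of_ne ha hb hM.edge_ne (A.seg_mem hnl)
      (B.seg_mem hm)) c1 c2 q1 q2)

end

/-! ### Weighted numbers of crossing segments -/

/-- Only the terms containing `f` can be positive, and by symmetry each occurs twice. -/
theorem sum_erase_le_of_le {α : Type*} [DecidableEq α] {E : Finset α} {f : α} (hf : f ∈ E)
    {d : α → α → ℝ} (hs : ∀ x y, d x y = d y x)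
    (h : ∀ x ∈ E, ∀ y ∈ E, x ≠ f → y ≠ f → d x y ≤ 0) :
    ∑ x ∈ E, ∑ y ∈ E.erase x, d x y ≤ 2 * ∑ y ∈ E.erase f, d f y := by
  rw [← Finset.add_sum_erase E _ hf, two_mul]
  gcongr with x hx
  obtain ⟨hxf, hx⟩ := Finset.mem_erase.1 hx
  rw [← Finset.add_sum_erase (E.erase x) _ (Finset.mem_erase.2 ⟨hxf.symm, hf⟩), hs x f]
  refine add_le_of_nonpos_right (Finset.sum_nonpos fun y hy => ?_)
  simp only [Finset.mem_erase] at hy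
  exact h x hx y hy.2.2 hxf hy.1

open Classical in
/-- The weighted number of pairs of crossing segments. -/
noncomputable def PreDrawing.cost {V N : Type*} [Fintype V] {G : SimpleGraph V}
    (K : PreDrawing G N) (w : Sym2 V → ℝ) : ℝ :=
  (∑ e ∈ G.edgeFinset, ∑ f ∈ G.edgeFinset.erase e, w e * w f * ((K.pairs e f).ncard : ℝ)) / 2

theorem PreDrawing.cost_eq {V N : Type*} [Fintype V] {G : SimpleGraph V} [DecidableEq (Sym2 V)]
    [Fintype G.edgeSet] (K : PreDrawing G N) (w : Sym2 V → ℝ) : K.cost w =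
      (∑ e ∈ G.edgeFinset, ∑ f ∈ G.edgeFinset.erase e,
        w e * w f * ((K.pairs e f).ncard : ℝ)) / 2 := by
  unfold PreDrawing.cost
  congr!

theorem PreDrawing.ncard_pairs_comm {V N : Type*} {G : SimpleGraph V} (K : PreDrawing G N)
    (e f : Sym2 V) : (K.pairs e f).ncard = (K.pairs f e).ncard := by
  rw [← ncard_image_of_injective _ (Prod.swap_injective)]
  congr 1
  ext ⟨s, t⟩
  constructor
  · rintro ⟨⟨t, s⟩, ⟨h1, h2, h3, h4⟩, h⟩
    cases h
    exact ⟨h2, h1, h3.symm, fun h => h4 h.symm⟩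
  · rintro ⟨h1, h2, h3, h4⟩
    exact ⟨(t, s), ⟨h2, h1, h3.symm, fun h => h4 h.symm⟩, rfl⟩

section
variable {V N : Type*} {G : SimpleGraph V} [Finite N]

/-- The weighted number of crossings with edges of `F` on the part of `e` in `X`. -/
noncomputable def PreDrawing.load (K : PreDrawing G N) (w : Sym2 V → ℝ) (F : Finset (Sym2 V))
    (e : Sym2 V) (X : Set Plane) : ℝ :=
  ∑ g ∈ F, w g * ((K.pairsIn e g X).ncard : ℝ)

theorem PreDrawing.load_mono (K : PreDrawing G N) {w : Sym2 V → ℝ} (hw : ∀ e, 0 ≤ w e)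
    (F : Finset (Sym2 V)) (e : Sym2 V) {X Y : Set Plane} (h : X ⊆ Y) :
    K.load w F e X ≤ K.load w F e Y := by
  refine Finset.sum_le_sum fun g _ => mul_le_mul_of_nonneg_left ?_ (hw g)
  have : K.pairsIn e g X ⊆ K.pairsIn e g Y := fun z hz =>
    ⟨hz.1, hz.2.imp fun q hq => ⟨h hq.1, hq.2⟩⟩
  exact_mod_cast ncard_le_ncard this (toFinite _)

variable [Fintype V] {K : PolyDrawing G N} {v a b : V} {w : Sym2 V → ℝ}

-- Rerouting changes only pairs containing `vb`. Against the other edges, `hle` says that the new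
-- initial part costs no more than the old one; against `va` at least one crossing is saved, worth
-- the product of the two weights.
open Classical in
theorem Meeting.exists_cost_le (M : Meeting K v a b) (hw : ∀ e, 0 ≤ w e)
    (hfirst : ∀ q ∈ M.A.pre M.i M.p, q ∈ K.curve s(v, b) → q = K.P (K.vert v) ∨ q = M.p)
    (hle : K.load w ((G.edgeFinset.erase s(v, a)).erase s(v, b)) s(v, a) (M.A.pre M.i M.p) ≤
      K.load w ((G.edgeFinset.erase s(v, a)).erase s(v, b)) s(v, b) (M.B.pre M.j M.p)) :
    ∃ K' : PreDrawing G (N ⊕ Option N), K'.cost w ≤ K.cost w - w s(v, a) * w s(v, b) := by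
  obtain ⟨ε, hε⟩ := M.exists_good hfirst
  refine ⟨M.reroute hε, ?_⟩
  have heE : s(v, a) ∈ G.edgeFinset := by simpa using M.adjA
  have hfE : s(v, b) ∈ G.edgeFinset := by simpa using M.adjB
  let d : Sym2 V → Sym2 V → ℝ := fun g h => w g * w h * (((M.reroute hε).pairs g h).ncard : ℝ) -
    w g * w h * ((K.pairs g h).ncard : ℝ)
  have hd : ∀ g h, d g h = w g * w h * ((((M.reroute hε).pairs g h).ncard : ℝ) -
    ((K.pairs g h).ncard : ℝ)) := fun g h => (mul_sub _ _ _).symm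
  have h1 : (M.reroute hε).cost w - K.cost w =
      (∑ g ∈ G.edgeFinset, ∑ h ∈ G.edgeFinset.erase g, d g h) / 2 := by
    simp only [PreDrawing.cost, d, Finset.sum_sub_distrib]
    ring
  have h2 : ∑ g ∈ G.edgeFinset, ∑ h ∈ G.edgeFinset.erase g, d g h ≤
      2 * ∑ h ∈ G.edgeFinset.erase s(v, b), d s(v, b) h := by
    refine sum_erase_le_of_le hfE (fun g h => ?_) fun g _ h _ hg hh => ?_
    · rw [hd, hd, mul_comm (w g), PreDrawing.ncard_pairs_comm _ g h,
        K.toPreDrawing.ncard_pairs_comm g h]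
    · rw [hd]
      refine mul_nonpos_of_nonneg_of_nonpos (mul_nonneg (hw _) (hw _)) (sub_nonpos.2 ?_)
      exact_mod_cast M.ncard_reroute_other hε hg hh
  have h3 : d s(v, b) s(v, a) ≤ - (w s(v, a) * w s(v, b)) := by
    have : ((((M.reroute hε).pairs s(v, b) s(v, a)).ncard : ℝ)) + 1 ≤
        ((K.pairs s(v, b) s(v, a)).ncard : ℝ) := by
      exact_mod_cast M.ncard_reroute_self hε
    rw [hd]
    nlinarith [mul_nonneg (hw s(v, a)) (hw s(v, b))]
  have h4 : ∑ h ∈ (G.edgeFinset.erase s(v, a)).erase s(v, b), d s(v, b) h ≤ w s(v, b) *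
      (K.load w ((G.edgeFinset.erase s(v, a)).erase s(v, b)) s(v, a) (M.A.pre M.i M.p) -
      K.load w ((G.edgeFinset.erase s(v, a)).erase s(v, b)) s(v, b) (M.B.pre M.j M.p)) := by
    rw [PreDrawing.load, PreDrawing.load, ← Finset.sum_sub_distrib, Finset.mul_sum]
    refine Finset.sum_le_sum fun g hg => ?_
    simp only [Finset.mem_erase, SimpleGraph.mem_edgeFinset] at hg
    rw [hd, ← mul_sub, ← mul_assoc]
    refine mul_le_mul_of_nonneg_left ?_ (mul_nonneg (hw _) (hw _))
    have k1 := M.ncard_reroute hε hg.2.2 hg.2.1 hg.1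
    have k2 := ncard_sdiff_add_ncard_of_subset
      (s := K.pairsIn s(v, b) g (M.B.pre M.j M.p)) (t := K.pairs s(v, b) g)
      (fun z hz => hz.1) (toFinite _)
    have k3 : ((((M.reroute hε).pairs s(v, b) g).ncard : ℝ)) +
        ((K.pairsIn s(v, b) g (M.B.pre M.j M.p)).ncard : ℝ) ≤
        ((K.pairsIn s(v, a) g (M.A.pre M.i M.p)).ncard : ℝ) + ((K.pairs s(v, b) g).ncard : ℝ) := by
      exact_mod_cast (by omega)
    linarith
  have h5 := mul_nonpos_of_nonneg_of_nonpos (hw s(v, b)) (sub_nonpos.2 hle)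
  rw [← Finset.add_sum_erase (G.edgeFinset.erase s(v, b)) _
    (Finset.mem_erase.2 ⟨M.edge_ne, heE⟩), Finset.erase_right_comm] at h2
  linarith

/-- Crossings of adjacent edges can be removed. -/
theorem PolyDrawing.exists_cost_le (K : PolyDrawing G N) (hw : ∀ e, 0 ≤ w e) (ha : G.Adj v a)
    (hb : G.Adj v b) (hab : a ≠ b) (hne : (K.pairs s(v, a) s(v, b)).Nonempty) :
    ∃ K' : PreDrawing G (N ⊕ Option N), K'.cost w ≤ K.cost w - w s(v, a) * w s(v, b) := by
  classical
  obtain ⟨A⟩ := K.nonempty_laneSeq ha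
  obtain ⟨B⟩ := K.nonempty_laneSeq hb
  obtain ⟨⟨s, t⟩, hs, ht, hst, hd⟩ := hne
  obtain ⟨i₀, hi₀, rfl⟩ := (A.mem_iff s).1 hs
  obtain ⟨j₀, hj₀, rfl⟩ := (B.mem_iff t).1 ht
  obtain ⟨p₀, h1, h2⟩ := Set.not_disjoint_iff.1 hd
  have hc : A.Cross B i₀ j₀ p₀ := ⟨hi₀, hj₀, h1, h2, hst⟩
  obtain ⟨i, j, p, hp, hmin, hfirst⟩ := A.exists_first_cross B ha hb hab ⟨_, _, _, hc⟩
  obtain ⟨j', i', p', hp', hmin', hfirst'⟩ :=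
    B.exists_first_cross A hb ha hab.symm ⟨_, _, _, hc.symm⟩
  -- The first crossing `p` along `va` and the first crossing `p'` along `vb` may differ; `vb` is
  -- rerouted at `p` if this is affordable, otherwise `va` at `p'`.
  by_cases hle : K.load w ((G.edgeFinset.erase s(v, a)).erase s(v, b)) s(v, a) (A.pre i p) ≤
      K.load w ((G.edgeFinset.erase s(v, a)).erase s(v, b)) s(v, b) (B.pre j p)
  · exact (hp.meeting ha hb hab).exists_cost_le hw hfirst hle
  · rw [mul_comm]
    refine (hp'.meeting hb ha hab.symm).exists_cost_le hw hfirst' ?_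
    rw [Finset.erase_right_comm]
    -- The initial part of `vb` up to `p'` lies in that up to `p`, and the initial part of `va` up
    -- to `p` in that up to `p'`, so the failed inequality at `p` gives the reversed one at `p'`.
    exact (K.load_mono hw _ _ (hmin' _ _ _ hp.symm)).trans
      ((not_le.1 hle).le.trans (K.load_mono hw _ _ (hmin _ _ _ hp'.symm)))

end
end CrossingNumber

namespace CrossingNumber
open Set Filter Topology
universe u

/-! ### Crossing numbers by polygonal drawings -/

section
variable {V : Type u} [Fintype V] (G : EdgeWeightedGraph V)

theorem drawingCr_nonneg (D : Drawing G.graph) : 0 ≤ G.drawingCr D :=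
  div_nonneg (Finset.sum_nonneg fun _ _ => Finset.sum_nonneg fun _ _ =>
    mul_nonneg (mul_nonneg (G.weight_nonneg _) (G.weight_nonneg _)) (Nat.cast_nonneg _)) zero_le_two

theorem cr_le_drawingCr (D : Drawing G.graph) : G.cr ≤ G.drawingCr D :=
  csInf_le ⟨0, by rintro _ ⟨D, rfl⟩; exact drawingCr_nonneg G D⟩ (mem_range_self D)

theorem cr_le_cost {N : Type*} [Finite N] (K : PreDrawing G.graph N) : G.cr ≤ K.cost G.weight := by
  classical
  obtain ⟨K', hK'⟩ := K.exists_poly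
  refine (cr_le_drawingCr G K'.toDrawing).trans ?_
  unfold EdgeWeightedGraph.drawingCr PreDrawing.cost
  gcongr with e he f hf
  · exact mul_nonneg (G.weight_nonneg _) (G.weight_nonneg _)
  · rw [SimpleGraph.mem_edgeFinset] at he
    rw [Finset.mem_erase, SimpleGraph.mem_edgeFinset] at hf
    exact (K'.ncard_crossings_toDrawing_le he hf.2 hf.1.symm).trans
      (ncard_le_ncard (hK' e he f hf.2) (toFinite _))

theorem exists_cost_le_drawingCr (D : Drawing G.graph) :
    ∃ (N : Type u) (_ : Finite N) (K : PolyDrawing G.graph N),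
      K.cost G.weight ≤ G.drawingCr D := by
  classical
  obtain ⟨N, hN, K, hK⟩ := exists_polyDrawing D
  refine ⟨N, hN, K, ?_⟩
  unfold EdgeWeightedGraph.drawingCr PreDrawing.cost
  gcongr with e he f hf
  · exact mul_nonneg (G.weight_nonneg _) (G.weight_nonneg _)
  · rw [SimpleGraph.mem_edgeFinset] at he
    rw [Finset.mem_erase, SimpleGraph.mem_edgeFinset] at hf
    exact hK e he f hf.2 hf.1.symm

/-- One segment per edge, with all nodes at the origin, already satisfies the conditions of a
`PreDrawing`; perturbation does the rest. This makes the infimum that defines `cr` one over a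
nonempty set. -/
theorem nonempty_drawing : Nonempty (Drawing G.graph) := by
  let K : PreDrawing G.graph V :=
    { vert := id
      P := fun _ => 0
      S := fun e => {e}
      vert_inj := Function.injective_id
      reach := fun u v _ => Relation.ReflTransGen.single rfl
      common := by
        rintro e - f - - _ rfl _ rfl n h1 h2
        exact ⟨n, h1, h2, rfl⟩
      vert_mem := by
        rintro e - _ rfl v h
        exact h
      simple := by
        rintro e - _ rfl _ rfl h
        exact (h _ (Sym2.out_fst_mem _) (Sym2.out_fst_mem _)).elim }
  obtain ⟨K', -⟩ := K.exists_poly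
  exact ⟨K'.toDrawing⟩

theorem exists_cost_lt {ε : ℝ} (hε : 0 < ε) :
    ∃ (N : Type u) (_ : Finite N) (K : PolyDrawing G.graph N), K.cost G.weight < G.cr + ε := by
  have := nonempty_drawing G
  obtain ⟨_, ⟨D, rfl⟩, hD⟩ := exists_lt_of_csInf_lt
    (s := range fun D : Drawing G.graph => G.drawingCr D) (range_nonempty _)
    (lt_add_of_pos_right G.cr hε)
  obtain ⟨N, hN, K, hK⟩ := exists_cost_le_drawingCr G D
  exact ⟨N, hN, K, hK.trans_lt hD⟩

theorem exists_cost_lt_of_adjacent {ε : ℝ} (hε : 0 < ε) :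
    ∃ (N : Type u) (_ : Finite N) (K : PolyDrawing G.graph N), K.cost G.weight < G.cr + ε ∧
      ∀ e ∈ G.graph.edgeSet, ∀ f ∈ G.graph.edgeSet, e ≠ f → (∃ v, v ∈ e ∧ v ∈ f) →
        0 < G.weight e * G.weight f → K.pairs e f = ∅ := by
  -- There are finitely many edges, so some `δ > 0` lies below all positive products of two weights;
  -- removing a crossing of adjacent edges would then push the cost below `cr`.
  have hδ : ∀ᶠ δ in 𝓝[>] (0 : ℝ), ∀ e f, 0 < G.weight e * G.weight f →
      δ < G.weight e * G.weight f := by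
    simp only [eventually_all]
    exact fun e f h => (eventually_lt_nhds h).filter_mono nhdsWithin_le_nhds
  obtain ⟨δ, hδ, h0⟩ := (hδ.and self_mem_nhdsWithin).exists
  have h0 : 0 < δ := h0
  obtain ⟨N, hN, K, hK⟩ := exists_cost_lt G (lt_min hε h0)
  refine ⟨N, hN, K, hK.trans_le (by gcongr; exact min_le_left _ _), ?_⟩
  rintro e he f hf hef ⟨v, h1, h2⟩ hw
  by_contra hne
  obtain ⟨a, rfl⟩ := Sym2.mem_iff_exists.1 h1
  obtain ⟨b, rfl⟩ := Sym2.mem_iff_exists.1 h2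
  obtain ⟨K', hK'⟩ := K.exists_cost_le G.weight_nonneg he hf
    (fun h => hef (congrArg (fun x => s(v, x)) h)) (nonempty_iff_ne_empty.2 hne)
  have := cr_le_cost G K'
  have := hδ _ _ hw
  linarith [min_le_right ε δ]

end

/-! ### Sums over the edges of a blow-up -/

section
variable {V : Type u} [Fintype V]

omit [Fintype V] in
theorem sum_fiber (G : SimpleGraph V) {m : ℕ} [DecidableEq (Sym2 V)]
    [Fintype (G.comap (Prod.fst : V × Fin m → V)).edgeSet] {a b : V} (h : G.Adj a b)
    (X : Sym2 (V × Fin m) → ℝ) :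
    ∑ e ∈ (G.comap (Prod.fst : V × Fin m → V)).edgeFinset with e.map Prod.fst = s(a, b), X e =
      ∑ i, ∑ j, X s((a, i), (b, j)) := by
  rw [← Fintype.sum_prod_type' (f := fun i j => X s((a, i), (b, j)))]
  symm
  refine Finset.sum_bij (fun z _ => s((a, z.1), (b, z.2))) ?_ ?_ ?_ fun _ _ => rfl
  · rintro ⟨i, j⟩ -
    simpa using h
  · rintro ⟨i, j⟩ - ⟨i', j'⟩ - hz
    have := h.ne
    simp only [Sym2.eq_iff, Prod.mk.injEq] at hz
    rcases hz with ⟨⟨-, rfl⟩, ⟨-, rfl⟩⟩ | ⟨⟨h, -⟩, -⟩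
    · rfl
    · exact (this h).elim
  · intro e he
    rw [Finset.mem_filter] at he
    obtain ⟨-, he⟩ := he
    induction e using Sym2.ind with
    | _ x y =>
      rcases Sym2.eq_iff.1 he with ⟨h1, h2⟩ | ⟨h1, h2⟩
      · exact ⟨(x.2, y.2), Finset.mem_univ _, by rw [← h1, ← h2]⟩
      · exact ⟨(y.2, x.2), Finset.mem_univ _, by rw [← h1, ← h2, Sym2.eq_swap]⟩

omit [Fintype V] in
theorem sum_comap (G : SimpleGraph V) [Fintype G.edgeSet] {m : ℕ} [DecidableEq (Sym2 V)]
    [Fintype (G.comap (Prod.fst : V × Fin m → V)).edgeSet] (X : Sym2 (V × Fin m) → ℝ) :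
    ∑ e ∈ (G.comap (Prod.fst : V × Fin m → V)).edgeFinset, X e = ∑ e ∈ G.edgeFinset,
      ∑ e' ∈ (G.comap (Prod.fst : V × Fin m → V)).edgeFinset with e'.map Prod.fst = e, X e' := by
  refine (Finset.sum_fiberwise_of_maps_to (fun e he => ?_) X).symm
  rw [SimpleGraph.mem_edgeFinset] at he ⊢
  exact mem_edgeSet_comap.1 he

omit [Fintype V] in
theorem sum_comap_map (G : SimpleGraph V) [Fintype G.edgeSet] {m : ℕ}
    [Fintype (G.comap (Prod.fst : V × Fin m → V)).edgeSet] (X : Sym2 V → ℝ) :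
    ∑ e ∈ (G.comap (Prod.fst : V × Fin m → V)).edgeFinset, X (e.map Prod.fst) =
      (m : ℝ) ^ 2 * ∑ e ∈ G.edgeFinset, X e := by
  classical
  rw [sum_comap, Finset.mul_sum]
  refine Finset.sum_congr rfl fun e he => ?_
  induction e using Sym2.ind with
  | _ a b =>
    rw [sum_fiber G (by simpa using he)]
    simp only [Sym2.map_mk, Finset.sum_const, Finset.card_univ, Fintype.card_fin, nsmul_eq_mul]
    ring

/-- Exchanging the value of `φ` at `a` with the extra value `i` is an involution on pairs `(i, φ)`.
-/
theorem mul_sum_eq_sum_update [DecidableEq V] {m : ℕ} (a : V) (H : (V → Fin m) → ℝ) :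
    (m : ℝ) * ∑ φ, H φ = ∑ i, ∑ φ, H (Function.update φ a i) := by
  have hinv : Function.Involutive fun z : Fin m × (V → Fin m) =>
      (z.2 a, Function.update z.2 a z.1) := by
    rintro ⟨i, φ⟩
    simp
  rw [← Fintype.sum_prod_type' (f := fun i φ => H (Function.update φ a i)),
    ← Equiv.sum_comp (hinv.toPerm _)]
  simp [Function.Involutive.coe_toPerm, Fintype.sum_prod_type]

/-- The values of a random `φ` at four distinct vertices are independent and uniform. They are freed
one at a time, each at the price of a factor `m`. -/
theorem pow_mul_sum_eq [DecidableEq V] {m : ℕ} {a b c d : V} (hab : a ≠ b) (hac : a ≠ c)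
    (had : a ≠ d) (hbc : b ≠ c) (hbd : b ≠ d) (hcd : c ≠ d)
    (F : Fin m → Fin m → Fin m → Fin m → ℝ) :
    (m : ℝ) ^ 4 * ∑ φ : V → Fin m, F (φ a) (φ b) (φ c) (φ d) =
      (m : ℝ) ^ Fintype.card V * ∑ i, ∑ j, ∑ k, ∑ l, F i j k l := by
  have k1 : ∀ i j k, (m : ℝ) ^ 1 * ∑ φ : V → Fin m, F i j k (φ d) =
      ∑ l, (m : ℝ) ^ Fintype.card V * F i j k l := by
    intro i j k
    rw [pow_one, mul_sum_eq_sum_update d]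
    simp
  have k2 : ∀ i j, (m : ℝ) ^ 2 * ∑ φ : V → Fin m, F i j (φ c) (φ d) =
      ∑ k, ∑ l, (m : ℝ) ^ Fintype.card V * F i j k l := by
    intro i j
    rw [pow_succ, mul_assoc, mul_sum_eq_sum_update c, Finset.mul_sum]
    simp only [Function.update_self, Function.update_of_ne hcd.symm, k1]
  have k3 : ∀ i, (m : ℝ) ^ 3 * ∑ φ : V → Fin m, F i (φ b) (φ c) (φ d) =
      ∑ j, ∑ k, ∑ l, (m : ℝ) ^ Fintype.card V * F i j k l := by
    intro i
    rw [pow_succ, mul_assoc, mul_sum_eq_sum_update b, Finset.mul_sum]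
    simp only [Function.update_self, Function.update_of_ne hbc.symm,
      Function.update_of_ne hbd.symm, k2]
  rw [pow_succ, mul_assoc, mul_sum_eq_sum_update a, Finset.mul_sum]
  simp only [Function.update_self, Function.update_of_ne hab.symm,
    Function.update_of_ne hac.symm, Function.update_of_ne had.symm, k3, Finset.mul_sum]

/-- Counting by the common vertex turns the sum into the sum of the squared degrees. -/
theorem sum_sum_common_le (G : SimpleGraph V) [Fintype G.edgeSet] :
    ∑ e ∈ G.edgeFinset, ∑ f ∈ G.edgeFinset, (({v | v ∈ e ∧ v ∈ f}.ncard : ℕ) : ℝ) ≤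
      (Fintype.card V : ℝ) ^ 3 := by
  classical
  have h1 : ∀ e f : Sym2 V, (({v | v ∈ e ∧ v ∈ f}.ncard : ℕ) : ℝ) =
      ∑ v : V, (if v ∈ e then 1 else 0) * (if v ∈ f then 1 else 0) := by
    intro e f
    rw [ncard_eq_toFinset_card']
    simp only [← ite_and, mul_ite, mul_one, mul_zero]
    rw [← Finset.sum_filter, Finset.sum_const, nsmul_one]
    congr 2
    ext v
    simp [and_comm]
  have h2 : ∀ v : V, ∑ e ∈ G.edgeFinset, (if v ∈ e then (1 : ℝ) else 0) ≤ Fintype.card V := by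
    intro v
    rw [← Finset.sum_filter, Finset.sum_const, nsmul_one]
    have : (G.edgeFinset.filter (v ∈ ·)).card = G.degree v := by
      rw [← SimpleGraph.card_incidenceFinset_eq_degree, SimpleGraph.incidenceFinset_eq_filter]
    rw [this]
    exact_mod_cast (G.degree_lt_card_verts v).le
  calc ∑ e ∈ G.edgeFinset, ∑ f ∈ G.edgeFinset, (({v | v ∈ e ∧ v ∈ f}.ncard : ℕ) : ℝ)
      = ∑ v : V, (∑ e ∈ G.edgeFinset, (if v ∈ e then (1 : ℝ) else 0)) *
          ∑ f ∈ G.edgeFinset, (if v ∈ f then (1 : ℝ) else 0) := by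
        simp only [h1, Finset.sum_mul_sum]
        rw [Finset.sum_comm (s := Finset.univ)]
        exact Finset.sum_congr rfl fun e _ => Finset.sum_comm
    _ ≤ ∑ v : V, (Fintype.card V : ℝ) * Fintype.card V :=
        Finset.sum_le_sum fun v _ => mul_le_mul (h2 v) (h2 v)
          (Finset.sum_nonneg fun _ _ => by split_ifs <;> norm_num) (Nat.cast_nonneg _)
    _ = (Fintype.card V : ℝ) ^ 3 := by
        rw [Finset.sum_const, Finset.card_univ, nsmul_eq_mul]
        ring

end

/-! ### The two bounds for the blow-up -/

section
variable {V : Type u} [Fintype V] (G : EdgeWeightedGraph V) (m : ℕ)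

theorem cr_blowup_le_cost {N : Type u} [Finite N] (K : PolyDrawing G.graph N) :
    (G.blowup m).cr ≤ (m : ℝ) ^ 4 * K.cost G.weight + (Fintype.card V : ℝ) ^ 3 * (m : ℝ) ^ 4 := by
  classical
  obtain ⟨N', hN', (K' : PreDrawing (G.blowup m).graph N'), hK'⟩ := K.exists_blowup m
  refine (cr_le_cost (G.blowup m) K').trans ?_
  -- This bound for two copies depends only on their underlying edges, each of which has m² copies.
  -- The diagonal terms `Φ e e` contain no crossings and pay for the common vertices of two copies
  -- of one edge.
  let Φ : Sym2 V → Sym2 V → ℝ := fun e f => G.weight e * G.weight f *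
    ((({z | e ≠ f ∧ z ∈ K.pairs e f}.ncard : ℕ) : ℝ) + (({v | v ∈ e ∧ v ∈ f}.ncard : ℕ) : ℝ))
  have hΦ : ∀ e f, 0 ≤ Φ e f := fun e f =>
    mul_nonneg (mul_nonneg (G.weight_nonneg _) (G.weight_nonneg _)) (by positivity)
  have hE : ∀ X : Sym2 V → ℝ, ∑ e ∈ (G.blowup m).graph.edgeFinset, X (e.map Prod.fst) =
      (m : ℝ) ^ 2 * ∑ e ∈ G.graph.edgeFinset, X e := fun X => sum_comap_map G.graph X
  have h1 : ∑ e ∈ (G.blowup m).graph.edgeFinset, ∑ f ∈ (G.blowup m).graph.edgeFinset.erase e,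
      (G.blowup m).weight e * (G.blowup m).weight f * ((K'.pairs e f).ncard : ℝ) ≤
      (m : ℝ) ^ 4 * ∑ e ∈ G.graph.edgeFinset, ∑ f ∈ G.graph.edgeFinset, Φ e f := by
    calc _ ≤ ∑ e ∈ (G.blowup m).graph.edgeFinset, ∑ f ∈ (G.blowup m).graph.edgeFinset,
          Φ (e.map Prod.fst) (f.map Prod.fst) := by
          refine Finset.sum_le_sum fun e he => (Finset.sum_le_sum fun f hf => ?_).trans
            (Finset.sum_le_sum_of_subset_of_nonneg (Finset.erase_subset _ _) fun _ _ _ => hΦ _ _)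
          rw [SimpleGraph.mem_edgeFinset] at he
          rw [Finset.mem_erase, SimpleGraph.mem_edgeFinset] at hf
          refine mul_le_mul_of_nonneg_left ?_ (mul_nonneg (G.weight_nonneg _) (G.weight_nonneg _))
          exact_mod_cast hK' e he f hf.2 hf.1.symm
      _ = _ := by
          simp only [hE]
          rw [hE fun e => (m : ℝ) ^ 2 * ∑ f ∈ G.graph.edgeFinset, Φ e f, ← Finset.mul_sum]
          ring
  have h2 : ∑ e ∈ G.graph.edgeFinset, ∑ f ∈ G.graph.edgeFinset, Φ e f ≤
      (∑ e ∈ G.graph.edgeFinset, ∑ f ∈ G.graph.edgeFinset.erase e,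
        G.weight e * G.weight f * ((K.pairs e f).ncard : ℝ)) + (Fintype.card V : ℝ) ^ 3 := by
    refine le_trans ?_ (add_le_add_right (sum_sum_common_le G.graph) _)
    rw [← Finset.sum_add_distrib]
    refine Finset.sum_le_sum fun e he => ?_
    simp only [Φ, mul_add, Finset.sum_add_distrib]
    refine add_le_add ?_ (Finset.sum_le_sum fun f _ => ?_)
    · rw [← Finset.add_sum_erase _ _ he]
      simp only [ne_eq, not_true_eq_false, false_and, ofPred_false, ncard_empty, Nat.cast_zero,
        mul_zero, zero_add]
      refine Finset.sum_le_sum fun f hf => ?_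
      simp [(Finset.mem_erase.1 hf).1.symm]
    · exact mul_le_of_le_one_left (Nat.cast_nonneg _)
        (mul_le_one₀ (G.weight_le_one _) (G.weight_nonneg _) (G.weight_le_one _))
  have h3 := h1.trans (mul_le_mul_of_nonneg_left h2 (by positivity))
  have h4 : 0 ≤ (m : ℝ) ^ 4 * (Fintype.card V : ℝ) ^ 3 := by positivity
  rw [PreDrawing.cost_eq, PreDrawing.cost_eq]
  linarith

variable {G m}

/-- The copy of an edge that joins the copies `φ v` of its ends. -/
def selectEdge (φ : V → Fin m) (e : Sym2 V) : Sym2 (V × Fin m) := e.map fun v => (v, φ v)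

omit [Fintype V] in
theorem map_selectEdge (φ : V → Fin m) (e : Sym2 V) : (selectEdge φ e).map Prod.fst = e := by
  rw [selectEdge, Sym2.map_map]
  exact congrFun Sym2.map_id' e

omit [Fintype V] in
theorem selectEdge_mem (φ : V → Fin m) {e : Sym2 V} (he : e ∈ G.graph.edgeSet) :
    selectEdge φ e ∈ (G.blowup m).graph.edgeSet :=
  mem_edgeSet_comap.2 ((map_selectEdge φ e).symm ▸ he)

omit [Fintype V] in
theorem fst_mem_of_mem_selectEdge {φ : V → Fin m} {e : Sym2 V} {z : V × Fin m}
    (hz : z ∈ selectEdge φ e) : z.1 ∈ e ∧ z = (z.1, φ z.1) := by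
  obtain ⟨v, hv, rfl⟩ := Sym2.mem_map.1 hz
  exact ⟨hv, rfl⟩

omit [Fintype V] in
theorem selectEdge_injective (φ : V → Fin m) : Function.Injective (selectEdge φ) := fun e f h => by
  rw [← map_selectEdge φ e, h, map_selectEdge]

/-- The drawing of `G` that uses the copy `φ v` of each vertex `v` in a drawing of a blow-up. -/
def PreDrawing.select {N : Type*} (K : PreDrawing (G.blowup m).graph N)
    (φ : V → Fin m) : PreDrawing G.graph N where
  vert v := K.vert (v, φ v)
  P := K.P
  S e := K.S (selectEdge φ e)
  vert_inj u v h := congrArg Prod.fst (K.vert_inj h)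
  reach u v h := K.reach (u, φ u) (v, φ v) h
  common e he f hf hef s hs t ht n h1 h2 := by
    obtain ⟨z, z1, z2, rfl⟩ := K.common _ (selectEdge_mem φ he) _ (selectEdge_mem φ hf)
      ((selectEdge_injective φ).ne hef) s hs t ht n h1 h2
    obtain ⟨k1, k2⟩ := fst_mem_of_mem_selectEdge z1
    exact ⟨z.1, k1, (fst_mem_of_mem_selectEdge z2).1, congrArg K.vert k2⟩
  vert_mem e he s hs v hv :=
    (fst_mem_of_mem_selectEdge (K.vert_mem _ (selectEdge_mem φ he) s hs _ hv)).1
  simple e he := K.simple _ (selectEdge_mem φ he)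

open Classical in
/-- The average over the choices of copies of two disjoint edges. -/
theorem pow_mul_sum_selectEdge {e f : Sym2 V} (he : e ∈ G.graph.edgeSet)
    (hf : f ∈ G.graph.edgeSet) (hef : ∀ v ∈ e, v ∉ f)
    (c : Sym2 (V × Fin m) → Sym2 (V × Fin m) → ℝ) :
    (m : ℝ) ^ 4 * ∑ φ : V → Fin m, c (selectEdge φ e) (selectEdge φ f) =
      (m : ℝ) ^ Fintype.card V * ∑ e' ∈ (G.blowup m).graph.edgeFinset with e'.map Prod.fst = e,
        ∑ f' ∈ (G.blowup m).graph.edgeFinset with f'.map Prod.fst = f, c e' f' := by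
  induction e using Sym2.ind with
  | _ a b =>
  induction f using Sym2.ind with
  | _ x y =>
  have h1 := hef a (Sym2.mem_mk_left _ _)
  have h2 := hef b (Sym2.mem_mk_right _ _)
  simp only [Sym2.mem_iff, not_or] at h1 h2
  have k1 : ∀ X : Sym2 (V × Fin m) → ℝ,
      ∑ e' ∈ (G.blowup m).graph.edgeFinset with e'.map Prod.fst = s(a, b), X e' =
        ∑ i, ∑ j, X s((a, i), (b, j)) := fun X => sum_fiber G.graph he X
  have k2 : ∀ X : Sym2 (V × Fin m) → ℝ,
      ∑ e' ∈ (G.blowup m).graph.edgeFinset with e'.map Prod.fst = s(x, y), X e' =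
        ∑ i, ∑ j, X s((x, i), (y, j)) := fun X => sum_fiber G.graph hf X
  simp only [k1, k2]
  exact pow_mul_sum_eq (SimpleGraph.Adj.ne he) h1.1 h1.2 h2.1 h2.2 (SimpleGraph.Adj.ne hf)
    fun i j k l => c s((a, i), (b, j)) s((x, k), (y, l))

variable (G m)

/-- Every selection `φ` gives a drawing of `G`, so `cr G` is at most the average cost of a
selection. Pairs of copies of disjoint edges survive in a fraction m⁻⁴ of the selections, and copies
of adjacent edges with positive weight product do not cross. -/
theorem le_cr_blowup (hm : 1 ≤ m) : (m : ℝ) ^ 4 * G.cr ≤ (G.blowup m).cr := by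
  classical
  refine le_of_forall_pos_le_add fun ε hε => ?_
  obtain ⟨N, hN, K, hK, hadj⟩ := exists_cost_lt_of_adjacent (G.blowup m) hε
  let c : Sym2 (V × Fin m) → Sym2 (V × Fin m) → ℝ := fun e f => ((K.pairs e f).ncard : ℝ)
  have hc : ∀ e f, 0 ≤ c e f := fun e f => Nat.cast_nonneg _
  have hw : ∀ e f, 0 ≤ G.weight e * G.weight f := fun e f =>
    mul_nonneg (G.weight_nonneg _) (G.weight_nonneg _)
  let B : Sym2 V → Finset (Sym2 (V × Fin m)) := fun e =>
    {e' ∈ (G.blowup m).graph.edgeFinset | e'.map Prod.fst = e}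
  have hB : ∀ {e e'}, e' ∈ B e ↔ e' ∈ (G.blowup m).graph.edgeFinset ∧ e'.map Prod.fst = e :=
    Finset.mem_filter
  have key : ∀ e ∈ G.graph.edgeFinset, ∀ f ∈ G.graph.edgeFinset.erase e,
      (m : ℝ) ^ 4 * ∑ φ : V → Fin m, G.weight e * G.weight f *
        c (selectEdge φ e) (selectEdge φ f) ≤ (m : ℝ) ^ Fintype.card V *
        ∑ e' ∈ B e, ∑ f' ∈ B f, (G.blowup m).weight e' * (G.blowup m).weight f' * c e' f' := by
    intro e he f hf
    rw [SimpleGraph.mem_edgeFinset] at he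
    rw [Finset.mem_erase, SimpleGraph.mem_edgeFinset] at hf
    have hr : ∑ e' ∈ B e, ∑ f' ∈ B f, (G.blowup m).weight e' * (G.blowup m).weight f' * c e' f' =
        G.weight e * G.weight f * ∑ e' ∈ B e, ∑ f' ∈ B f, c e' f' := by
      simp only [Finset.mul_sum]
      refine Finset.sum_congr rfl fun e' he' => Finset.sum_congr rfl fun f' hf' => ?_
      simp only [EdgeWeightedGraph.blowup, (hB.1 he').2, (hB.1 hf').2]
    rw [hr, ← Finset.mul_sum, mul_left_comm, mul_left_comm _ (G.weight e * G.weight f)]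
    rcases (hw e f).eq_or_lt with h0 | h0
    · rw [← h0, zero_mul, zero_mul]
    refine mul_le_mul_of_nonneg_left ?_ h0.le
    by_cases hef : ∃ v, v ∈ e ∧ v ∈ f
    · obtain ⟨v, h1, h2⟩ := hef
      have hzero : ∀ φ : V → Fin m, c (selectEdge φ e) (selectEdge φ f) = 0 := by
        intro φ
        have := hadj _ (selectEdge_mem φ he) _ (selectEdge_mem φ hf.2)
          ((selectEdge_injective φ).ne hf.1.symm)
          ⟨(v, φ v), Sym2.mem_map.2 ⟨v, h1, rfl⟩, Sym2.mem_map.2 ⟨v, h2, rfl⟩⟩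
          (by simpa only [EdgeWeightedGraph.blowup, map_selectEdge] using h0)
        simp [c, this]
      simp only [hzero, Finset.sum_const_zero, mul_zero]
      exact mul_nonneg (by positivity)
        (Finset.sum_nonneg fun _ _ => Finset.sum_nonneg fun _ _ => hc _ _)
    · push Not at hef
      exact (pow_mul_sum_selectEdge he hf.2 hef c).le
  -- Grouping by underlying edges omits only the pairs of copies of one edge, whose terms are
  -- nonnegative.
  have hsum : ∑ e ∈ G.graph.edgeFinset, ∑ f ∈ G.graph.edgeFinset.erase e, ∑ e' ∈ B e,
      ∑ f' ∈ B f, (G.blowup m).weight e' * (G.blowup m).weight f' * c e' f' ≤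
      ∑ e' ∈ (G.blowup m).graph.edgeFinset, ∑ f' ∈ (G.blowup m).graph.edgeFinset.erase e',
        (G.blowup m).weight e' * (G.blowup m).weight f' * c e' f' := by
    have hE := sum_comap (m := m) G.graph fun e' =>
      ∑ f' ∈ (G.blowup m).graph.edgeFinset.erase e',
        (G.blowup m).weight e' * (G.blowup m).weight f' * c e' f'
    refine le_of_le_of_eq ?_ hE.symm
    refine Finset.sum_le_sum fun e he => ?_
    rw [Finset.sum_comm]
    refine Finset.sum_le_sum fun e' he' => ?_
    rw [← Finset.sum_biUnion]
    · refine Finset.sum_le_sum_of_subset_of_nonneg ?_ fun _ _ _ =>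
        mul_nonneg (mul_nonneg ((G.blowup m).weight_nonneg _) ((G.blowup m).weight_nonneg _))
          (hc _ _)
      intro f' hf'
      obtain ⟨f, hf, hf'⟩ := Finset.mem_biUnion.1 hf'
      refine Finset.mem_erase.2 ⟨?_, (hB.1 hf').1⟩
      rintro rfl
      exact (Finset.mem_erase.1 hf).1 ((hB.1 hf').2.symm.trans (hB.1 he').2)
    · intro f _ f₂ _ hne
      refine Finset.disjoint_left.2 fun g h1 h2 => hne ?_
      rw [← (hB.1 h1).2, (hB.1 h2).2]
  have hselect : ∀ φ : V → Fin m, G.cr ≤ (∑ e ∈ G.graph.edgeFinset,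
      ∑ f ∈ G.graph.edgeFinset.erase e, G.weight e * G.weight f *
        c (selectEdge φ e) (selectEdge φ f)) / 2 := fun φ => cr_le_cost G (K.select φ)
  have htotal : (m : ℝ) ^ Fintype.card V * ((m : ℝ) ^ 4 * G.cr) ≤
      (m : ℝ) ^ Fintype.card V * K.cost (G.blowup m).weight := by
    calc (m : ℝ) ^ Fintype.card V * ((m : ℝ) ^ 4 * G.cr)
        = (m : ℝ) ^ 4 * ∑ φ : V → Fin m, G.cr := by
          simp only [Finset.sum_const, Finset.card_univ, Fintype.card_fun, Fintype.card_fin,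
            nsmul_eq_mul, Nat.cast_pow]
          ring
      _ ≤ (m : ℝ) ^ 4 * ∑ φ : V → Fin m, (∑ e ∈ G.graph.edgeFinset,
          ∑ f ∈ G.graph.edgeFinset.erase e, G.weight e * G.weight f *
            c (selectEdge φ e) (selectEdge φ f)) / 2 :=
          mul_le_mul_of_nonneg_left (Finset.sum_le_sum fun φ _ => hselect φ) (by positivity)
      _ = (∑ e ∈ G.graph.edgeFinset, ∑ f ∈ G.graph.edgeFinset.erase e, (m : ℝ) ^ 4 *
          ∑ φ : V → Fin m, G.weight e * G.weight f *
            c (selectEdge φ e) (selectEdge φ f)) / 2 := by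
          rw [← Finset.sum_div, mul_div_assoc', Finset.sum_comm, Finset.mul_sum]
          congr 1
          refine Finset.sum_congr rfl fun e _ => ?_
          rw [Finset.sum_comm, Finset.mul_sum]
      _ ≤ (∑ e ∈ G.graph.edgeFinset, ∑ f ∈ G.graph.edgeFinset.erase e,
          (m : ℝ) ^ Fintype.card V * ∑ e' ∈ B e, ∑ f' ∈ B f,
            (G.blowup m).weight e' * (G.blowup m).weight f' * c e' f') / 2 := by
          refine div_le_div_of_nonneg_right ?_ zero_le_two
          exact Finset.sum_le_sum fun e he => Finset.sum_le_sum fun f hf => key e he f hf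
      _ = (m : ℝ) ^ Fintype.card V * ((∑ e ∈ G.graph.edgeFinset,
          ∑ f ∈ G.graph.edgeFinset.erase e, ∑ e' ∈ B e, ∑ f' ∈ B f,
            (G.blowup m).weight e' * (G.blowup m).weight f' * c e' f') / 2) := by
          simp only [← Finset.mul_sum]
          ring
      _ ≤ (m : ℝ) ^ Fintype.card V * K.cost (G.blowup m).weight := by
          rw [PreDrawing.cost_eq]
          exact mul_le_mul_of_nonneg_left (div_le_div_of_nonneg_right hsum zero_le_two)
              (by positivity)
  exact (le_of_mul_le_mul_left htotal (pow_pos (by exact_mod_cast hm) _)).trans hK.le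

end
end CrossingNumber

theorem mainTheorem7 {V : Type*} [Fintype V] (G : EdgeWeightedGraph V) (m : ℕ) (hm : 1 ≤ m) :
    0 ≤ (G.blowup m).cr - (m : ℝ) ^ 4 * G.cr ∧
      (G.blowup m).cr - (m : ℝ) ^ 4 * G.cr ≤ (Fintype.card V : ℝ) ^ 3 * (m : ℝ) ^ 4 := by
  refine ⟨sub_nonneg.2 (CrossingNumber.le_cr_blowup G m hm), ?_⟩
  have h4 : (0 : ℝ) < (m : ℝ) ^ 4 := by positivity
  refine le_of_forall_pos_le_add fun ε hε => ?_
  -- The slack is `ε / m ^ 4` because the cost of the drawing of `G` is multiplied by `m ^ 4` in the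
  -- blow-up.
  obtain ⟨N, hN, K, hK⟩ := CrossingNumber.exists_cost_lt G (div_pos hε h4)
  have h1 := CrossingNumber.cr_blowup_le_cost G m K
  have h2 := mul_lt_mul_of_pos_left hK h4
  rw [mul_add, mul_div_cancel₀ _ h4.ne'] at h2
  linarith
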